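/- For a real matrix $M$ let $\|M\|_*$ be the sum of its singular values and $\|M\|_1=\sum_{i,j}|M_{ij}|$. Let $L_0\in\mathbb{R}^{n_1\times n_2}$ ($n_1,n_2\ge 1$) have rank $r$ and reduced singular value decomposition $L_0=U\Sigma V^*$, with $U\in\mathbb{R}^{n_1\times r}$, $V\in\mathbb{R}^{n_2\times r}$ having orthonormal columns. Say that $L_0$ is incoherent with parameter $\mu>0$ if $$\max_i\|U^*e_i\|_2^2\le\frac{\mu r}{n_1},\qquad \max_j\|V^*e_j\|_2^2\le\frac{\mu r}{n_2},\qquad \max_{i,j}|(UV^*)_{ij}|\le\sqrt{\frac{\mu r}{n_1n_2}} .$$ Let $S\in\mathbb{R}^{n_1\times n_2}$ be an arbitrary fixed matrix, let $\Omega$ be uniformly distributed among all sets of $m$ positions $(i,j)$, and let $S_0$ be the matrix obtained from $S$ by setting to zero its entries outside $\Omega$. Principal Component Pursuit (PCP) with parameter $\lambda$ is the problem of minimizing $\|L\|_*+\lambda\|S'\|_1$ over all pairs of $n_1\times n_2$ matrices with $L+S'=L_0+S_0$; it is called exact if $(L_0,S_0)$ is its unique solution. There are numerical constants $c,\rho_r,\rho_s>0$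 (not depending on the dimensions, $\mu$, $m$, $L_0$ or $S$) such that the following holds. (Square case.) If $n_1=n_2=n$, $L_0$ is incoherent with parameter $\mu$, and $$\operatorname{rank}(L_0)\le\rho_r\,n\,\mu^{-1}(\log n)^{-2}\quad\text{and}\quad m\le\rho_s n^2,$$ then PCP with $\lambda=1/\sqrt n$ is exact with probability at least $1-cn^{-10}$ over the choice of $\Omega$. (Rectangular case.) Write $n_{(1)}=\max(n_1,n_2)$ and $n_{(2)}=\min(n_1,n_2)$. If $L_0$ is incoherent with parameter $\mu$, and $$\operatorname{rank}(L_0)\le\rho_r\,n_{(2)}\,\mu^{-1}(\log n_{(1)})^{-2}\quad\text{and}\quad m\le\rho_s n_1n_2,$$ then PCP with $\lambda=1/\sqrt{n_{(1)}}$ is exact with probability at least $1-cn_{(1)}^{-10}$ over the choice of $\Omega$. (The rank conditions are read as $\operatorname{rank}(L_0)\,\mu(\log n)^2\le\rho_r n$ and $\operatorname{rank}(L_0)\,\mu(\log n_{(1)})^2\le\rho_r n_{(2)}$, so that they also make sense when the logarithm vanishes.) -/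

import Mathlib

namespace PCP

noncomputable section

open Matrix

/-- The nuclear norm: the sum of the singular values of the Euclidean operator `ℝ^{n₂} → ℝ^{n₁}`
given by `M` (all singular values of index `≥ n₂` vanish). -/
def nuclearNorm {n₁ n₂ : ℕ} (M : Matrix (Fin n₁) (Fin n₂) ℝ) : ℝ :=
  ∑ i ∈ Finset.range n₂, (Matrix.toEuclideanLin M).singularValues i

/-- The `ℓ₁` norm of a matrix seen as a long vector. -/
def l1Norm {n₁ n₂ : ℕ} (M : Matrix (Fin n₁) (Fin n₂) ℝ) : ℝ :=
  ∑ i, ∑ j, |M i j|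

/-- `(L, S)` solves: minimize `‖L‖_* + lam ‖S‖₁` subject to `L + S = M`. -/
def IsSolution {n₁ n₂ : ℕ} (lam : ℝ) (M L S : Matrix (Fin n₁) (Fin n₂) ℝ) : Prop :=
  L + S = M ∧ ∀ L' S' : Matrix (Fin n₁) (Fin n₂) ℝ, L' + S' = M →
    nuclearNorm L + lam * l1Norm S ≤ nuclearNorm L' + lam * l1Norm S'

/-- Exact recovery: with input `L₀ + S₀`, the pair `(L₀, S₀)` is the one and only solution. -/
def IsExact {n₁ n₂ : ℕ} (lam : ℝ) (L₀ S₀ : Matrix (Fin n₁) (Fin n₂) ℝ) : Prop :=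
  IsSolution lam (L₀ + S₀) L₀ S₀ ∧
    ∀ L S : Matrix (Fin n₁) (Fin n₂) ℝ, IsSolution lam (L₀ + S₀) L S → L = L₀ ∧ S = S₀

/-- `L = U Σ Vᵀ` is a reduced singular value decomposition: orthonormal columns, and as many
positive singular values as the rank of `L`. -/
structure IsSVD {n₁ n₂ : ℕ} (L : Matrix (Fin n₁) (Fin n₂) ℝ)
    (U : Matrix (Fin n₁) (Fin L.rank) ℝ) (σ : Fin L.rank → ℝ)
    (V : Matrix (Fin n₂) (Fin L.rank) ℝ) : Prop where
  orthU : Uᵀ * U = 1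
  orthV : Vᵀ * V = 1
  pos : ∀ k, 0 < σ k
  eq : L = U * Matrix.diagonal σ * Vᵀ

/-- The incoherence conditions with parameter `μ`. The `i`-th row of `U` is `Uᵀ eᵢ`; the quantities
bounded here do not depend on the choice of the singular value decomposition. -/
def Incoherent {n₁ n₂ : ℕ} (L : Matrix (Fin n₁) (Fin n₂) ℝ) (μ : ℝ) : Prop :=
  ∃ (U : Matrix (Fin n₁) (Fin L.rank) ℝ) (σ : Fin L.rank → ℝ)
    (V : Matrix (Fin n₂) (Fin L.rank) ℝ), IsSVD L U σ V ∧
      (∀ i, ∑ k, U i k ^ 2 ≤ μ * L.rank / n₁) ∧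
      (∀ j, ∑ k, V j k ^ 2 ≤ μ * L.rank / n₂) ∧
      ∀ i j, |(U * Vᵀ) i j| ≤ √(μ * L.rank / (n₁ * n₂))

/-- The matrix with the entries of `S` on `Ω` and zeros off `Ω`. -/
def restrict {n₁ n₂ : ℕ} (Ω : Finset (Fin n₁ × Fin n₂)) (S : Matrix (Fin n₁) (Fin n₂) ℝ) :
    Matrix (Fin n₁) (Fin n₂) ℝ :=
  Matrix.of fun i j => if (i, j) ∈ Ω then S i j else 0

open Classical in
/-- The probability of the event `E` when `Ω` is uniformly distributed among the sets of
`m` positions of an `n₁ × n₂` matrix. -/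
def uniformProb {n₁ n₂ : ℕ} (m : ℕ) (E : Finset (Fin n₁ × Fin n₂) → Prop) : ℝ :=
  (((Finset.univ.powersetCard m).filter E).card : ℝ) /
    ((Finset.univ : Finset (Fin n₁ × Fin n₂)).powersetCard m).card

end

end PCP

/-! Exactness is certified by duality (`isExact_of_certificate`). Let T be the tangent space at L₀
to the matrices of rank r, with orthogonal projection P_T (`tproj`), and let O contain the support
of S₀. If ‖P_O P_T‖ ≤ 1/2, it suffices to find W orthogonal to T with ‖W‖ ≤ 1/2 such that Q = UVᵀ +
W is within λ/4 of λ·sign on O in Frobenius norm and has entries at most λ/2 off O: then every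
nonzero feasible perturbation strictly raises the objective.

The signs of S are arbitrary, while the construction of W wants random ones. Draw a Bernoulli(p) set
O and independent fair signs ε. The positions of O at which ε agrees with the sign of S form a
Bernoulli(p/2) set (`Ex_agree`), and a certificate for (O, ε) serves every matrix that is supported
there and carries entries of S. Recovery of all such matrices is a decreasing property of the set of
positions, so it passes from Bernoulli sets to uniform sets of size m (`Pr_bern_le_proportion`).

The certificate is W = (1 - P_T)(Y + λG). The matrix G = (1 - P_O P_T P_O)⁻¹ P_O ε reproduces the
signs exactly on O; conditionally on O it is linear in ε, and subgaussian bounds control it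
(`Pr_not_signCert`). The matrix Y lives off O and satisfies P_T Y ≈ UVᵀ. It comes from the golfing
scheme: the complement of O is a union of k independent Bernoulli(q) batches with (1 - q)^k = p, and
correcting the residual on each batch halves its largest entry by Bernstein's inequality
(`Pr_not_golfCert`). Here k is of order log N, so the final residual is negligible.

Two estimates are used throughout. Operator norms of random matrices come from a 1/4-net
(`Pr_not_opLe`). The bound on ‖P_O P_T‖ splits along rows and columns into norms of sparse random
sums of rank-one matrices, handled by trace moments (`Ex_trace_gram_pow_le`,
`Spread.fro_mask_tproj_le`). -/

namespace PCP
noncomputable section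
open Matrix

/-! ### Finite probability spaces -/

/-- A probability vector on a finite type. -/
structure IsProb {α : Type*} [Fintype α] (w : α → ℝ) : Prop where
  nonneg : ∀ a, 0 ≤ w a
  sum_eq : ∑ a, w a = 1

/-- Expectation with respect to a weight vector. -/
def Ex {α : Type*} [Fintype α] (w : α → ℝ) (f : α → ℝ) : ℝ := ∑ a, w a * f a

open Classical in
/-- The indicator function of an event. -/
def ind {α : Type*} (E : α → Prop) (a : α) : ℝ := if E a then 1 else 0

/-- Probability of an event with respect to a weight vector. -/
def Pr {α : Type*} [Fintype α] (w : α → ℝ) (E : α → Prop) : ℝ := Ex w (ind E)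

/-- The product weight on a function space. -/
def piW {ι α : Type*} [Fintype ι] (w : ι → α → ℝ) (ω : ι → α) : ℝ := ∏ i, w i (ω i)

/-- The product weight on a product of two spaces. -/
def prodW {α β : Type*} (w : α → ℝ) (v : β → ℝ) (x : α × β) : ℝ := w x.1 * v x.2

/-- The Bernoulli weight: `true` with probability `q`. -/
def bern (q : ℝ) (b : Bool) : ℝ := if b then q else 1 - q

lemma ind_nonneg {α : Type*} (E : α → Prop) (a : α) : 0 ≤ ind E a := by
  unfold ind; split_ifs <;> norm_num

lemma ind_of {α : Type*} {E : α → Prop} {a : α} (h : E a) : ind E a = 1 := by simp [ind, h]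

lemma ind_of_not {α : Type*} {E : α → Prop} {a : α} (h : ¬ E a) : ind E a = 0 := by simp [ind, h]

section FinProb

variable {α β ι : Type*} [Fintype α] [Fintype β] [Fintype ι]

lemma Ex_mono {w : α → ℝ} (hw : ∀ a, 0 ≤ w a) {f g : α → ℝ} (h : ∀ a, f a ≤ g a) :
    Ex w f ≤ Ex w g :=
  Finset.sum_le_sum fun a _ => mul_le_mul_of_nonneg_left (h a) (hw a)

lemma Ex_nonneg {w : α → ℝ} (hw : ∀ a, 0 ≤ w a) {f : α → ℝ} (h : ∀ a, 0 ≤ f a) : 0 ≤ Ex w f :=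
  Finset.sum_nonneg fun a _ => mul_nonneg (hw a) (h a)

lemma Ex_add (w f g : α → ℝ) : Ex w (fun a => f a + g a) = Ex w f + Ex w g := by
  simp [Ex, mul_add, Finset.sum_add_distrib]

lemma Ex_const_mul (w : α → ℝ) (c : ℝ) (f : α → ℝ) : Ex w (fun a => c * f a) = c * Ex w f := by
  simp only [Ex, Finset.mul_sum]
  exact Finset.sum_congr rfl fun a _ => by ring

lemma Ex_mul_const (w : α → ℝ) (c : ℝ) (f : α → ℝ) : Ex w (fun a => f a * c) = Ex w f * c := by
  rw [mul_comm, ← Ex_const_mul]; simp only [mul_comm]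

lemma Ex_sum {κ : Type*} (s : Finset κ) (w : α → ℝ) (f : κ → α → ℝ) :
    Ex w (fun a => ∑ k ∈ s, f k a) = ∑ k ∈ s, Ex w (f k) := by
  simp only [Ex, Finset.mul_sum]
  exact Finset.sum_comm

lemma IsProb.Ex_const {w : α → ℝ} (hw : IsProb w) (c : ℝ) : Ex w (fun _ => c) = c := by
  simp [Ex, ← Finset.sum_mul, hw.sum_eq]

lemma IsProb.Ex_le_of_le {w : α → ℝ} (hw : IsProb w) {f : α → ℝ} {c : ℝ} (h : ∀ a, f a ≤ c) :
    Ex w f ≤ c := (Ex_mono hw.nonneg h).trans_eq (hw.Ex_const c)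

lemma Pr_nonneg {w : α → ℝ} (hw : ∀ a, 0 ≤ w a) (E : α → Prop) : 0 ≤ Pr w E :=
  Ex_nonneg hw (ind_nonneg E)

lemma Pr_mono {w : α → ℝ} (hw : ∀ a, 0 ≤ w a) {E F : α → Prop} (h : ∀ a, E a → F a) :
    Pr w E ≤ Pr w F := by
  refine Ex_mono hw fun a => ?_
  by_cases ha : E a
  · rw [ind_of ha, ind_of (h a ha)]
  · rw [ind_of_not ha]; exact ind_nonneg F a

lemma Pr_or_le {w : α → ℝ} (hw : ∀ a, 0 ≤ w a) (E F : α → Prop) :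
    Pr w (fun a => E a ∨ F a) ≤ Pr w E + Pr w F := by
  rw [Pr, Pr, Pr, ← Ex_add]
  refine Ex_mono hw fun a => ?_
  by_cases h1 : E a <;> by_cases h2 : F a <;> simp [ind, h1, h2]

lemma Pr_exists_le {κ : Type*} (s : Finset κ) {w : α → ℝ} (hw : ∀ a, 0 ≤ w a)
    (E : κ → α → Prop) : Pr w (fun a => ∃ k ∈ s, E k a) ≤ ∑ k ∈ s, Pr w (E k) := by
  simp only [Pr]
  rw [← Ex_sum]
  refine Ex_mono hw fun a => ?_
  by_cases h : ∃ k ∈ s, E k a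
  · rw [ind_of (E := fun a => ∃ k ∈ s, E k a) h]
    obtain ⟨k, hk, hE⟩ := h
    rw [← ind_of (E := E k) hE]
    exact Finset.single_le_sum (f := fun k => ind (E k) a) (fun k _ => ind_nonneg (E k) a) hk
  · rw [ind_of_not (E := fun a => ∃ k ∈ s, E k a) h]
    exact Finset.sum_nonneg fun k _ => ind_nonneg (E k) a

lemma IsProb.Pr_eq_one_sub {w : α → ℝ} (hw : IsProb w) (E : α → Prop) :
    Pr w E = 1 - Pr w (fun a => ¬ E a) := by
  rw [eq_sub_iff_add_eq, Pr, Pr, ← Ex_add]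
  convert hw.Ex_const 1 using 2
  ext a
  by_cases h : E a <;> simp [ind, h]

/-- Markov's inequality. -/
lemma Pr_le_of_Ex {w : α → ℝ} (hw : ∀ a, 0 ≤ w a) {f : α → ℝ} (hf : ∀ a, 0 ≤ f a) {c : ℝ}
    (hc : 0 < c) : Pr w (fun a => c ≤ f a) ≤ Ex w f / c := by
  rw [le_div_iff₀ hc, Pr, ← Ex_mul_const]
  refine Ex_mono hw fun a => ?_
  by_cases h : c ≤ f a
  · rw [ind_of (E := fun a => c ≤ f a) h]; linarith
  · rw [ind_of_not (E := fun a => c ≤ f a) h]; simpa using hf a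

/-- The exponential Markov inequality. -/
lemma Pr_le_of_mgf {w : α → ℝ} (hw : ∀ a, 0 ≤ w a) (X : α → ℝ) {t u B : ℝ} (ht : 0 ≤ t)
    (hB : Ex w (fun a => Real.exp (t * X a)) ≤ Real.exp B) :
    Pr w (fun a => u ≤ X a) ≤ Real.exp (B - t * u) := by
  rw [Real.exp_sub]
  refine (Pr_mono hw (F := fun a => Real.exp (t * u) ≤ Real.exp (t * X a)) fun a h => ?_).trans
    ((Pr_le_of_Ex hw (fun a => (Real.exp_pos _).le) (Real.exp_pos _)).trans ?_)
  · exact Real.exp_le_exp.2 (mul_le_mul_of_nonneg_left h ht)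
  · gcongr

lemma isProb_piW {w : ι → α → ℝ} (hw : ∀ i, IsProb (w i)) [DecidableEq ι] : IsProb (piW w) where
  nonneg ω := Finset.prod_nonneg fun i _ => (hw i).nonneg _
  sum_eq := by
    have := (Finset.prod_univ_sum (fun _ : ι => (Finset.univ : Finset α)) (fun i a => w i a)).symm
    rw [Fintype.piFinset_univ] at this
    simpa [piW, (hw _).sum_eq] using this

lemma isProb_prodW {w : α → ℝ} {v : β → ℝ} (hw : IsProb w) (hv : IsProb v) :
    IsProb (prodW w v) where
  nonneg x := mul_nonneg (hw.nonneg _) (hv.nonneg _)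
  sum_eq := by
    simp [prodW, Fintype.sum_prod_type, ← Finset.mul_sum, hv.sum_eq, hw.sum_eq]

lemma isProb_bern {q : ℝ} (h0 : 0 ≤ q) (h1 : q ≤ 1) : IsProb (bern q) where
  nonneg b := by cases b <;> simp [bern, h0, h1]
  sum_eq := by simp [bern]

lemma Ex_bern (q : ℝ) (f : Bool → ℝ) : Ex (bern q) f = q * f true + (1 - q) * f false := by
  simp [Ex, bern]

/-- The expectation of a product of functions of independent coordinates. -/
lemma Ex_piW_prod [DecidableEq ι] (w : ι → α → ℝ) (g : ι → α → ℝ) :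
    Ex (piW w) (fun ω => ∏ i, g i (ω i)) = ∏ i, Ex (w i) (g i) := by
  have := (Finset.prod_univ_sum (fun _ : ι => (Finset.univ : Finset α))
    (fun i a => w i a * g i a)).symm
  rw [Fintype.piFinset_univ] at this
  simpa [Ex, piW, Finset.prod_mul_distrib] using this

lemma Ex_piW_exp_sum [DecidableEq ι] (w : ι → α → ℝ) (g : ι → α → ℝ) :
    Ex (piW w) (fun ω => Real.exp (∑ i, g i (ω i))) =
      ∏ i, Ex (w i) (fun a => Real.exp (g i a)) := by
  simp only [Real.exp_sum]
  exact Ex_piW_prod w fun i a => Real.exp (g i a)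

lemma Ex_prodW (w : α → ℝ) (v : β → ℝ) (f : α × β → ℝ) :
    Ex (prodW w v) f = Ex w (fun a => Ex v (fun b => f (a, b))) := by
  simp [Ex, prodW, Fintype.sum_prod_type, Finset.mul_sum, mul_assoc]

lemma Ex_prodW_swap (w : α → ℝ) (v : β → ℝ) (f : α × β → ℝ) :
    Ex (prodW w v) f = Ex v (fun b => Ex w (fun a => f (a, b))) := by
  simp only [Ex, prodW, Fintype.sum_prod_type_right, Finset.mul_sum]
  exact Finset.sum_congr rfl fun b _ => Finset.sum_congr rfl fun a _ => by ring

/-- Resampling one coordinate does not change the expectation. -/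
lemma Ex_piW_update [DecidableEq ι] {w : ι → α → ℝ} (hw : ∀ i, IsProb (w i)) (j : ι)
    (f : (ι → α) → ℝ) :
    Ex (piW w) f = Ex (piW w) (fun ω => Ex (w j) (fun a => f (Function.update ω j a))) := by
  -- Splitting off coordinate j makes the resampled function independent of the old value b, whose
  -- weights then sum to one.
  have key : ∀ F : (ι → α) → ℝ, Ex (piW w) F =
      ∑ b : α, ∑ η : ({i // i ≠ j} → α), w j b * (∏ i : {i // i ≠ j}, w i (η i)) *
        F ((Equiv.funSplitAt j α).symm (b, η)) := by
    intro F
    rw [Ex, ← (Equiv.funSplitAt j α).symm.sum_comp, Fintype.sum_prod_type]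
    refine Finset.sum_congr rfl fun b _ => Finset.sum_congr rfl fun η _ => ?_
    congr 1
    rw [piW, ← Finset.mul_prod_erase _ _ (Finset.mem_univ j)]
    congr 1
    · simp [Equiv.funSplitAt, Equiv.piSplitAt]
    · rw [Finset.prod_subtype (Finset.univ.erase j) (p := fun i => i ≠ j) (by simp)
        (fun i => w i ((Equiv.funSplitAt j α).symm (b, η) i))]
      refine Finset.prod_congr rfl fun i _ => ?_
      simp [Equiv.funSplitAt, Equiv.piSplitAt, i.2]
  have upd : ∀ b c (η : {i // i ≠ j} → α),
      Function.update ((Equiv.funSplitAt j α).symm (b, η)) j c =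
        (Equiv.funSplitAt j α).symm (c, η) := by
    intro b c η
    ext i
    by_cases h : i = j
    · subst h; simp [Equiv.funSplitAt, Equiv.piSplitAt]
    · simp [Equiv.funSplitAt, Equiv.piSplitAt, h]
  rw [key, key]
  simp only [upd]
  rw [Finset.sum_comm, Finset.sum_comm (γ := α)]
  refine Finset.sum_congr rfl fun η _ => ?_
  simp only [mul_assoc]
  rw [← Finset.sum_mul, (hw j).sum_eq, one_mul, Ex, Finset.mul_sum]
  exact Finset.sum_congr rfl fun b _ => by ring

/-- The image of a weight under a map. -/
def mapW [DecidableEq β] (h : α → β) (w : α → ℝ) (b : β) : ℝ := Ex w fun a => if h a = b then 1 else 0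

/-- The image of a product weight under a coordinatewise map is a product weight. -/
lemma Ex_piW_comp [DecidableEq ι] [DecidableEq β] (h : ι → α → β) (w : ι → α → ℝ)
    (F : (ι → β) → ℝ) :
    Ex (piW w) (fun ω => F (fun i => h i (ω i))) = Ex (piW fun i => mapW (h i) (w i)) F := by
  -- Expanding over the possible outcomes o leaves products of one-coordinate indicators, to which
  -- independence applies.
  have e : ∀ ω : ι → α, F (fun i => h i (ω i)) =
      ∑ o : ι → β, (∏ i, if h i (ω i) = o i then 1 else 0) * F o := by
    intro ω
    rw [Finset.sum_eq_single (fun i => h i (ω i))]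
    · simp
    · intro o _ ho
      obtain ⟨i, hi⟩ := Function.ne_iff.1 ho
      rw [Finset.prod_eq_zero (Finset.mem_univ i) (by simp [Ne.symm hi]), zero_mul]
    · simp
  simp only [e]
  rw [Ex_sum, Ex]
  refine Finset.sum_congr rfl fun o _ => ?_
  rw [Ex_mul_const]
  congr 1
  exact Ex_piW_prod w (fun i a => if h i a = o i then 1 else 0)

end FinProb

/-! ### Moment generating functions -/

/-- For a centered variable the linear term disappears in expectation, so a bound on its square
bounds the moment generating function with no constant in front. -/
lemma exp_le_add_exp_sq (x : ℝ) : Real.exp x ≤ x + Real.exp (x ^ 2) := by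
  have h1 : x ^ 2 + 1 ≤ Real.exp (x ^ 2) := Real.add_one_le_exp _
  rcases le_or_gt |x| 1 with h | h
  · have := abs_le.1 (Real.abs_exp_sub_one_sub_id_le h)
    linarith [this.2]
  · rcases lt_or_ge 0 x with hx | hx
    · rw [abs_of_pos hx] at h
      have : Real.exp x ≤ Real.exp (x ^ 2) := Real.exp_le_exp.2 (by nlinarith)
      linarith
    · rw [abs_of_nonpos hx] at h
      have : Real.exp x ≤ 1 := Real.exp_le_one_iff.2 hx
      nlinarith

/-- The centered and rescaled Bernoulli variable `1 - γ / q`. -/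
def cen (q : ℝ) (b : Bool) : ℝ := 1 - (if b then 1 else 0) / q

lemma abs_cen_le {q : ℝ} (h0 : 0 < q) (h1 : q ≤ 1) (b : Bool) : |cen q b| ≤ 1 / q := by
  have : 1 ≤ 1 / q := by rw [le_div_iff₀ h0]; linarith
  cases b
  · simpa [cen] using this
  · simp only [cen, if_true]
    rw [abs_le]; constructor <;> linarith

lemma Ex_cen {q : ℝ} (h0 : 0 < q) : Ex (bern q) (cen q) = 0 := by
  rw [Ex_bern]; simp only [cen]; field_simp; simp; ring

lemma Ex_cen_sq {q : ℝ} (h0 : 0 < q) : Ex (bern q) (fun b => cen q b ^ 2) ≤ 1 / q := by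
  rw [Ex_bern]
  have : q * cen q true ^ 2 + (1 - q) * cen q false ^ 2 = 1 / q - 1 := by
    simp only [cen]; field_simp; simp; ring
  linarith

/-- Hoeffding-type bound for the moment generating function. -/
lemma Ex_exp_cen_le {q : ℝ} (h0 : 0 < q) (h1 : q ≤ 1) (θ : ℝ) :
    Ex (bern q) (fun b => Real.exp (θ * cen q b)) ≤ Real.exp (θ ^ 2 / q ^ 2) := by
  have hP := isProb_bern h0.le h1
  calc Ex (bern q) (fun b => Real.exp (θ * cen q b))
      ≤ Ex (bern q) (fun b => θ * cen q b + Real.exp (θ ^ 2 / q ^ 2)) := by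
        refine Ex_mono hP.nonneg fun b => (exp_le_add_exp_sq _).trans ?_
        have : (θ * cen q b) ^ 2 ≤ θ ^ 2 / q ^ 2 := by
          have h2 : cen q b ^ 2 ≤ (1 / q) ^ 2 := sq_le_sq' (by
            linarith [(abs_le.1 (abs_cen_le h0 h1 b)).1]) (abs_le.1 (abs_cen_le h0 h1 b)).2
          calc (θ * cen q b) ^ 2 = θ ^ 2 * cen q b ^ 2 := by ring
            _ ≤ θ ^ 2 * (1 / q) ^ 2 := by gcongr
            _ = _ := by ring
        gcongr
    _ = _ := by rw [Ex_add, Ex_const_mul, Ex_cen h0, hP.Ex_const]; ring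

/-- Bernstein-type bound for the moment generating function. -/
lemma Ex_exp_cen_le_of_abs_le {q : ℝ} (h0 : 0 < q) (h1 : q ≤ 1) {θ : ℝ} (hθ : |θ| ≤ q) :
    Ex (bern q) (fun b => Real.exp (θ * cen q b)) ≤ Real.exp (θ ^ 2 / q) := by
  have hP := isProb_bern h0.le h1
  calc Ex (bern q) (fun b => Real.exp (θ * cen q b))
      ≤ Ex (bern q) (fun b => (1 + θ * cen q b) + θ ^ 2 * cen q b ^ 2) := by
        refine Ex_mono hP.nonneg fun b => ?_
        have : |θ * cen q b| ≤ 1 := by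
          rw [abs_mul]
          calc |θ| * |cen q b| ≤ q * (1 / q) :=
                mul_le_mul hθ (abs_cen_le h0 h1 b) (abs_nonneg _) h0.le
            _ = 1 := by field_simp
        have := (abs_le.1 (Real.abs_exp_sub_one_sub_id_le this)).2
        rw [mul_pow] at this
        linarith
    _ = 1 + θ ^ 2 * Ex (bern q) (fun b => cen q b ^ 2) := by
        rw [Ex_add, Ex_add, Ex_const_mul, Ex_const_mul, Ex_cen h0, hP.Ex_const]; ring
    _ ≤ 1 + θ ^ 2 * (1 / q) := by gcongr; exact Ex_cen_sq h0
    _ ≤ _ := by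
        have := Real.add_one_le_exp (θ ^ 2 / q)
        rw [mul_one_div]; linarith

/-- The sign attached to a bit. -/
def sgn (b : Bool) : ℝ := if b then 1 else -1

lemma sgn_sq (b : Bool) : sgn b ^ 2 = 1 := by cases b <;> simp [sgn]

lemma abs_sgn (b : Bool) : |sgn b| = 1 := by cases b <;> simp [sgn]

lemma Ex_exp_sgn (θ : ℝ) :
    Ex (bern (1 / 2)) (fun b => Real.exp (θ * sgn b)) = Real.cosh θ := by
  rw [Ex_bern, Real.cosh_eq]; simp [sgn]; ring

lemma Ex_exp_sgn_le (θ : ℝ) :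
    Ex (bern (1 / 2)) (fun b => Real.exp (θ * sgn b)) ≤ Real.exp (θ ^ 2 / 2) := by
  rw [Ex_exp_sgn]; exact Real.cosh_le_exp_half_sq θ

/-- Combine cosh t ≤ e^u for u = t²/2 with e^u - 1 = e^u (1 - e^(-u)) ≤ u e^u. The factor t² is what
allows a small sparsity p to shrink the variance proxy. -/
lemma cosh_sub_one_le (t : ℝ) : Real.cosh t - 1 ≤ t ^ 2 / 2 * Real.exp (t ^ 2 / 2) := by
  have h1 := Real.cosh_le_exp_half_sq t
  have h2 := Real.one_sub_le_exp_neg (t ^ 2 / 2)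
  have h3 : Real.exp (t ^ 2 / 2) * Real.exp (-(t ^ 2 / 2)) = 1 := by rw [← Real.exp_add]; simp
  nlinarith [Real.exp_pos (t ^ 2 / 2)]

/-- A sparse random sign is subgaussian with small variance proxy. -/
lemma exists_sparse_sign_mgf {s : ℝ} (hs : 0 < s) : ∃ p₀ > 0, ∀ p : ℝ, 0 ≤ p → p ≤ p₀ → p ≤ 1 →
    ∀ t : ℝ, 1 - p + p * Real.cosh t ≤ Real.exp (s ^ 2 * t ^ 2 / 2) := by
  -- The threshold |t| = 2/s² separates two regimes. Above it, cosh t ≤ e^|t| ≤ e^(s²t²/2) whatever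
  -- p is; below it, this choice gives p e^(t²/2) ≤ s².
  refine ⟨s ^ 2 * Real.exp (-((2 / s ^ 2) ^ 2 / 2)), by positivity, fun p hp hp0 hp1 t => ?_⟩
  rcases le_or_gt |t| (2 / s ^ 2) with h | h
  · have ht : t ^ 2 ≤ (2 / s ^ 2) ^ 2 := by
      rw [← sq_abs t]; gcongr
    have h1 := cosh_sub_one_le t
    have h2 : p * Real.exp (t ^ 2 / 2) ≤ s ^ 2 := by
      calc p * Real.exp (t ^ 2 / 2) ≤ (s ^ 2 * Real.exp (-((2 / s ^ 2) ^ 2 / 2))) *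
            Real.exp ((2 / s ^ 2) ^ 2 / 2) := by gcongr
        _ = s ^ 2 := by rw [mul_assoc, ← Real.exp_add]; simp
    have h3 := Real.add_one_le_exp (s ^ 2 * t ^ 2 / 2)
    have h4 : p * (Real.cosh t - 1) ≤ t ^ 2 / 2 * s ^ 2 := by
      calc p * (Real.cosh t - 1) ≤ p * (t ^ 2 / 2 * Real.exp (t ^ 2 / 2)) := by gcongr
        _ = t ^ 2 / 2 * (p * Real.exp (t ^ 2 / 2)) := by ring
        _ ≤ _ := by gcongr
    linarith
  · have h1 : 1 ≤ Real.cosh t := Real.one_le_cosh t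
    have h2 : Real.cosh t ≤ Real.exp |t| := by
      rw [← Real.cosh_abs, Real.cosh_eq]
      have := Real.exp_le_exp.2 (neg_le_self (abs_nonneg t))
      linarith
    have h3 : |t| ≤ s ^ 2 * t ^ 2 / 2 := by
      rw [div_lt_iff₀ (by positivity)] at h
      rw [← sq_abs t]
      nlinarith [abs_nonneg t]
    have := Real.exp_le_exp.2 h3
    nlinarith

/-! ### The operator norm and nets -/

/-- The operator norm of `M` for the Euclidean norms is at most `c`. -/
def OpLe {m n : ℕ} (M : Matrix (Fin m) (Fin n) ℝ) (c : ℝ) : Prop :=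
  ∀ x y, x ⬝ᵥ x ≤ 1 → y ⬝ᵥ y ≤ 1 → y ⬝ᵥ (M *ᵥ x) ≤ c

section OpLe

variable {m n : ℕ} {M M' : Matrix (Fin m) (Fin n) ℝ} {c c' : ℝ}

lemma dot_self_nonneg {n : ℕ} (x : Fin n → ℝ) : 0 ≤ x ⬝ᵥ x :=
  Finset.sum_nonneg fun i _ => mul_self_nonneg (x i)

lemma OpLe.mono (h : OpLe M c) (hc : c ≤ c') : OpLe M c' :=
  fun x y hx hy => (h x y hx hy).trans hc

lemma OpLe.add (h : OpLe M c) (h' : OpLe M' c') : OpLe (M + M') (c + c') := by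
  intro x y hx hy
  rw [add_mulVec, dotProduct_add]
  exact add_le_add (h x y hx hy) (h' x y hx hy)

lemma OpLe.smul (h : OpLe M c) {a : ℝ} (ha : 0 ≤ a) : OpLe (a • M) (a * c) := by
  intro x y hx hy
  rw [smul_mulVec, dotProduct_smul]
  exact mul_le_mul_of_nonneg_left (h x y hx hy) ha

lemma OpLe.neg (h : OpLe M c) : OpLe (-M) c := by
  intro x y hx hy
  have := h x (-y) hx (by simpa using hy)
  simpa [neg_mulVec] using this

lemma OpLe.sum {κ : Type*} (s : Finset κ) {A : κ → Matrix (Fin m) (Fin n) ℝ} {b : κ → ℝ}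
    (h : ∀ k ∈ s, OpLe (A k) (b k)) : OpLe (∑ k ∈ s, A k) (∑ k ∈ s, b k) := by
  classical
  induction s using Finset.induction_on with
  | empty => intro x y _ _; simp
  | insert a s ha ih =>
    rw [Finset.sum_insert ha, Finset.sum_insert ha]
    exact (h a (Finset.mem_insert_self _ _)).add
      (ih fun k hk => h k (Finset.mem_insert_of_mem hk))

/-- The bilinear bound for arbitrary vectors. -/
lemma OpLe.dot_le (h : OpLe M c) {x : Fin n → ℝ} {y : Fin m → ℝ} {a b : ℝ} (ha : 0 ≤ a)
    (hb : 0 ≤ b) (hx : x ⬝ᵥ x ≤ a ^ 2) (hy : y ⬝ᵥ y ≤ b ^ 2) : y ⬝ᵥ (M *ᵥ x) ≤ a * b * c := by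
  rcases ha.eq_or_lt with rfl | ha
  · have : x = 0 := dotProduct_self_eq_zero.1 (le_antisymm (by simpa using hx) (dot_self_nonneg x))
    simp [this]
  rcases hb.eq_or_lt with rfl | hb
  · have : y = 0 := dotProduct_self_eq_zero.1 (le_antisymm (by simpa using hy) (dot_self_nonneg y))
    simp [this]
  have h1 := h (a⁻¹ • x) (b⁻¹ • y)
    (by
      rw [smul_dotProduct, dotProduct_smul, smul_eq_mul, smul_eq_mul]
      calc a⁻¹ * (a⁻¹ * (x ⬝ᵥ x)) ≤ a⁻¹ * (a⁻¹ * a ^ 2) := by gcongr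
        _ = 1 := by field_simp)
    (by
      rw [smul_dotProduct, dotProduct_smul, smul_eq_mul, smul_eq_mul]
      calc b⁻¹ * (b⁻¹ * (y ⬝ᵥ y)) ≤ b⁻¹ * (b⁻¹ * b ^ 2) := by gcongr
        _ = 1 := by field_simp)
  rw [mulVec_smul, dotProduct_smul, smul_dotProduct, smul_eq_mul, smul_eq_mul] at h1
  calc y ⬝ᵥ (M *ᵥ x) = a * b * (a⁻¹ * (b⁻¹ * (y ⬝ᵥ (M *ᵥ x)))) := by field_simp
    _ ≤ _ := by gcongr

/-- Any finite bound will do: it only starts the net iteration, which contracts towards a bound that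
does not depend on it. -/
lemma exists_opLe (M : Matrix (Fin m) (Fin n) ℝ) : ∃ c, OpLe M c := by
  have hb : ∀ {n : ℕ} (x : Fin n → ℝ), x ⬝ᵥ x ≤ 1 → ∀ i, |x i| ≤ 1 := by
    intro n x hx i
    rw [abs_le_one_iff_mul_self_le_one]
    exact (Finset.single_le_sum (f := fun i => x i * x i) (fun i _ => mul_self_nonneg _)
      (Finset.mem_univ i)).trans hx
  refine ⟨∑ i, ∑ j, |M i j|, fun x y hx hy => ?_⟩
  simp only [dotProduct, mulVec, Finset.mul_sum]
  refine Finset.sum_le_sum fun i _ => Finset.sum_le_sum fun j _ => (le_abs_self _).trans ?_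
  rw [abs_mul, abs_mul]
  calc |y i| * (|M i j| * |x j|) ≤ 1 * (|M i j| * 1) := by
        gcongr
        · exact hb y hy i
        · exact hb x hx j
    _ = _ := by ring

end OpLe

/-- A `1/4`-net of the Euclidean unit ball of exponential cardinality. -/
lemma exists_net (n : ℕ) : ∃ s : Finset (Fin n → ℝ), (s.card : ℝ) ≤ Real.exp (18 * n) ∧
    (∀ y ∈ s, y ⬝ᵥ y ≤ 1) ∧ ∀ x, x ⬝ᵥ x ≤ 1 → ∃ y ∈ s, (x - y) ⬝ᵥ (x - y) ≤ (1 / 4) ^ 2 := by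
  classical
  -- The net consists of the points of the grid of mesh 1/(4√n) inside the ball, each coordinate
  -- coded by its absolute value and a sign. Rounding towards zero keeps a vector in the ball and
  -- moves it by at most 1/4.
  let G : Finset (Fin n → ℕ × Bool) :=
    Fintype.piFinset fun _ => Finset.range (16 * n + 1) ×ˢ Finset.univ
  let F := G.filter fun g => ∑ i, (g i).1 ^ 2 ≤ 16 * n
  let v : (Fin n → ℕ × Bool) → Fin n → ℝ := fun g i => sgn (g i).2 * (g i).1 / (4 * √n)
  refine ⟨F.image v, ?_, ?_, ?_⟩
  · have h1 : ((F.image v).card : ℝ) ≤ F.card := by exact_mod_cast Finset.card_image_le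
    -- Exponential weights do the counting. Since Σ gᵢ ≤ Σ gᵢ² ≤ 16n, each point of `F` has weight
    -- at least 1, and the total weight factors over coordinates into e^(16n) times (at most 4)^n,
    -- with 4 ≤ e².
    have h2 : (F.card : ℝ) ≤ ∑ g ∈ G, Real.exp (16 * n - ∑ i, ((g i).1 : ℝ)) := by
      rw [Finset.card_eq_sum_ones]
      push_cast
      calc ∑ g ∈ F, (1 : ℝ) ≤ ∑ g ∈ F, Real.exp (16 * n - ∑ i, ((g i).1 : ℝ)) := by
            refine Finset.sum_le_sum fun g hg => Real.one_le_exp ?_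
            have hg := (Finset.mem_filter.1 hg).2
            have : ∑ i, (g i).1 ≤ 16 * n :=
              (Finset.sum_le_sum fun i _ => Nat.le_self_pow two_ne_zero _).trans hg
            have : ∑ i, ((g i).1 : ℝ) ≤ 16 * n := by exact_mod_cast this
            linarith
        _ ≤ _ := Finset.sum_le_sum_of_subset_of_nonneg (Finset.filter_subset _ _)
            fun _ _ _ => (Real.exp_pos _).le
    have h3 : ∑ g ∈ G, Real.exp (16 * n - ∑ i, ((g i).1 : ℝ)) =
        Real.exp (16 * n) * (∑ a ∈ Finset.range (16 * n + 1) ×ˢ (Finset.univ : Finset Bool),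
          Real.exp (-(a.1 : ℝ))) ^ n := by
      have := Finset.prod_univ_sum
        (fun _ : Fin n => Finset.range (16 * n + 1) ×ˢ (Finset.univ : Finset Bool))
        (fun _ a => Real.exp (-(a.1 : ℝ)))
      rw [Finset.prod_const, Finset.card_univ, Fintype.card_fin] at this
      rw [this, Finset.mul_sum]
      refine Finset.sum_congr rfl fun g _ => ?_
      rw [← Real.exp_sum, ← Real.exp_add]
      simp [sub_eq_add_neg]
    have h4 : ∑ a ∈ Finset.range (16 * n + 1) ×ˢ (Finset.univ : Finset Bool),
          Real.exp (-(a.1 : ℝ)) ≤ Real.exp 2 := by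
      rw [Finset.sum_product]
      simp only [Finset.sum_const, Finset.card_univ, Fintype.card_bool, nsmul_eq_mul]
      rw [← Finset.mul_sum]
      have he : Real.exp (-1) ≤ 1 / 2 := by
        rw [Real.exp_neg, one_div]
        exact inv_anti₀ (by norm_num) (by linarith [Real.add_one_le_exp 1])
      have : ∑ i ∈ Finset.range (16 * n + 1), Real.exp (-(i : ℝ)) ≤ 2 := by
        calc ∑ i ∈ Finset.range (16 * n + 1), Real.exp (-(i : ℝ))
            ≤ ∑ i ∈ Finset.range (16 * n + 1), (1 / 2 : ℝ) ^ i := by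
              refine Finset.sum_le_sum fun i _ => ?_
              have : Real.exp (-(i : ℝ)) = Real.exp (-1) ^ i := by
                rw [← Real.exp_nat_mul]; ring_nf
              rw [this]
              gcongr
          _ ≤ 2 := by
              have := sum_geometric_two_le (16 * n + 1)
              exact this
      have h2 : (4 : ℝ) ≤ Real.exp 2 := by
        have : Real.exp 2 = Real.exp 1 * Real.exp 1 := by rw [← Real.exp_add]; norm_num
        nlinarith [Real.add_one_le_exp 1]
      push_cast
      linarith
    calc ((F.image v).card : ℝ) ≤ _ := h1.trans (h2.trans_eq h3)
      _ ≤ Real.exp (16 * n) * Real.exp 2 ^ n := by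
          gcongr
      _ = _ := by rw [← Real.exp_nat_mul, ← Real.exp_add]; ring_nf
  · intro y hy
    obtain ⟨g, hg, rfl⟩ := Finset.mem_image.1 hy
    have hg := (Finset.mem_filter.1 hg).2
    have hg' : ∑ i, ((g i).1 : ℝ) ^ 2 ≤ 16 * n := by exact_mod_cast hg
    have : v g ⬝ᵥ v g = (∑ i, ((g i).1 : ℝ) ^ 2) / (16 * n) := by
      rw [dotProduct, Finset.sum_div]
      refine Finset.sum_congr rfl fun i _ => ?_
      have : v g i * v g i = sgn (g i).2 ^ 2 * (g i).1 ^ 2 / (16 * (√n) ^ 2) := by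
        simp only [v]; ring
      rw [this, sgn_sq, Real.sq_sqrt (Nat.cast_nonneg n), one_mul]
    rw [this]
    exact div_le_one_of_le₀ hg' (by positivity)
  · intro x hx
    rcases Nat.eq_zero_or_pos n with rfl | hn
    · refine ⟨v (fun _ => (0, true)), Finset.mem_image_of_mem _ ?_, by simp⟩
      simp only [F, G, Finset.mem_filter, Fintype.mem_piFinset]
      exact ⟨fun i => i.elim0, by simp⟩
    have hn' : (0 : ℝ) < n := by exact_mod_cast hn
    have hs : 0 < √(n : ℝ) := Real.sqrt_pos.2 hn'
    have hs2 : √(n : ℝ) ^ 2 = n := Real.sq_sqrt hn'.le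
    let g : Fin n → ℕ × Bool := fun i => (⌊4 * √n * |x i|⌋₊, decide (0 ≤ x i))
    have hfl : ∀ i, ((g i).1 : ℝ) ≤ 4 * √n * |x i| := fun i => Nat.floor_le (by positivity)
    have hlt : ∀ i, 4 * √n * |x i| < (g i).1 + 1 := fun i => Nat.lt_floor_add_one _
    have hsum : ∑ i, (g i).1 ^ 2 ≤ 16 * n := by
      have : ∑ i, ((g i).1 : ℝ) ^ 2 ≤ 16 * n := by
        calc ∑ i, ((g i).1 : ℝ) ^ 2 ≤ ∑ i, (4 * √n * |x i|) ^ 2 := by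
              gcongr with i; exact hfl i
          _ = 16 * n * (x ⬝ᵥ x) := by
              rw [dotProduct, Finset.mul_sum]
              refine Finset.sum_congr rfl fun i _ => ?_
              rw [mul_pow, mul_pow, hs2, sq_abs]; ring
          _ ≤ 16 * n * 1 := by gcongr
          _ = _ := by ring
      exact_mod_cast this
    have hsx : ∀ i, x i = sgn (g i).2 * |x i| := by
      intro i
      by_cases h : 0 ≤ x i
      · simp [g, sgn, h, abs_of_nonneg h]
      · simp [g, sgn, h, abs_of_neg (not_le.1 h)]
    refine ⟨v g, Finset.mem_image_of_mem _ (Finset.mem_filter.2 ⟨?_, hsum⟩), ?_⟩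
    · simp only [G, Fintype.mem_piFinset, Finset.mem_product, Finset.mem_range, Finset.mem_univ,
        and_true]
      intro i
      have : (g i).1 ^ 2 ≤ ∑ i, (g i).1 ^ 2 :=
        Finset.single_le_sum (f := fun i => (g i).1 ^ 2) (fun _ _ => Nat.zero_le _)
          (Finset.mem_univ i)
      have := Nat.le_self_pow two_ne_zero (g i).1
      omega
    · have : ∀ i, (x - v g) i * (x - v g) i ≤ 1 / (16 * n) := by
        intro i
        have e : (x - v g) i = sgn (g i).2 * ((4 * √n * |x i| - (g i).1) / (4 * √n)) := by
          have : (x - v g) i = sgn (g i).2 * |x i| - v g i := by rw [← hsx i]; rfl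
          rw [this]; simp only [v]; field_simp
        have e2 : (x - v g) i * (x - v g) i =
            sgn (g i).2 ^ 2 * ((4 * √n * |x i| - (g i).1) ^ 2 / (16 * √n ^ 2)) := by
          rw [e]; ring
        rw [e2, sgn_sq, one_mul, hs2]
        gcongr
        have := hfl i
        have := hlt i
        nlinarith
      calc (x - v g) ⬝ᵥ (x - v g) ≤ ∑ _i : Fin n, (1 : ℝ) / (16 * n) :=
            Finset.sum_le_sum fun i _ => this i
        _ = _ := by simp; field_simp; norm_num

/-- A random matrix with subgaussian bilinear forms has operator norm of the order of the square
root of the dimension. -/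
lemma Pr_not_opLe {α : Type*} [Fintype α] {w : α → ℝ} (hw : ∀ a, 0 ≤ w a) {m n N : ℕ}
    (hm : m ≤ N) (hn : n ≤ N) (X : α → Matrix (Fin m) (Fin n) ℝ) {s : ℝ} (hs : 0 < s)
    (hX : ∀ x y, x ⬝ᵥ x ≤ 1 → y ⬝ᵥ y ≤ 1 → ∀ t, 0 ≤ t →
      Ex w (fun a => Real.exp (t * (y ⬝ᵥ (X a *ᵥ x)))) ≤ Real.exp (t ^ 2 * s ^ 2 / 2)) :
    Pr w (fun a => ¬ OpLe (X a) (18 * s * √N)) ≤ Real.exp (-N) := by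
  obtain ⟨A, hAc, hA1, hA2⟩ := exists_net n
  obtain ⟨B, hBc, hB1, hB2⟩ := exists_net m
  set u : ℝ := 9 * s * √N with hu
  have hN2 : √(N : ℝ) ^ 2 = N := Real.sq_sqrt (Nat.cast_nonneg N)
  have net : ∀ M : Matrix (Fin m) (Fin n) ℝ, (∀ z ∈ A ×ˢ B, ¬ u ≤ z.2 ⬝ᵥ (M *ᵥ z.1)) →
      OpLe M (18 * s * √N) := by
    intro M hM
    -- Replacing x and then y by net points costs c/4 each time. Iteration drives any starting bound
    -- down to 2u.
    have step : ∀ c, OpLe M c → OpLe M (u + c / 2) := by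
      intro c hc x y hx hy
      obtain ⟨x', hx', hxx⟩ := hA2 x hx
      obtain ⟨y', hy', hyy⟩ := hB2 y hy
      have h1 := hM (x', y') (Finset.mk_mem_product hx' hy')
      have h2 := hc.dot_le (x := x) (y := y - y') (a := 1) (b := 1 / 4) (by norm_num)
        (by norm_num) (by simpa using hx) hyy
      have h3 := hc.dot_le (x := x - x') (y := y') (a := 1 / 4) (b := 1) (by norm_num)
        (by norm_num) hxx (by simpa using hB1 y' hy')
      simp only [mulVec_sub, dotProduct_sub, sub_dotProduct] at h2 h3
      simp only [not_le] at h1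
      linarith
    obtain ⟨c, hc⟩ := exists_opLe M
    have it : ∀ k : ℕ, OpLe M (2 * u + c * (1 / 2) ^ k) := by
      intro k
      induction k with
      | zero =>
        refine hc.mono ?_
        have : 0 ≤ u := by positivity
        simp; linarith
      | succ k ih =>
        refine (step _ ih).mono (le_of_eq ?_)
        rw [pow_succ]; ring
    intro x y hx hy
    have lim : Filter.Tendsto (fun k : ℕ => 2 * u + c * (1 / 2 : ℝ) ^ k) Filter.atTop
        (nhds (2 * u + c * 0)) :=
      ((tendsto_pow_atTop_nhds_zero_of_lt_one (by norm_num) (by norm_num)).const_mul c).const_add _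
    have := ge_of_tendsto' lim fun k => it k x y hx hy
    calc _ ≤ _ := this
      _ = _ := by rw [hu]; ring
  calc Pr w (fun a => ¬ OpLe (X a) (18 * s * √N))
      ≤ Pr w (fun a => ∃ z ∈ A ×ˢ B, u ≤ z.2 ⬝ᵥ (X a *ᵥ z.1)) := by
        refine Pr_mono hw fun a ha => ?_
        by_contra! h
        exact ha (net _ fun z hz => not_le.2 (h z hz))
    _ ≤ ∑ z ∈ A ×ˢ B, Pr w (fun a => u ≤ z.2 ⬝ᵥ (X a *ᵥ z.1)) := Pr_exists_le _ hw _
    -- With u = 9s√N each tail is e^(-81N/2), which beats the at most e^(36N) pairs of net points.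
    _ ≤ ∑ _z ∈ A ×ˢ B, Real.exp (-(40 * N)) := by
        refine Finset.sum_le_sum fun z hz => ?_
        rw [Finset.mem_product] at hz
        have ht : 0 ≤ u / s ^ 2 := by positivity
        refine (Pr_le_of_mgf hw _ ht (hX z.1 z.2 (hA1 _ hz.1) (hB1 _ hz.2) _ ht)).trans ?_
        refine Real.exp_le_exp.2 ?_
        have : (u / s ^ 2) ^ 2 * s ^ 2 / 2 - u / s ^ 2 * u = -(81 / 2) * √N ^ 2 := by
          rw [hu]; field_simp; ring
        rw [this, hN2]
        have : (0 : ℝ) ≤ N := Nat.cast_nonneg N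
        linarith
    _ = A.card * B.card * Real.exp (-(40 * N)) := by
        rw [Finset.sum_const, Finset.card_product]; simp
    _ ≤ Real.exp (18 * n) * Real.exp (18 * m) * Real.exp (-(40 * N)) := by gcongr
    _ ≤ _ := by
        rw [← Real.exp_add, ← Real.exp_add]
        refine Real.exp_le_exp.2 ?_
        have h1 : (m : ℝ) ≤ N := by exact_mod_cast hm
        have h2 : (n : ℝ) ≤ N := by exact_mod_cast hn
        have : (0 : ℝ) ≤ N := Nat.cast_nonneg N
        linarith

/-! ### Frobenius geometry of matrices -/

section Frobenius

variable {m n : ℕ}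

/-- The Frobenius inner product. -/
def ip (A B : Matrix (Fin m) (Fin n) ℝ) : ℝ := ∑ i, ∑ j, A i j * B i j

/-- The Frobenius norm. -/
def fro (A : Matrix (Fin m) (Fin n) ℝ) : ℝ := √(ip A A)

/-- The matrix with the entries of `X` on `O` and zeros elsewhere. -/
def mask (O : Fin m × Fin n → Bool) (X : Matrix (Fin m) (Fin n) ℝ) : Matrix (Fin m) (Fin n) ℝ :=
  Matrix.of fun i j => if O (i, j) then X i j else 0

variable (A B C : Matrix (Fin m) (Fin n) ℝ) (O : Fin m × Fin n → Bool)

lemma ip_comm : ip A B = ip B A := by simp only [ip, mul_comm]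

lemma ip_add_left : ip (A + B) C = ip A C + ip B C := by
  simp [ip, add_mul, Finset.sum_add_distrib]

lemma ip_sub_left : ip (A - B) C = ip A C - ip B C := by
  simp [ip, sub_mul, Finset.sum_sub_distrib]

lemma ip_smul_left (a : ℝ) : ip (a • A) B = a * ip A B := by
  simp [ip, Finset.mul_sum, mul_assoc]

lemma ip_add_right : ip A (B + C) = ip A B + ip A C := by
  rw [ip_comm, ip_add_left, ip_comm B, ip_comm C]

lemma ip_sub_right : ip A (B - C) = ip A B - ip A C := by
  rw [ip_comm, ip_sub_left, ip_comm B, ip_comm C]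

lemma ip_smul_right (a : ℝ) : ip A (a • B) = a * ip A B := by
  rw [ip_comm, ip_smul_left, ip_comm]

lemma ip_neg_left : ip (-A) B = -ip A B := by simp [ip]

@[simp] lemma ip_zero_left : ip 0 A = 0 := by simp [ip]

@[simp] lemma ip_zero_right : ip A 0 = 0 := by simp [ip]

lemma ip_self_nonneg : 0 ≤ ip A A :=
  Finset.sum_nonneg fun _ _ => Finset.sum_nonneg fun _ _ => mul_self_nonneg _

lemma fro_nonneg : 0 ≤ fro A := Real.sqrt_nonneg _

lemma fro_sq : fro A ^ 2 = ip A A := Real.sq_sqrt (ip_self_nonneg A)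

lemma ip_eq_sum_prod : ip A B = ∑ p : Fin m × Fin n, A p.1 p.2 * B p.1 p.2 := by
  rw [Fintype.sum_prod_type]; rfl

lemma ip_le_fro_mul_fro : ip A B ≤ fro A * fro B := by
  simp only [fro, ip_eq_sum_prod]
  simpa [sq] using Real.sum_mul_le_sqrt_mul_sqrt Finset.univ
    (fun p : Fin m × Fin n => A p.1 p.2) (fun p => B p.1 p.2)

@[simp] lemma fro_neg : fro (-A) = fro A := by simp [fro, ip]

lemma abs_ip_le : |ip A B| ≤ fro A * fro B := by
  rw [abs_le]
  have h1 := ip_le_fro_mul_fro (-A) B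
  rw [fro_neg, ip_neg_left] at h1
  exact ⟨by linarith, ip_le_fro_mul_fro A B⟩

lemma fro_add_le : fro (A + B) ≤ fro A + fro B := by
  refine abs_le_of_sq_le_sq' ?_ (add_nonneg (fro_nonneg A) (fro_nonneg B)) |>.2
  rw [fro_sq, ip_add_left, ip_add_right, ip_add_right, ip_comm B A, add_sq, fro_sq, fro_sq]
  linarith [ip_le_fro_mul_fro A B]

lemma fro_smul (a : ℝ) : fro (a • A) = |a| * fro A := by
  rw [fro, ip_smul_left, ip_smul_right, ← mul_assoc, Real.sqrt_mul (mul_self_nonneg a),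
    Real.sqrt_mul_self_eq_abs, fro]

variable {A B} in
lemma fro_le_of_ip_le (h : ip A A ≤ ip B B) : fro A ≤ fro B := Real.sqrt_le_sqrt h

lemma fro_le_of_abs_le {z : ℝ} (hz : 0 ≤ z) {N : ℕ} (hm : m ≤ N) (hn : n ≤ N)
    (h : ∀ i j, |A i j| ≤ z) : fro A ≤ N * z := by
  refine Real.sqrt_le_iff.2 ⟨by positivity, ?_⟩
  calc ip A A ≤ ∑ _i : Fin m, ∑ _j : Fin n, z ^ 2 := by
        refine Finset.sum_le_sum fun i _ => Finset.sum_le_sum fun j _ => ?_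
        rw [← sq, ← sq_abs]
        gcongr
        exact h i j
    _ = m * n * z ^ 2 := by simp; ring
    _ ≤ N * N * z ^ 2 := by gcongr
    _ = _ := by ring

lemma abs_entry_le_fro (i : Fin m) (j : Fin n) : |A i j| ≤ fro A := by
  refine Real.abs_le_sqrt ?_
  rw [ip_eq_sum_prod, sq]
  exact Finset.single_le_sum (f := fun p : Fin m × Fin n => A p.1 p.2 * A p.1 p.2)
    (fun _ _ => mul_self_nonneg _) (Finset.mem_univ (i, j))

variable {A} in
lemma eq_zero_of_fro_eq_zero (h : fro A = 0) : A = 0 := by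
  ext i j
  simpa [h] using abs_entry_le_fro A i j

lemma ip_single (i : Fin m) (j : Fin n) : ip (Matrix.single i j 1) A = A i j := by
  rw [ip, Finset.sum_eq_single i, Finset.sum_eq_single j]
  · simp
  · intro j' _ h; simp [Matrix.single, Ne.symm h]
  · simp
  · intro i' _ h; simp [Matrix.single, Ne.symm h]
  · simp

lemma dot_mulVec_eq_ip (x : Fin n → ℝ) (y : Fin m → ℝ) :
    y ⬝ᵥ (A *ᵥ x) = ip (vecMulVec y x) A := by
  simp only [dotProduct, mulVec, ip, vecMulVec_apply, Finset.mul_sum]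
  exact Finset.sum_congr rfl fun i _ => Finset.sum_congr rfl fun j _ => by ring

lemma ip_vecMulVec_self (x : Fin n → ℝ) (y : Fin m → ℝ) :
    ip (vecMulVec y x) (vecMulVec y x) = (y ⬝ᵥ y) * (x ⬝ᵥ x) := by
  simp only [dotProduct, ip, vecMulVec_apply, Finset.sum_mul_sum]
  exact Finset.sum_congr rfl fun i _ => Finset.sum_congr rfl fun j _ => by ring

lemma fro_vecMulVec_le {x : Fin n → ℝ} {y : Fin m → ℝ} (hx : x ⬝ᵥ x ≤ 1) (hy : y ⬝ᵥ y ≤ 1) :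
    fro (vecMulVec y x) ≤ 1 := by
  rw [fro, ip_vecMulVec_self]
  refine Real.sqrt_le_one.2 (mul_le_one₀ hy (dot_self_nonneg x) hx)

lemma opLe_fro : OpLe A (fro A) := by
  intro x y hx hy
  rw [dot_mulVec_eq_ip]
  refine (ip_le_fro_mul_fro _ _).trans ?_
  simpa using mul_le_mul_of_nonneg_right (fro_vecMulVec_le hx hy) (fro_nonneg A)

lemma mask_add : mask O (A + B) = mask O A + mask O B := by
  ext i j; simp only [mask, of_apply, Matrix.add_apply]; split_ifs <;> simp

lemma mask_sub : mask O (A - B) = mask O A - mask O B := by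
  ext i j; simp only [mask, of_apply, Matrix.sub_apply]; split_ifs <;> simp

lemma mask_smul (a : ℝ) : mask O (a • A) = a • mask O A := by
  ext i j; simp only [mask, of_apply, Matrix.smul_apply]; split_ifs <;> simp

lemma mask_mask : mask O (mask O A) = mask O A := by
  ext i j; simp only [mask, of_apply]; split_ifs <;> rfl

lemma ip_mask_left : ip (mask O A) B = ip A (mask O B) := by
  refine Finset.sum_congr rfl fun i _ => Finset.sum_congr rfl fun j _ => ?_
  simp only [mask, of_apply]; split_ifs <;> simp

lemma mask_add_mask_not : mask O A + mask (fun x => !O x) A = A := by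
  ext i j; simp only [mask, of_apply, Matrix.add_apply]; by_cases h : O (i, j) <;> simp [h]

lemma fro_mask_le : fro (mask O A) ≤ fro A := by
  refine fro_le_of_ip_le (Finset.sum_le_sum fun i _ => Finset.sum_le_sum fun j _ => ?_)
  simp only [mask, of_apply]; split_ifs
  · rfl
  · simpa using mul_self_nonneg _

lemma fro_le_l1Norm : fro A ≤ l1Norm A := by
  have hn : 0 ≤ l1Norm A :=
    Finset.sum_nonneg fun _ _ => Finset.sum_nonneg fun _ _ => abs_nonneg _
  refine Real.sqrt_le_iff.2 ⟨hn, ?_⟩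
  have e : l1Norm A = ∑ p : Fin m × Fin n, |A p.1 p.2| := by rw [Fintype.sum_prod_type]; rfl
  rw [ip_eq_sum_prod, e, sq, Finset.sum_mul]
  refine Finset.sum_le_sum fun p _ => ?_
  rw [← abs_mul_abs_self]
  refine mul_le_mul_of_nonneg_left ?_ (abs_nonneg _)
  exact Finset.single_le_sum (f := fun p : Fin m × Fin n => |A p.1 p.2|)
    (fun _ _ => abs_nonneg _) (Finset.mem_univ p)

lemma ip_eq_trace : ip A B = trace (Aᵀ * B) := by
  simp only [ip, trace, diag_apply, mul_apply, transpose_apply]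
  exact Finset.sum_comm

lemma ip_mul_left {k : ℕ} (P : Matrix (Fin m) (Fin k) ℝ) (A : Matrix (Fin k) (Fin n) ℝ) :
    ip (P * A) B = ip A (Pᵀ * B) := by
  rw [ip_eq_trace, ip_eq_trace, transpose_mul, Matrix.mul_assoc]

lemma ip_mul_right {k : ℕ} (A : Matrix (Fin m) (Fin k) ℝ) (R : Matrix (Fin k) (Fin n) ℝ) :
    ip (A * R) B = ip A (B * Rᵀ) := by
  rw [ip_eq_trace, ip_eq_trace, transpose_mul, Matrix.mul_assoc, trace_mul_comm, Matrix.mul_assoc]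

end Frobenius

/-! ### The tangent space projection -/

/-- Orthogonal projection matrices. -/
structure IsProj {n : ℕ} (P : Matrix (Fin n) (Fin n) ℝ) : Prop where
  symm : Pᵀ = P
  idem : P * P = P

lemma isProj_mul_transpose {n r : ℕ} {U : Matrix (Fin n) (Fin r) ℝ} (hU : Uᵀ * U = 1) :
    IsProj (U * Uᵀ) where
  symm := by simp
  idem := by
    rw [Matrix.mul_assoc, ← Matrix.mul_assoc Uᵀ, hU, Matrix.one_mul]

/-- The projection `X ↦ P X + X R - P X R`. -/
def tproj {m n : ℕ} (P : Matrix (Fin m) (Fin m) ℝ) (R : Matrix (Fin n) (Fin n) ℝ)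
    (X : Matrix (Fin m) (Fin n) ℝ) : Matrix (Fin m) (Fin n) ℝ := P * X + X * R - P * X * R

section Tproj

variable {m n : ℕ} {P : Matrix (Fin m) (Fin m) ℝ} {R : Matrix (Fin n) (Fin n) ℝ}
  (X Y : Matrix (Fin m) (Fin n) ℝ)

lemma tproj_add : tproj P R (X + Y) = tproj P R X + tproj P R Y := by
  simp only [tproj, Matrix.mul_add, Matrix.add_mul]; abel

lemma tproj_smul (a : ℝ) : tproj P R (a • X) = a • tproj P R X := by
  simp only [tproj, Matrix.mul_smul, Matrix.smul_mul, smul_sub, smul_add]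

lemma tproj_sub : tproj P R (X - Y) = tproj P R X - tproj P R Y := by
  simp only [tproj, Matrix.mul_sub, Matrix.sub_mul]; abel

@[simp] lemma tproj_zero : tproj P R (0 : Matrix (Fin m) (Fin n) ℝ) = 0 := by simp [tproj]

lemma tproj_sum {κ : Type*} (s : Finset κ) (A : κ → Matrix (Fin m) (Fin n) ℝ) :
    tproj P R (∑ k ∈ s, A k) = ∑ k ∈ s, tproj P R (A k) := by
  classical
  induction s using Finset.induction_on with
  | empty => simp
  | insert a s ha ih => rw [Finset.sum_insert ha, Finset.sum_insert ha, tproj_add, ih]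

lemma tproj_tproj (hP : IsProj P) (hR : IsProj R) : tproj P R (tproj P R X) = tproj P R X := by
  have h1 : ∀ Z : Matrix (Fin m) (Fin n) ℝ, P * (P * Z) = P * Z := fun Z => by
    rw [← Matrix.mul_assoc, hP.idem]
  simp only [tproj, Matrix.mul_add, Matrix.mul_sub, Matrix.add_mul, Matrix.sub_mul,
    Matrix.mul_assoc, h1, hR.idem]
  abel

lemma ip_tproj_left (hP : IsProj P) (hR : IsProj R) :
    ip (tproj P R X) Y = ip X (tproj P R Y) := by
  simp only [tproj, ip_sub_left, ip_add_left, ip_sub_right, ip_add_right, ip_mul_right _ _ R,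
    ip_mul_left _ P, hP.symm, hR.symm, Matrix.mul_assoc]

lemma sub_tproj_eq : X - tproj P R X = (1 - P) * X * (1 - R) := by
  simp only [tproj, Matrix.sub_mul, Matrix.mul_sub, Matrix.one_mul, Matrix.mul_one]
  abel

lemma IsProj.dot_mulVec_self {n : ℕ} {P : Matrix (Fin n) (Fin n) ℝ} (hP : IsProj P)
    (x : Fin n → ℝ) : (P *ᵥ x) ⬝ᵥ (P *ᵥ x) = x ⬝ᵥ (P *ᵥ x) := by
  rw [dotProduct_mulVec, vecMul_mulVec, hP.symm, hP.idem, dotProduct_comm, ← mulVec_transpose,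
    hP.symm]

lemma IsProj.one_sub {n : ℕ} {P : Matrix (Fin n) (Fin n) ℝ} (hP : IsProj P) : IsProj (1 - P) where
  symm := by simp [hP.symm]
  idem := by simp [Matrix.mul_sub, Matrix.sub_mul, hP.idem]

lemma IsProj.dot_add {n : ℕ} {P : Matrix (Fin n) (Fin n) ℝ} (hP : IsProj P) (x : Fin n → ℝ) :
    (P *ᵥ x) ⬝ᵥ (P *ᵥ x) + ((1 - P) *ᵥ x) ⬝ᵥ ((1 - P) *ᵥ x) = x ⬝ᵥ x := by
  rw [hP.dot_mulVec_self, hP.one_sub.dot_mulVec_self, sub_mulVec, dotProduct_sub, one_mulVec]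
  ring

lemma IsProj.dot_mulVec_le {n : ℕ} {P : Matrix (Fin n) (Fin n) ℝ} (hP : IsProj P)
    (x : Fin n → ℝ) : (P *ᵥ x) ⬝ᵥ (P *ᵥ x) ≤ x ⬝ᵥ x := by
  linarith [hP.dot_add x, dot_self_nonneg ((1 - P) *ᵥ x)]

lemma IsProj.dot_mul_mulVec (hP : IsProj P) (x : Fin n → ℝ) (y : Fin m → ℝ) :
    y ⬝ᵥ ((P * X * R) *ᵥ x) = (P *ᵥ y) ⬝ᵥ (X *ᵥ (R *ᵥ x)) := by
  rw [← mulVec_mulVec, ← mulVec_mulVec, dotProduct_mulVec, ← mulVec_transpose, hP.symm]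

lemma opLe_sub_tproj (hP : IsProj P) (hR : IsProj R) {X : Matrix (Fin m) (Fin n) ℝ} {c : ℝ}
    (h : OpLe X c) : OpLe (X - tproj P R X) c := by
  intro x y hx hy
  rw [sub_tproj_eq, hP.one_sub.dot_mul_mulVec]
  exact h _ _ ((hR.one_sub.dot_mulVec_le x).trans hx) ((hP.one_sub.dot_mulVec_le y).trans hy)

end Tproj

/-! ### Subgradients of the nuclear norm. -/

section Certificate

variable {m n r : ℕ} {U : Matrix (Fin m) (Fin r) ℝ} {V : Matrix (Fin n) (Fin r) ℝ}

lemma tproj_mul_diagonal_mul (hU : Uᵀ * U = 1) (hV : Vᵀ * V = 1) (D : Matrix (Fin r) (Fin r) ℝ) :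
    tproj (U * Uᵀ) (V * Vᵀ) (U * D * Vᵀ) = U * D * Vᵀ := by
  have h1 : U * Uᵀ * (U * D * Vᵀ) = U * D * Vᵀ := by
    simp only [← Matrix.mul_assoc]; rw [Matrix.mul_assoc U Uᵀ U, hU, Matrix.mul_one]
  have h2 : U * D * Vᵀ * (V * Vᵀ) = U * D * Vᵀ := by
    rw [Matrix.mul_assoc _ Vᵀ, ← Matrix.mul_assoc Vᵀ, hV, Matrix.one_mul]
  rw [tproj, h1, h2]; abel

lemma tproj_mul_transpose (hU : Uᵀ * U = 1) (hV : Vᵀ * V = 1) :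
    tproj (U * Uᵀ) (V * Vᵀ) (U * Vᵀ) = U * Vᵀ := by
  simpa using tproj_mul_diagonal_mul hU hV 1

/-- UVᵀ sees only the components Py and Rx, and W only the complementary ones. Each of the two forms
is at most half the sum of the squared lengths it sees, and by Pythagoras the halves add up to (|x|²
+ |y|²)/2. Such matrices are the dual witnesses for the nuclear norm at L₀. -/
lemma opLe_mul_transpose_add (hU : Uᵀ * U = 1) (hV : Vᵀ * V = 1) {W : Matrix (Fin m) (Fin n) ℝ}
    (hW : tproj (U * Uᵀ) (V * Vᵀ) W = 0) (hW1 : OpLe W 1) : OpLe (U * Vᵀ + W) 1 := by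
  intro x y hx hy
  have hP := isProj_mul_transpose hU
  have hR := isProj_mul_transpose hV
  have eW : W = (1 - U * Uᵀ) * W * (1 - V * Vᵀ) := by rw [← sub_tproj_eq, hW, sub_zero]
  set P := U * Uᵀ
  set R := V * Vᵀ
  have e1 : y ⬝ᵥ ((U * Vᵀ) *ᵥ x) = (P *ᵥ y) ⬝ᵥ ((U * Vᵀ) *ᵥ (R *ᵥ x)) := by
    rw [← hP.dot_mul_mulVec]
    congr 2
    simp only [P, R, ← Matrix.mul_assoc]
    rw [Matrix.mul_assoc U Uᵀ U, hU, Matrix.mul_one, Matrix.mul_assoc U Vᵀ V, hV, Matrix.mul_one]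
  have hUV : ∀ z : Fin n → ℝ, ((U * Vᵀ) *ᵥ z) ⬝ᵥ ((U * Vᵀ) *ᵥ z) = z ⬝ᵥ (R *ᵥ z) := by
    intro z
    rw [dotProduct_mulVec, vecMul_mulVec, dotProduct_comm, ← hR.symm, mulVec_transpose]
    congr 2
    simp only [R, transpose_mul, transpose_transpose]
    rw [Matrix.mul_assoc V, ← Matrix.mul_assoc Uᵀ, hU, Matrix.one_mul]
  have hRx : (R *ᵥ x) ⬝ᵥ (R *ᵥ (R *ᵥ x)) = (R *ᵥ x) ⬝ᵥ (R *ᵥ x) := by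
    rw [mulVec_mulVec, hR.idem]
  have cs : ∀ {k : ℕ} (a b : Fin k → ℝ), 2 * (a ⬝ᵥ b) ≤ a ⬝ᵥ a + b ⬝ᵥ b := by
    intro k a b
    have := dot_self_nonneg (a - b)
    simp only [sub_dotProduct, dotProduct_sub, dotProduct_comm b a] at this
    linarith
  have h1 := cs (P *ᵥ y) ((U * Vᵀ) *ᵥ (R *ᵥ x))
  rw [← e1, hUV, hRx] at h1
  have e2 : y ⬝ᵥ (W *ᵥ x) = ((1 - P) *ᵥ y) ⬝ᵥ (W *ᵥ ((1 - R) *ᵥ x)) := by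
    rw [← hP.one_sub.dot_mul_mulVec, ← eW]
  have h2 := hW1.dot_le (x := (1 - R) *ᵥ x) (y := (1 - P) *ᵥ y) (Real.sqrt_nonneg _)
    (Real.sqrt_nonneg _) (Real.sq_sqrt (dot_self_nonneg _)).ge (Real.sq_sqrt (dot_self_nonneg _)).ge
  rw [← e2] at h2
  have h3 := two_mul_le_add_sq (√((1 - R) *ᵥ x ⬝ᵥ (1 - R) *ᵥ x)) (√((1 - P) *ᵥ y ⬝ᵥ (1 - P) *ᵥ y))
  rw [Real.sq_sqrt (dot_self_nonneg _), Real.sq_sqrt (dot_self_nonneg _)] at h3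
  rw [add_mulVec, dotProduct_add]
  linarith [hP.dot_add y, hR.dot_add x]

/-! ### The nuclear norm -/

/-- The vectors are an orthonormal eigenbasis of XᵀX. Completeness is stated as Parseval's identity,
and the singular values become the lengths |X vᵢ|. -/
lemma exists_singular_basis (X : Matrix (Fin m) (Fin n) ℝ) : ∃ v : Fin n → Fin n → ℝ,
    (∀ i, v i ⬝ᵥ v i = 1) ∧ (∀ a b, ∑ i, (a ⬝ᵥ v i) * (v i ⬝ᵥ b) = a ⬝ᵥ b) ∧
    (∀ i j, i ≠ j → (X *ᵥ v i) ⬝ᵥ (X *ᵥ v j) = 0) ∧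
    nuclearNorm X = ∑ i, √((X *ᵥ v i) ⬝ᵥ (X *ᵥ v i)) := by
  have hn : Module.finrank ℝ (EuclideanSpace ℝ (Fin n)) = n := by simp
  set T := Matrix.toEuclideanLin X with hT
  set b := T.isSymmetric_adjoint_comp_self.eigenvectorBasis hn with hb
  have inner_eq : ∀ {k : ℕ} (x y : EuclideanSpace ℝ (Fin k)), inner ℝ x y = x.ofLp ⬝ᵥ y.ofLp := by
    intro k x y
    rw [EuclideanSpace.inner_eq_star_dotProduct]; simp [dotProduct_comm]
  have hTv : ∀ i, (T (b i)).ofLp = X *ᵥ (b i).ofLp := fun i => rfl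
  have hTT : ∀ i j, (X *ᵥ (b i).ofLp) ⬝ᵥ (X *ᵥ (b j).ofLp) =
      T.isSymmetric_adjoint_comp_self.eigenvalues hn j * inner ℝ (b i) (b j) := by
    intro i j
    rw [← hTv, ← hTv, ← inner_eq, ← LinearMap.adjoint_inner_right]
    have := T.isSymmetric_adjoint_comp_self.apply_eigenvectorBasis hn j
    rw [LinearMap.comp_apply, ← hb] at this
    rw [this, inner_smul_right]
    simp
  refine ⟨fun i => (b i).ofLp, fun i => ?_, fun x y => ?_, fun i j hij => ?_, ?_⟩
  · rw [← inner_eq]; simp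
  · have := b.sum_inner_mul_inner (WithLp.toLp 2 x) (WithLp.toLp 2 y)
    simpa only [inner_eq] using this
  · rw [hTT, b.orthonormal.2 hij, mul_zero]
  · rw [nuclearNorm, Finset.sum_range]
    refine Finset.sum_congr rfl fun i _ => ?_
    rw [hTT, ← hT, LinearMap.singularValues_fin T hn]
    simp

/-- Half of the duality of operator and nuclear norm: compute the inner product in the right
singular basis of X and bound each (Q vᵢ)·(X vᵢ) by |X vᵢ|. -/
lemma ip_le_nuclearNorm {Q : Matrix (Fin m) (Fin n) ℝ} (hQ : OpLe Q 1)
    (X : Matrix (Fin m) (Fin n) ℝ) : ip Q X ≤ nuclearNorm X := by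
  obtain ⟨v, hv1, hv2, -, hX⟩ := exists_singular_basis X
  have e : ip Q X = ∑ i, (Q *ᵥ v i) ⬝ᵥ (X *ᵥ v i) := by
    have : ip Q X = ∑ a, Q a ⬝ᵥ X a := rfl
    rw [this]
    rw [Finset.sum_congr rfl fun a _ => (hv2 (Q a) (X a)).symm, Finset.sum_comm]
    refine Finset.sum_congr rfl fun i _ => Finset.sum_congr rfl fun a _ => ?_
    rw [dotProduct_comm (v i)]; rfl
  rw [e, hX]
  refine Finset.sum_le_sum fun i _ => ?_
  have := hQ.dot_le (x := v i) (y := X *ᵥ v i) zero_le_one (Real.sqrt_nonneg _) (by simp [hv1])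
    (Real.sq_sqrt (dot_self_nonneg _)).ge
  rw [dotProduct_comm]
  linarith

/-- Writing |X vᵢ| = wᵢ · X vᵢ expresses the nuclear norm as Σ_k σ_k Σ_i (u_k·wᵢ)(v_k·vᵢ). The inner
sum is at most 1 by Bessel for w, Parseval for v and the arithmetic-geometric mean inequality. This
avoids identifying σ with the sorted singular values. -/
lemma nuclearNorm_le_sum (hU : Uᵀ * U = 1) (hV : Vᵀ * V = 1) {σ : Fin r → ℝ} (hσ : ∀ k, 0 ≤ σ k) :
    nuclearNorm (U * diagonal σ * Vᵀ) ≤ ∑ k, σ k := by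
  set X := U * diagonal σ * Vᵀ with hXdef
  obtain ⟨v, hv1, hv2, hv3, hX⟩ := exists_singular_basis X
  set s : Fin n → ℝ := fun i => √((X *ᵥ v i) ⬝ᵥ (X *ᵥ v i)) with hs
  have hs2 : ∀ i, s i ^ 2 = (X *ᵥ v i) ⬝ᵥ (X *ᵥ v i) := fun i => Real.sq_sqrt (dot_self_nonneg _)
  -- When s i = 0 the inverse is 0 and so is w i; the family is then orthogonal with lengths at most
  -- 1, which is all that Bessel's inequality needs.
  set w : Fin n → Fin m → ℝ := fun i => (s i)⁻¹ • (X *ᵥ v i) with hw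
  have hww : ∀ i, w i ⬝ᵥ w i ≤ 1 := by
    intro i
    simp only [hw, smul_dotProduct, dotProduct_smul, smul_eq_mul, ← hs2]
    rcases eq_or_ne (s i) 0 with h | h
    · simp [h]
    · exact le_of_eq (by field_simp)
  have hwo : ∀ i j, i ≠ j → w i ⬝ᵥ w j = 0 := by
    intro i j hij
    simp only [hw, smul_dotProduct, dotProduct_smul, smul_eq_mul, hv3 i j hij, mul_zero]
  have bessel : ∀ u : Fin m → ℝ, ∑ i, (u ⬝ᵥ w i) ^ 2 ≤ u ⬝ᵥ u := by
    intro u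
    set y := ∑ i, (u ⬝ᵥ w i) • w i with hy
    have h1 : u ⬝ᵥ y = ∑ i, (u ⬝ᵥ w i) ^ 2 := by
      rw [hy, dotProduct_sum]
      exact Finset.sum_congr rfl fun i _ => by rw [dotProduct_smul, smul_eq_mul, sq]
    have h2 : y ⬝ᵥ y ≤ ∑ i, (u ⬝ᵥ w i) ^ 2 := by
      rw [hy, dotProduct_sum]
      refine Finset.sum_le_sum fun i _ => ?_
      rw [sum_dotProduct, Finset.sum_eq_single i]
      · rw [dotProduct_smul, smul_dotProduct, smul_eq_mul, smul_eq_mul]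
        nlinarith [hww i, sq_nonneg (u ⬝ᵥ w i)]
      · intro j _ hj
        rw [dotProduct_smul, smul_dotProduct, hwo j i hj]; simp
      · simp
    have h3 := dot_self_nonneg (u - y)
    simp only [sub_dotProduct, dotProduct_sub, dotProduct_comm y u] at h3
    linarith
  have hUk : ∀ k, (fun a => U a k) ⬝ᵥ (fun a => U a k) = 1 := fun k => by
    have := congrFun (congrFun hU k) k
    simpa [mul_apply, dotProduct] using this
  have hVk : ∀ k, (fun a => V a k) ⬝ᵥ (fun a => V a k) = 1 := fun k => by
    have := congrFun (congrFun hV k) k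
    simpa [mul_apply, dotProduct] using this
  have e1 : ∀ i, s i = w i ⬝ᵥ (X *ᵥ v i) := by
    intro i
    simp only [hw, smul_dotProduct, smul_eq_mul, ← hs2]
    rcases eq_or_ne (s i) 0 with h | h
    · simp [h]
    · field_simp
  have e2 : ∀ i, w i ⬝ᵥ (X *ᵥ v i) =
      ∑ k, σ k * (((fun a => U a k) ⬝ᵥ w i) * ((fun a => V a k) ⬝ᵥ v i)) := by
    intro i
    rw [hXdef, ← mulVec_mulVec, ← mulVec_mulVec, dotProduct_mulVec, dotProduct]
    refine Finset.sum_congr rfl fun k _ => ?_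
    rw [mulVec_diagonal]
    have : vecMul (w i) U k = (fun a => U a k) ⬝ᵥ w i := by
      rw [dotProduct_comm]; rfl
    rw [this]
    have : (Vᵀ *ᵥ v i) k = (fun a => V a k) ⬝ᵥ v i := rfl
    rw [this]; ring
  have hfin : ∀ k, ∑ i, ((fun a => U a k) ⬝ᵥ w i) * ((fun a => V a k) ⬝ᵥ v i) ≤ 1 := by
    intro k
    have h1 := bessel (fun a => U a k)
    have h2 := hv2 (fun a => V a k) (fun a => V a k)
    rw [hUk] at h1
    rw [hVk] at h2
    have h3 : ∑ i, ((fun a => U a k) ⬝ᵥ w i) * ((fun a => V a k) ⬝ᵥ v i) ≤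
        ∑ i, (((fun a => U a k) ⬝ᵥ w i) ^ 2 / 2 +
          ((fun a => V a k) ⬝ᵥ v i) * (v i ⬝ᵥ (fun a => V a k)) / 2) := by
      refine Finset.sum_le_sum fun i _ => ?_
      rw [dotProduct_comm (v i)]
      nlinarith [two_mul_le_add_sq ((fun a => U a k) ⬝ᵥ w i) ((fun a => V a k) ⬝ᵥ v i)]
    rw [Finset.sum_add_distrib, ← Finset.sum_div, ← Finset.sum_div, h2] at h3
    linarith
  calc nuclearNorm X = ∑ i, s i := hX
    _ = ∑ k, σ k * ∑ i, ((fun a => U a k) ⬝ᵥ w i) * ((fun a => V a k) ⬝ᵥ v i) := by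
        simp only [e1, e2]
        rw [Finset.sum_comm]
        simp only [Finset.mul_sum]
    _ ≤ ∑ k, σ k * 1 := by gcongr with k; exact hσ k; exact hfin k
    _ = _ := by simp

end Certificate

/-! ### Dual certificates -/

/-- The subgradient inequality for the ℓ₁ norm. The values of ε at positions of O where S vanishes
are free, so O may be larger than the support of S. -/
lemma l1Norm_sub_ge {m n : ℕ} (O : Fin m × Fin n → Bool) {S ε : Matrix (Fin m) (Fin n) ℝ}
    (H : Matrix (Fin m) (Fin n) ℝ) (hε : ∀ i j, |ε i j| ≤ 1)
    (hS : ∀ i j, S i j ≠ 0 → O (i, j) ∧ S i j * ε i j = |S i j|) :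
    l1Norm S - ip (mask O ε) H + l1Norm (mask (fun x => !O x) H) ≤ l1Norm (S - H) := by
  simp only [l1Norm, ip, ← Finset.sum_sub_distrib, ← Finset.sum_add_distrib]
  refine Finset.sum_le_sum fun i _ => Finset.sum_le_sum fun j _ => ?_
  simp only [mask, of_apply, Matrix.sub_apply]
  have h1 := hε i j
  by_cases hO : O (i, j)
  · simp only [hO, if_true, Bool.not_true, Bool.false_eq_true, if_false, abs_zero, add_zero]
    have h2 : S i j * ε i j = |S i j| := by
      by_cases h : S i j = 0
      · simp [h]
      · exact (hS i j h).2
    rw [← h2]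
    calc S i j * ε i j - ε i j * H i j = (S i j - H i j) * ε i j := by ring
      _ ≤ |S i j - H i j| * |ε i j| := by rw [← abs_mul]; exact le_abs_self _
      _ ≤ |S i j - H i j| * 1 := by gcongr
      _ = _ := mul_one _
  · have h2 : S i j = 0 := by
      by_contra h
      exact hO (hS i j h).1
    simp [hO, h2]

/-- A dual certificate guarantees exact recovery. -/
theorem isExact_of_certificate {m n : ℕ} {lam : ℝ} (h0 : 0 < lam) (h1 : lam < 1)
    {r : ℕ} {L : Matrix (Fin m) (Fin n) ℝ} {U : Matrix (Fin m) (Fin r) ℝ} {σ : Fin r → ℝ}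
    {V : Matrix (Fin n) (Fin r) ℝ} (hU : Uᵀ * U = 1) (hV : Vᵀ * V = 1) (hσ : ∀ k, 0 < σ k)
    (hL : L = U * diagonal σ * Vᵀ) (O : Fin m × Fin n → Bool)
    {ε W : Matrix (Fin m) (Fin n) ℝ} (hε : ∀ i j, |ε i j| ≤ 1)
    (hW : tproj (U * Uᵀ) (V * Vᵀ) W = 0) (hW1 : OpLe W (1 / 2))
    (hOn : fro (mask O (U * Vᵀ + W - lam • ε)) ≤ lam / 4)
    (hOff : ∀ i j, O (i, j) = false → |(U * Vᵀ + W) i j| ≤ lam / 2)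
    (hOT : ∀ X, fro (mask O (tproj (U * Uᵀ) (V * Vᵀ) X)) ≤ 1 / 2 * fro X)
    {S : Matrix (Fin m) (Fin n) ℝ} (hS : ∀ i j, S i j ≠ 0 → O (i, j) ∧ S i j * ε i j = |S i j|) :
    IsExact lam L S := by
  have hP := isProj_mul_transpose hU
  have hR := isProj_mul_transpose hV
  have hnuc := nuclearNorm_le_sum hU hV fun k => (hσ k).le
  have hTL := tproj_mul_diagonal_mul hU hV (diagonal σ)
  have hbase := fun W' h h' => opLe_mul_transpose_add (W := W') hU hV h h'
  rw [← hL] at hnuc hTL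
  have hipL : ip (U * Vᵀ) L = ∑ k, σ k := by
    have : (U * Vᵀ)ᵀ * L = V * (diagonal σ * Vᵀ) := by
      rw [hL, transpose_mul, transpose_transpose]
      simp only [Matrix.mul_assoc]
      rw [← Matrix.mul_assoc Uᵀ U, hU, Matrix.one_mul]
    rw [ip_eq_trace, this, trace_mul_comm, Matrix.mul_assoc, hV, Matrix.mul_one,
      trace_diagonal]
  set P := U * Uᵀ
  set R := V * Vᵀ
  -- The objective grows at least linearly in the part of H orthogonal to T and in the part of H off
  -- O. If both vanish, H lies in T and is supported on O, and `hOT` forces H = 0.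
  have main : ∀ H, nuclearNorm L + lam * l1Norm S + (1 / 2 * (1 - lam) * fro (H - tproj P R H) +
      lam / 4 * fro (mask (fun x => !O x) H)) ≤ nuclearNorm (L + H) + lam * l1Norm (S - H) := by
    intro H
    set D := H - tproj P R H with hD
    have hTD : tproj P R D = 0 := by rw [hD, tproj_sub, tproj_tproj _ hP hR, sub_self]
    have hipD : ip D H = fro D ^ 2 := by
      rw [fro_sq]
      conv_rhs => rw [ip_comm, hD, ip_sub_left, ip_tproj_left _ _ hP hR, ← hD, hTD]
      rw [ip_comm]; simp
    -- Since ‖W‖ ≤ 1/2, there is room to add half of the normalized D to the dual witness; pairing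
    -- it with H gains ‖D‖/2. If D = 0, the inverse makes W₀ = 0 as well.
    set W₀ := (fro D)⁻¹ • D with hW₀
    have hfD := fro_nonneg D
    have hW₀op : OpLe W₀ 1 := by
      refine (opLe_fro W₀).mono ?_
      rw [hW₀, fro_smul, abs_of_nonneg (inv_nonneg.2 hfD)]
      exact inv_mul_le_one
    have hW₀H : ip W₀ H = fro D := by
      rw [hW₀, ip_smul_left, hipD]
      rcases eq_or_ne (fro D) 0 with h | h
      · simp [h]
      · field_simp
    have hW' : tproj P R (W + (1 / 2 : ℝ) • W₀) = 0 := by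
      rw [tproj_add, hW, hW₀, tproj_smul, tproj_smul, hTD]; simp
    have hQ := hbase (W + (1 / 2 : ℝ) • W₀) hW' ((hW1.add (hW₀op.smul (by norm_num))).mono
      (by norm_num))
    have h2 := ip_le_nuclearNorm hQ (L + H)
    have h3 : ip (W + (1 / 2 : ℝ) • W₀) L = 0 := by
      rw [← hTL, ← ip_tproj_left _ _ hP hR, hW', ip_zero_left]
    have h4 : ip (U * Vᵀ + (W + (1 / 2 : ℝ) • W₀)) (L + H) =
        ∑ k, σ k + ip (U * Vᵀ + W) H + 1 / 2 * fro D := by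
      rw [ip_add_right, ip_add_left, h3, hipL, ← add_assoc, ip_add_left, ip_smul_left, hW₀H]
      ring
    have h5 := l1Norm_sub_ge O H hε hS
    set Q := U * Vᵀ + W with hQdef
    set Oc : Fin m × Fin n → Bool := fun x => !O x with hOc
    have h6 : ip Q H - lam * ip (mask O ε) H =
        ip (mask O (Q - lam • ε)) (mask O H) + ip (mask Oc Q) H := by
      rw [← ip_mask_left, mask_mask, mask_sub, mask_smul, ip_sub_left, ip_smul_left]
      conv_lhs => rw [← mask_add_mask_not Q O, ip_add_left]
      ring
    have h7 : -(lam / 4 * fro (mask O H)) ≤ ip (mask O (Q - lam • ε)) (mask O H) := by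
      have := (abs_le.1 (abs_ip_le (mask O (Q - lam • ε)) (mask O H))).1
      have h := mul_le_mul_of_nonneg_right hOn (fro_nonneg (mask O H))
      linarith
    have h8 : -(lam / 2 * l1Norm (mask Oc H)) ≤ ip (mask Oc Q) H := by
      rw [neg_le, ← ip_neg_left, l1Norm, ip, Finset.mul_sum]
      refine Finset.sum_le_sum fun i _ => ?_
      rw [Finset.mul_sum]
      refine Finset.sum_le_sum fun j _ => ?_
      simp only [mask, of_apply, hOc, Matrix.neg_apply]
      by_cases h : O (i, j)
      · simp [h]
      · have h' := hOff i j (by simpa using h)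
        rw [if_pos (by simpa using h), if_pos (by simpa using h)]
        calc -(Q i j) * H i j ≤ |-(Q i j) * H i j| := le_abs_self _
          _ = |Q i j| * |H i j| := by rw [abs_mul, abs_neg]
          _ ≤ _ := by gcongr
    have h9 : fro (mask Oc H) ≤ l1Norm (mask Oc H) := fro_le_l1Norm _
    -- The bound ‖P_O P_T‖ ≤ 1/2 gives ‖P_O H‖ ≤ ‖H‖/2 + ‖D‖; splitting H over O and its complement,
    -- the term ‖P_O H‖/2 is absorbed on the left.
    have h10 : fro (mask O H) ≤ fro (mask Oc H) + 2 * fro D := by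
      have e : H = tproj P R H + D := by rw [hD]; abel
      have a1 : fro (mask O H) ≤ fro (mask O (tproj P R H)) + fro (mask O D) := by
        conv_lhs => rw [e, mask_add]
        exact fro_add_le _ _
      have a2 := hOT H
      have a3 := fro_mask_le D O
      have a4 : fro H ≤ fro (mask O H) + fro (mask Oc H) := by
        conv_lhs => rw [← mask_add_mask_not H O]
        exact fro_add_le _ _
      linarith
    have h11 := mul_le_mul_of_nonneg_left h5 h0.le
    have h12 := mul_le_mul_of_nonneg_left h9 h0.le
    have h13 := mul_le_mul_of_nonneg_left h10 h0.le
    rw [h4] at h2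
    linarith
  have key : ∀ L' S', L' + S' = L + S → ∃ H, L' = L + H ∧ S' = S - H := by
    intro L' S' h
    exact ⟨L' - L, by abel, by rw [eq_sub_of_add_eq' h]; abel⟩
  have pos : ∀ H, 0 ≤ 1 / 2 * (1 - lam) * fro (H - tproj P R H) +
      lam / 4 * fro (mask (fun x => !O x) H) := by
    intro H
    have := fro_nonneg (H - tproj P R H)
    have := fro_nonneg (mask (fun x => !O x) H)
    have : 0 < 1 - lam := by linarith
    positivity
  refine ⟨⟨rfl, fun L' S' h => ?_⟩, fun L' S' h => ?_⟩
  · obtain ⟨H, rfl, rfl⟩ := key L' S' h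
    linarith [main H, pos H]
  · obtain ⟨H, rfl, rfl⟩ := key L' S' h.1
    have h2 := h.2 L S rfl
    have h3 := main H
    have hA := fro_nonneg (H - tproj P R H)
    have hB := fro_nonneg (mask (fun x => !O x) H)
    have hlam : 0 < 1 - lam := by linarith
    have hA0 : fro (H - tproj P R H) = 0 := by
      nlinarith [mul_nonneg h0.le hB, mul_nonneg hlam.le hA]
    have hB0 : fro (mask (fun x => !O x) H) = 0 := by
      nlinarith [mul_nonneg h0.le hB, mul_nonneg hlam.le hA]
    have e1 : H = tproj P R H := sub_eq_zero.1 (eq_zero_of_fro_eq_zero hA0)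
    have e2 : H = mask O H := by
      conv_lhs => rw [← mask_add_mask_not H O, eq_zero_of_fro_eq_zero hB0, add_zero]
    have h4 := hOT H
    rw [← e1, ← e2] at h4
    have : H = 0 := eq_zero_of_fro_eq_zero (le_antisymm (by linarith) (fro_nonneg H))
    simp [this]

/-! ### Trace moments of sums of independent rank-one matrices -/

section Moments

variable {r : ℕ}

/-- With u·Sᵏu = Σ lⱼᵏ (u·vⱼ)², these quadratic forms are moments of a positive measure on the
spectrum, so the moment inequalities below become scalar ones. -/
lemma exists_eigenbasis {S : Matrix (Fin r) (Fin r) ℝ} (hS : S.PosSemidef) :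
    ∃ (v : Fin r → Fin r → ℝ) (l : Fin r → ℝ), (∀ j, 0 ≤ l j) ∧
      (∀ a b, ∑ j, (a ⬝ᵥ v j) * (v j ⬝ᵥ b) = a ⬝ᵥ b) ∧
      (∀ (k : ℕ) (u : Fin r → ℝ), u ⬝ᵥ (S ^ k *ᵥ u) = ∑ j, l j ^ k * (u ⬝ᵥ v j) ^ 2) ∧
      ∀ k : ℕ, trace (S ^ k) = ∑ j, l j ^ k := by
  have inner_eq : ∀ x y : EuclideanSpace ℝ (Fin r), inner ℝ x y = x.ofLp ⬝ᵥ y.ofLp := by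
    intro x y
    rw [EuclideanSpace.inner_eq_star_dotProduct]; simp [dotProduct_comm]
  set b := hS.isHermitian.eigenvectorBasis
  set v : Fin r → Fin r → ℝ := fun j => (b j).ofLp with hv
  set l := hS.isHermitian.eigenvalues
  have hpars : ∀ a c : Fin r → ℝ, ∑ j, (a ⬝ᵥ v j) * (v j ⬝ᵥ c) = a ⬝ᵥ c := by
    intro x y
    have := b.sum_inner_mul_inner (WithLp.toLp 2 x) (WithLp.toLp 2 y)
    simpa only [inner_eq] using this
  have hone : ∀ j, v j ⬝ᵥ v j = 1 := by
    intro j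
    simp only [hv]
    rw [← inner_eq]; simp
  have hpow : ∀ (k : ℕ) j, S ^ k *ᵥ v j = l j ^ k • v j := by
    intro k j
    induction k with
    | zero => simp
    | succ k ih =>
      rw [pow_succ, ← mulVec_mulVec, hS.isHermitian.mulVec_eigenvectorBasis, mulVec_smul]
      change l j • (S ^ k *ᵥ v j) = _
      rw [ih, smul_smul, pow_succ, mul_comm]
  have hsymm : ∀ k : ℕ, (S ^ k)ᵀ = S ^ k := by
    intro k
    rw [transpose_pow]
    have := hS.isHermitian.eq
    rw [conjTranspose_eq_transpose_of_trivial] at this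
    rw [this]
  refine ⟨v, l, hS.eigenvalues_nonneg, hpars, fun k u => ?_, fun k => ?_⟩
  · rw [← hpars]
    refine Finset.sum_congr rfl fun j _ => ?_
    rw [dotProduct_mulVec, ← mulVec_transpose, hsymm, hpow, smul_dotProduct, smul_eq_mul,
      dotProduct_comm (v j) u]
    ring
  · have e : trace (S ^ k) = ∑ a, (1 : Matrix (Fin r) (Fin r) ℝ) a ⬝ᵥ (S ^ k) a := by
      refine Finset.sum_congr rfl fun a _ => ?_
      rw [diag_apply]
      simp [dotProduct, Matrix.one_apply]
    rw [e, Finset.sum_congr rfl fun a _ => 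
      (hpars ((1 : Matrix (Fin r) (Fin r) ℝ) a) ((S ^ k) a)).symm, Finset.sum_comm]
    refine Finset.sum_congr rfl fun j _ => ?_
    have : ∑ a, ((1 : Matrix (Fin r) (Fin r) ℝ) a ⬝ᵥ v j) * (v j ⬝ᵥ (S ^ k) a) =
        (1 *ᵥ v j) ⬝ᵥ (S ^ k *ᵥ v j) := by
      refine Finset.sum_congr rfl fun a _ => ?_
      rw [dotProduct_comm (v j)]; rfl
    rw [this, one_mulVec, hpow, dotProduct_smul, hone, smul_eq_mul, mul_one]

/-- Lower moments of a positive semidefinite form are controlled by a higher moment. -/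
lemma moment_le {S : Matrix (Fin r) (Fin r) ℝ} (hS : S.PosSemidef) (u : Fin r → ℝ) {m : ℕ}
    {s : ℝ} (hs : 0 < s) (h : u ⬝ᵥ (S ^ m *ᵥ u) ≤ (u ⬝ᵥ u) * s ^ m) {k : ℕ} (hk : k ≤ m) :
    u ⬝ᵥ (S ^ k *ᵥ u) ≤ 2 * (u ⬝ᵥ u) * s ^ k := by
  obtain ⟨v, l, hl, hpars, hmom, -⟩ := exists_eigenbasis hS
  have hu : u ⬝ᵥ u = ∑ j, (u ⬝ᵥ v j) ^ 2 := by
    rw [← hpars]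
    exact Finset.sum_congr rfl fun j _ => by rw [dotProduct_comm (v j) u, sq]
  -- A crude interpolation, by comparing x with s, instead of Hölder's inequality; it costs the
  -- factor 2.
  have pt : ∀ x : ℝ, 0 ≤ x → x ^ k * s ^ (m - k) ≤ s ^ m + x ^ m := by
    intro x hx
    obtain ⟨d, rfl⟩ := Nat.exists_eq_add_of_le hk
    rw [Nat.add_sub_cancel_left]
    rcases le_total x s with hxs | hxs
    · calc x ^ k * s ^ d ≤ s ^ k * s ^ d := by gcongr
        _ = s ^ (k + d) := (pow_add _ _ _).symm
        _ ≤ _ := le_add_of_nonneg_right (by positivity)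
    · calc x ^ k * s ^ d ≤ x ^ k * x ^ d := by gcongr
        _ = x ^ (k + d) := (pow_add _ _ _).symm
        _ ≤ _ := le_add_of_nonneg_left (by positivity)
  have h1 : (u ⬝ᵥ (S ^ k *ᵥ u)) * s ^ (m - k) ≤ (u ⬝ᵥ u) * s ^ m + u ⬝ᵥ (S ^ m *ᵥ u) := by
    rw [hmom, hmom, hu, Finset.sum_mul, Finset.sum_mul, ← Finset.sum_add_distrib]
    refine Finset.sum_le_sum fun j _ => ?_
    nlinarith [mul_le_mul_of_nonneg_right (pt (l j) (hl j)) (sq_nonneg (u ⬝ᵥ v j))]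
  have h2 : (u ⬝ᵥ (S ^ k *ᵥ u)) * s ^ (m - k) ≤ 2 * (u ⬝ᵥ u) * s ^ k * s ^ (m - k) := by
    rw [mul_assoc _ (s ^ k), ← pow_add, Nat.add_sub_cancel' hk]
    linarith
  exact le_of_mul_le_mul_right h2 (by positivity)

/-- Each noncommutative word is sorted by the position k of its first A. For rank-one A the terms of
the sum then factor into two scalar moments. -/
lemma add_pow_eq_sum {R : Type*} [Ring R] (S A : R) (m : ℕ) :
    (S + A) ^ m = S ^ m + ∑ k ∈ Finset.range m, S ^ k * A * (S + A) ^ (m - 1 - k) := by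
  induction m with
  | zero => simp
  | succ m ih =>
    have : ∀ k ∈ Finset.range m, S ^ (k + 1) * A * (S + A) ^ (m + 1 - 1 - (k + 1)) =
        S * (S ^ k * A * (S + A) ^ (m - 1 - k)) := by
      intro k _
      rw [pow_succ']
      have : m + 1 - 1 - (k + 1) = m - 1 - k := by omega
      rw [this]; noncomm_ring
    rw [Finset.sum_range_succ', Finset.sum_congr rfl this, ← Finset.mul_sum, pow_succ', add_mul]
    conv_lhs => enter [1]; rw [ih]
    simp only [mul_add, pow_succ', pow_zero, one_mul]
    simp [add_assoc]

lemma posSemidef_vecMulVec (u : Fin r → ℝ) : (vecMulVec u u).PosSemidef := by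
  simpa using posSemidef_vecMulVec_self_star u

lemma posSemidef_add_vecMulVec {S : Matrix (Fin r) (Fin r) ℝ} (hS : S.PosSemidef)
    (u : Fin r → ℝ) : (S + vecMulVec u u).PosSemidef := hS.add (posSemidef_vecMulVec u)

lemma dot_pow_nonneg {S : Matrix (Fin r) (Fin r) ℝ} (hS : S.PosSemidef) (u : Fin r → ℝ) (k : ℕ) :
    0 ≤ u ⬝ᵥ (S ^ k *ᵥ u) := by
  obtain ⟨v, l, hl, -, hmom, -⟩ := exists_eigenbasis hS
  rw [hmom]
  exact Finset.sum_nonneg fun j _ => mul_nonneg (pow_nonneg (hl j) k) (sq_nonneg _)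

/-- Sorting words by the first uuᵀ gives a renewal recursion for the updated moments. Its extremal
solution for input a sᵏ is a (s + a)ᵏ, by the identity for a difference of k-th powers. -/
lemma dot_pow_add_vecMulVec_le {S : Matrix (Fin r) (Fin r) ℝ} (hS : S.PosSemidef) (u : Fin r → ℝ) {a s : ℝ}
    (ha : 0 ≤ a) (hs : 0 < s) {m : ℕ} (h : ∀ k ≤ m, u ⬝ᵥ (S ^ k *ᵥ u) ≤ a * s ^ k) :
    ∀ k ≤ m, u ⬝ᵥ ((S + vecMulVec u u) ^ k *ᵥ u) ≤ a * (s + a) ^ k := by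
  intro k
  induction k using Nat.strong_induction_on with
  | _ k ih =>
    intro hk
    rw [add_pow_eq_sum, add_mulVec, dotProduct_add, sum_mulVec, dotProduct_sum]
    have hterm : ∀ j ∈ Finset.range k,
        u ⬝ᵥ ((S ^ j * vecMulVec u u * (S + vecMulVec u u) ^ (k - 1 - j)) *ᵥ u) ≤
          a * s ^ j * (a * (s + a) ^ (k - 1 - j)) := by
      intro j hj
      have hj := Finset.mem_range.1 hj
      have e : u ⬝ᵥ ((S ^ j * vecMulVec u u * (S + vecMulVec u u) ^ (k - 1 - j)) *ᵥ u) =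
          (u ⬝ᵥ (S ^ j *ᵥ u)) * (u ⬝ᵥ ((S + vecMulVec u u) ^ (k - 1 - j) *ᵥ u)) := by
        rw [← mulVec_mulVec, ← mulVec_mulVec, vecMulVec_mulVec, mulVec_smul, dotProduct_smul]
        simp
      rw [e]
      have h1 := h j (by omega)
      have h2 := ih (k - 1 - j) (by omega) (by omega)
      exact mul_le_mul h1 h2 (dot_pow_nonneg (posSemidef_add_vecMulVec hS u) u _) (by positivity)
    have hgeo := (Commute.all s (s + a)).geom_sum₂_mul k
    calc _ ≤ a * s ^ k + ∑ j ∈ Finset.range k, a * s ^ j * (a * (s + a) ^ (k - 1 - j)) :=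
          add_le_add (h k hk) (Finset.sum_le_sum hterm)
      _ = a * s ^ k + a * ((∑ j ∈ Finset.range k, s ^ j * (s + a) ^ (k - 1 - j)) * a) := by
          rw [Finset.sum_mul, Finset.mul_sum]
          congr 1
          exact Finset.sum_congr rfl fun j _ => by ring
      _ = _ := by
          have : (∑ j ∈ Finset.range k, s ^ j * (s + a) ^ (k - 1 - j)) * a =
              (s + a) ^ k - s ^ k := by linarith
          rw [this]; ring

/-- The effect of a rank-one update on the moments in the direction of the update. -/
lemma dot_pow_update_le {S : Matrix (Fin r) (Fin r) ℝ} (hS : S.PosSemidef) (u : Fin r → ℝ) {a : ℝ}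
    (ha : 0 < a) (hu : u ⬝ᵥ u ≤ a) (m : ℕ) :
    u ⬝ᵥ ((S + vecMulVec u u) ^ m *ᵥ u) ≤
      6 * (u ⬝ᵥ (S ^ m *ᵥ u) + (u ⬝ᵥ u) * (2 * m * a) ^ m) := by
  have hμ := dot_pow_nonneg hS u m
  have hu0 := dot_self_nonneg u
  rcases Nat.eq_zero_or_pos m with rfl | hm
  · simp; linarith
  rcases hu0.eq_or_lt with h0 | h0
  · have : u = 0 := dotProduct_self_eq_zero.1 h0.symm
    simp [this]
  have hm' : (0 : ℝ) < m := by exact_mod_cast hm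
  set b := u ⬝ᵥ u
  set c := u ⬝ᵥ (S ^ m *ᵥ u) with hc
  -- The first entry of the maximum makes s dominate the m-th moment. The second gives 2b ≤ s/m, so
  -- that (s + 2b)^m exceeds s^m by at most (1 + 1/m)^m ≤ 3; with the leading 2b this yields the
  -- constant 6.
  set s : ℝ := (max (c / b) ((2 * m * a) ^ m)) ^ ((m : ℝ)⁻¹) with hs
  have hmax : 0 ≤ max (c / b) ((2 * m * a) ^ m) := le_max_of_le_left (by positivity)
  have hsm : s ^ m = max (c / b) ((2 * m * a) ^ m) := Real.rpow_inv_natCast_pow hmax hm.ne'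
  have hs0 : 0 ≤ s := Real.rpow_nonneg hmax _
  have hsa : 2 * m * a ≤ s := by
    refine le_of_pow_le_pow_left₀ hm.ne' hs0 ?_
    rw [hsm]; exact le_max_right _ _
  have hspos : 0 < s := lt_of_lt_of_le (by positivity) hsa
  have hcs : c ≤ b * s ^ m := by
    rw [hsm, mul_comm, ← div_le_iff₀ h0]; exact le_max_left _ _
  have h1 := dot_pow_add_vecMulVec_le hS u (a := 2 * b) (by positivity) hspos
    (fun k hk => moment_le hS u hspos hcs hk) m le_rfl
  have h2 : s + 2 * b ≤ s * (1 + 1 / m) := by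
    have : 2 * b ≤ s / m := by
      rw [le_div_iff₀ hm']
      nlinarith
    calc s + 2 * b ≤ s + s / m := by linarith
      _ = _ := by ring
  have h3 : (1 + 1 / (m : ℝ)) ^ m ≤ 3 := by
    have : 1 + 1 / (m : ℝ) ≤ Real.exp (1 / m) := by linarith [Real.add_one_le_exp (1 / (m : ℝ))]
    calc (1 + 1 / (m : ℝ)) ^ m ≤ Real.exp (1 / m) ^ m := by gcongr
      _ = Real.exp 1 := by rw [← Real.exp_nat_mul]; congr 1; field_simp
      _ ≤ 3 := by linarith [Real.exp_one_lt_d9]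
  calc u ⬝ᵥ ((S + vecMulVec u u) ^ m *ᵥ u) ≤ 2 * b * (s + 2 * b) ^ m := h1
    _ ≤ 2 * b * (s * (1 + 1 / m)) ^ m := by gcongr
    _ = 2 * b * s ^ m * (1 + 1 / m) ^ m := by rw [mul_pow]; ring
    _ ≤ 2 * b * s ^ m * 3 := by gcongr
    _ = 6 * (b * max (c / b) ((2 * m * a) ^ m)) := by rw [hsm]; ring
    _ ≤ 6 * (b * (c / b + (2 * m * a) ^ m)) := by
        gcongr
        exact max_le_add_of_nonneg (by positivity) (by positivity)
    _ = _ := by field_simp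

variable {ι : Type*} [Fintype ι]

/-- The random matrix `∑ δᵢ uᵢ uᵢᵀ`. -/
def gram (u : ι → Fin r → ℝ) (δ : ι → Bool) : Matrix (Fin r) (Fin r) ℝ :=
  ∑ i, if δ i then vecMulVec (u i) (u i) else 0

lemma posSemidef_gram (u : ι → Fin r → ℝ) (δ : ι → Bool) : (gram u δ).PosSemidef := by
  refine Matrix.posSemidef_sum _ fun i _ => ?_
  split_ifs
  · exact posSemidef_vecMulVec _
  · exact PosSemidef.zero

lemma gram_update_true [DecidableEq ι] (u : ι → Fin r → ℝ) (δ : ι → Bool) (i : ι) :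
    gram u (Function.update δ i true) =
      gram u (Function.update δ i false) + vecMulVec (u i) (u i) := by
  have h : ∀ b, gram u (Function.update δ i b) = (if b then vecMulVec (u i) (u i) else 0) +
      ∑ j ∈ Finset.univ.erase i, if δ j then vecMulVec (u j) (u j) else 0 := by
    intro b
    rw [gram, ← Finset.add_sum_erase _ _ (Finset.mem_univ i)]
    congr 1
    · simp
    · refine Finset.sum_congr rfl fun j hj => ?_
      rw [Function.update_of_ne (Finset.ne_of_mem_erase hj)]
  rw [h, h]; simp [add_comm]

lemma trace_vecMulVec_mul (u : Fin r → ℝ) (M : Matrix (Fin r) (Fin r) ℝ) :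
    trace (vecMulVec u u * M) = u ⬝ᵥ (M *ᵥ u) := by
  rw [vecMulVec_mul, trace_vecMulVec, dotProduct_comm, ← dotProduct_mulVec]

/-- Trace moments of a sparse sum of rank-one matrices that add up to the identity. -/
lemma Ex_trace_gram_pow_le [DecidableEq ι] {u : ι → Fin r → ℝ}
    (hu : ∑ i, vecMulVec (u i) (u i) = 1) {a p : ℝ} (ha : 0 < a) (hua : ∀ i, u i ⬝ᵥ u i ≤ a)
    (hp : 0 < p) (hp2 : p ≤ 1 / 2) {K : ℕ} (hK : 2 * K * a ≤ 24 * p) :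
    ∀ k ≤ K, Ex (piW fun _ : ι => bern p) (fun δ => trace (gram u δ ^ k)) ≤ r * (24 * p) ^ k := by
  have hP : ∀ _ : ι, IsProb (bern p) := fun _ => isProb_bern hp.le (by linarith)
  have hpi := isProb_piW hP
  intro k
  induction k with
  | zero => intro _; simp [hpi.Ex_const]
  | succ k ih =>
    intro hk
    have ih := ih (by omega)
    have hk' : 2 * k * a ≤ 24 * p := by
      refine le_trans ?_ hK
      have : (k : ℝ) ≤ K := by exact_mod_cast (by omega : k ≤ K)
      gcongr
    set W : (ι → Bool) → ℝ := piW fun _ : ι => bern p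
    -- Only one of the factors is expanded. Each term then depends on δ i through its own selector
    -- and through a rank-one update of the remaining matrix.
    have hdiag : ∀ δ, trace (gram u δ ^ (k + 1)) =
        ∑ i, if δ i then u i ⬝ᵥ (gram u δ ^ k *ᵥ u i) else 0 := by
      intro δ
      rw [pow_succ']
      conv_lhs => enter [1, 1]; rw [gram]
      rw [Finset.sum_mul, trace_sum]
      refine Finset.sum_congr rfl fun i _ => ?_
      split_ifs
      · exact trace_vecMulVec_mul _ _
      · simp
    have hfull : ∀ M : Matrix (Fin r) (Fin r) ℝ, ∑ i, u i ⬝ᵥ (M *ᵥ u i) = trace M := by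
      intro M
      simp only [← trace_vecMulVec_mul]
      rw [← trace_sum, ← Finset.sum_mul, hu, Matrix.one_mul]
    have hsq : ∑ i, u i ⬝ᵥ u i = r := by
      have := hfull 1
      simpa using this
    have hone : ∀ i, Ex W (fun δ => if δ i then u i ⬝ᵥ (gram u δ ^ k *ᵥ u i) else 0) ≤
        12 * p * Ex W (fun δ => u i ⬝ᵥ (gram u δ ^ k *ᵥ u i)) +
          6 * p * ((u i ⬝ᵥ u i) * (24 * p) ^ k) := by
      intro i
      have e1 := Ex_piW_update hP i
        (fun δ : ι → Bool => if δ i then u i ⬝ᵥ (gram u δ ^ k *ᵥ u i) else 0)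
      have e2 := Ex_piW_update hP i (fun δ : ι → Bool => u i ⬝ᵥ (gram u δ ^ k *ᵥ u i))
      simp only [Ex_bern, Function.update_self, if_true, Bool.false_eq_true, if_false, mul_zero,
        add_zero] at e1 e2
      set f : (ι → Bool) → ℝ :=
        fun δ => u i ⬝ᵥ (gram u (Function.update δ i false) ^ k *ᵥ u i) with hf
      have h3 : Ex W (fun δ => if δ i then u i ⬝ᵥ (gram u δ ^ k *ᵥ u i) else 0) ≤
          Ex W (fun δ => 6 * p * f δ + 6 * p * ((u i ⬝ᵥ u i) * (24 * p) ^ k)) := by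
        rw [e1]
        refine Ex_mono hpi.nonneg fun δ => ?_
        rw [gram_update_true]
        have h4 := dot_pow_update_le (posSemidef_gram u (Function.update δ i false)) (u i) ha
          (hua i) k
        have h5 : (u i ⬝ᵥ u i) * (2 * k * a) ^ k ≤ (u i ⬝ᵥ u i) * (24 * p) ^ k := by
          have := dot_self_nonneg (u i)
          gcongr
        calc p * _ ≤ p * (6 * (f δ + (u i ⬝ᵥ u i) * (24 * p) ^ k)) := by
              gcongr
              exact h4.trans (by gcongr)
          _ = _ := by ring
      -- Position i is unselected with probability 1 - p ≥ 1/2, and the contribution of the other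
      -- case is nonnegative. This restores the full moment at the cost of a factor 2, so the
      -- recursion closes.
      have h6 : 1 / 2 * Ex W f ≤ Ex W (fun δ => u i ⬝ᵥ (gram u δ ^ k *ᵥ u i)) := by
        rw [e2, ← Ex_const_mul]
        refine Ex_mono hpi.nonneg fun δ => ?_
        have h7 := dot_pow_nonneg (posSemidef_gram u (Function.update δ i true)) (u i) k
        have h8 := dot_pow_nonneg (posSemidef_gram u (Function.update δ i false)) (u i) k
        have : 1 / 2 * f δ ≤ (1 - p) * f δ := by
          refine mul_le_mul_of_nonneg_right (by linarith) h8
        have := mul_nonneg hp.le h7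
        linarith
      rw [Ex_add, Ex_const_mul, hpi.Ex_const] at h3
      nlinarith
    simp only [hdiag]
    rw [Ex_sum]
    calc _ ≤ ∑ i, (12 * p * Ex W (fun δ => u i ⬝ᵥ (gram u δ ^ k *ᵥ u i)) +
          6 * p * ((u i ⬝ᵥ u i) * (24 * p) ^ k)) := Finset.sum_le_sum fun i _ => hone i
      _ = 12 * p * Ex W (fun δ => trace (gram u δ ^ k)) + 6 * p * (r * (24 * p) ^ k) := by
          rw [Finset.sum_add_distrib, ← Finset.mul_sum, ← Finset.mul_sum, ← Finset.sum_mul, hsq,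
            ← Ex_sum]
          simp only [hfull]
      _ ≤ 12 * p * (r * (24 * p) ^ k) + 6 * p * (r * (24 * p) ^ k) := by gcongr
      _ ≤ r * (24 * p) ^ (k + 1) := by
          rw [pow_succ]
          have : 0 ≤ p * (r * (24 * p) ^ k) := by positivity
          nlinarith

/-- A sparse sum of rank-one matrices that add up to the identity has small norm. -/
lemma Pr_gram_le [DecidableEq ι] {u : ι → Fin r → ℝ}
    (hu : ∑ i, vecMulVec (u i) (u i) = 1) {a p : ℝ} (ha : 0 < a) (hua : ∀ i, u i ⬝ᵥ u i ≤ a)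
    (hp : 0 < p) (hp2 : p ≤ 1 / 2) {K : ℕ} (hK : 2 * K * a ≤ 24 * p) :
    Pr (piW fun _ : ι => bern p)
      (fun δ => ¬ ∀ x, x ⬝ᵥ (gram u δ *ᵥ x) ≤ 72 * p * (x ⬝ᵥ x)) ≤ r * Real.exp (-K) := by
  have hpi := isProb_piW fun _ : ι => isProb_bern hp.le (by linarith : p ≤ 1)
  have hpos : ∀ δ, 0 ≤ trace (gram u δ ^ K) := by
    intro δ
    obtain ⟨v, l, hl, -, -, htr⟩ := exists_eigenbasis (posSemidef_gram u δ)
    rw [htr]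
    exact Finset.sum_nonneg fun j _ => pow_nonneg (hl j) _
  calc _ ≤ Pr (piW fun _ : ι => bern p) (fun δ => (72 * p) ^ K ≤ trace (gram u δ ^ K)) := by
        refine Pr_mono hpi.nonneg fun δ h => ?_
        obtain ⟨v, l, hl, hpars, hmom, htr⟩ := exists_eigenbasis (posSemidef_gram u δ)
        by_contra hlt
        refine h fun x => ?_
        have hj : ∀ j, l j ≤ 72 * p := by
          intro j
          by_contra hj
          refine hlt ?_
          rw [htr]
          refine le_trans ?_ (Finset.single_le_sum (f := fun j => l j ^ K)
            (fun j _ => pow_nonneg (hl j) _) (Finset.mem_univ j))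
          exact pow_le_pow_left₀ (by positivity) (not_le.1 hj).le _
        have e1 := hmom 1 x
        have e0 := hmom 0 x
        simp only [pow_one, pow_zero, one_mul, one_mulVec] at e1 e0
        rw [e1, e0, Finset.mul_sum]
        exact Finset.sum_le_sum fun j _ => mul_le_mul_of_nonneg_right (hj j) (sq_nonneg _)
    _ ≤ _ := Pr_le_of_Ex hpi.nonneg hpos (by positivity)
    _ ≤ r * (24 * p) ^ K / (72 * p) ^ K := by
        gcongr
        exact Ex_trace_gram_pow_le hu ha hua hp hp2 hK K le_rfl
    -- The threshold 72p is three times the moment scale 24p, and 1/3 ≤ 1/e.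
    _ = r * (1 / 3) ^ K := by
        rw [mul_div_assoc, ← div_pow]
        congr 2
        field_simp
        norm_num
    _ ≤ _ := by
        gcongr
        rw [show -(K : ℝ) = K * (-1) by ring, Real.exp_nat_mul]
        gcongr
        rw [Real.exp_neg, one_div]
        exact inv_anti₀ (Real.exp_pos 1) (by linarith [Real.exp_one_lt_d9])

end Moments

/-! ### Sparse sets and the tangent space -/

section Sparse

variable {m n r : ℕ} {U : Matrix (Fin m) (Fin r) ℝ} {V : Matrix (Fin n) (Fin r) ℝ}

/-- The vectors `uᵢ` placed in the column `j`, zero in the other columns. -/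
def colVec (U : Matrix (Fin m) (Fin r) ℝ) (j : Fin n) (x : Fin m × Fin n) : Fin r → ℝ :=
  if x.2 = j then U x.1 else 0

/-- The vectors `vⱼ` placed in the row `i`, zero in the other rows. -/
def rowVec (V : Matrix (Fin n) (Fin r) ℝ) (i : Fin m) (x : Fin m × Fin n) : Fin r → ℝ :=
  if x.1 = i then V x.2 else 0

lemma sum_colVec {M : Type*} [AddCommMonoid M] (j : Fin n) (F : Fin m × Fin n → (Fin r → ℝ) → M)
    (hF : ∀ x, F x 0 = 0) : ∑ x, F x (colVec U j x) = ∑ i, F (i, j) (U i) := by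
  rw [Fintype.sum_prod_type]
  refine Finset.sum_congr rfl fun i _ => ?_
  rw [Finset.sum_eq_single j]
  · simp [colVec]
  · intro j' _ h; simp [colVec, h, hF]
  · simp

lemma sum_rowVec {M : Type*} [AddCommMonoid M] (i : Fin m) (F : Fin m × Fin n → (Fin r → ℝ) → M)
    (hF : ∀ x, F x 0 = 0) : ∑ x, F x (rowVec V i x) = ∑ j, F (i, j) (V j) := by
  rw [Fintype.sum_prod_type, Finset.sum_eq_single i]
  · refine Finset.sum_congr rfl fun j _ => ?_
    simp [rowVec]
  · intro i' _ h
    exact Finset.sum_eq_zero fun j _ => by simp [rowVec, h, hF]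
  · simp

lemma sum_vecMulVec_row (hU : Uᵀ * U = 1) : ∑ i, vecMulVec (U i) (U i) = 1 := by
  rw [← hU]
  ext a b
  simp [Matrix.sum_apply, vecMulVec_apply, mul_apply]

lemma dot_gram {ι : Type*} [Fintype ι] (u : ι → Fin r → ℝ) (δ : ι → Bool) (x : Fin r → ℝ) :
    x ⬝ᵥ (gram u δ *ᵥ x) = ∑ i, if δ i then (u i ⬝ᵥ x) ^ 2 else 0 := by
  rw [gram, sum_mulVec, dotProduct_sum]
  refine Finset.sum_congr rfl fun i _ => ?_
  split_ifs
  · rw [vecMulVec_mulVec, dotProduct_smul, dotProduct_comm x]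
    simp [sq]
  · simp

/-- The restriction of `O` to each row and column interacts weakly with the spaces spanned by the
columns of `U` and `V`. -/
structure Spread (U : Matrix (Fin m) (Fin r) ℝ) (V : Matrix (Fin n) (Fin r) ℝ) (κ : ℝ)
    (O : Fin m × Fin n → Bool) : Prop where
  col : ∀ j x, x ⬝ᵥ (gram (colVec U j) O *ᵥ x) ≤ κ * (x ⬝ᵥ x)
  row : ∀ i x, x ⬝ᵥ (gram (rowVec V i) O *ᵥ x) ≤ κ * (x ⬝ᵥ x)

/-- The squared norm splits over the columns of Y, and on column j it is the quadratic form of the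
Gram matrix of the rows of U selected by O there. -/
lemma Spread.fro_mask_mul_le {κ : ℝ} {O : Fin m × Fin n → Bool} (h : Spread U V κ O)
    (Y : Matrix (Fin r) (Fin n) ℝ) :
    ip (mask O (U * Y)) (mask O (U * Y)) ≤ κ * ip Y Y := by
  have e1 : ip (mask O (U * Y)) (mask O (U * Y)) =
      ∑ j, (fun k => Y k j) ⬝ᵥ (gram (colVec U j) O *ᵥ (fun k => Y k j)) := by
    rw [ip, Finset.sum_comm]
    refine Finset.sum_congr rfl fun j _ => ?_
    rw [dot_gram, sum_colVec j (fun x w => if O x then (w ⬝ᵥ fun k => Y k j) ^ 2 else 0) (by simp)]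
    refine Finset.sum_congr rfl fun i _ => ?_
    simp only [mask, of_apply]
    split_ifs
    · rw [sq]; rfl
    · simp
  have e2 : ip Y Y = ∑ j, (fun k => Y k j) ⬝ᵥ (fun k => Y k j) := by
    rw [ip, Finset.sum_comm]; rfl
  rw [e1, e2, Finset.mul_sum]
  exact Finset.sum_le_sum fun j _ => h.col j _

lemma Spread.fro_mask_mul_transpose_le {κ : ℝ} {O : Fin m × Fin n → Bool} (h : Spread U V κ O)
    (Y : Matrix (Fin m) (Fin r) ℝ) :
    ip (mask O (Y * Vᵀ)) (mask O (Y * Vᵀ)) ≤ κ * ip Y Y := by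
  have e1 : ip (mask O (Y * Vᵀ)) (mask O (Y * Vᵀ)) =
      ∑ i, Y i ⬝ᵥ (gram (rowVec V i) O *ᵥ Y i) := by
    refine Finset.sum_congr rfl fun i _ => ?_
    rw [dot_gram, sum_rowVec i (fun x w => if O x then (w ⬝ᵥ Y i) ^ 2 else 0) (by simp)]
    refine Finset.sum_congr rfl fun j _ => ?_
    simp only [mask, of_apply]
    split_ifs
    · rw [sq, dotProduct_comm]; rfl
    · simp
  have e2 : ip Y Y = ∑ i, Y i ⬝ᵥ Y i := rfl
  rw [e1, e2, Finset.mul_sum]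
  exact Finset.sum_le_sum fun i _ => h.row i _

lemma IsProj.fro_mul_le {P : Matrix (Fin m) (Fin m) ℝ} (hP : IsProj P)
    (X : Matrix (Fin m) (Fin n) ℝ) : ip X (P * X) ≤ ip X X := by
  have h1 : ip (P * X) (P * X) = ip X (P * X) := by
    rw [ip_mul_left, hP.symm, ← Matrix.mul_assoc, hP.idem]
  have h2 := ip_self_nonneg (X - P * X)
  simp only [ip_sub_left, ip_sub_right, h1, ip_comm (P * X) X] at h2
  linarith

lemma IsProj.fro_mul_right_le {R : Matrix (Fin n) (Fin n) ℝ} (hR : IsProj R)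
    (X : Matrix (Fin m) (Fin n) ℝ) : ip X (X * R) ≤ ip X X := by
  have h1 : ip (X * R) (X * R) = ip X (X * R) := by
    rw [ip_mul_right, hR.symm, Matrix.mul_assoc, hR.idem]
  have h2 := ip_self_nonneg (X - X * R)
  simp only [ip_sub_left, ip_sub_right, h1, ip_comm (X * R) X] at h2
  linarith

/-- Split P_T X = U(UᵀX) + ((1 - UUᵀ)XV)Vᵀ. Both coefficient matrices have Frobenius norm at most
‖X‖, so each term contributes √κ ‖X‖. -/
lemma Spread.fro_mask_tproj_le {κ : ℝ} (hκ : 0 ≤ κ) {O : Fin m × Fin n → Bool}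
    (h : Spread U V κ O) (hU : Uᵀ * U = 1) (hV : Vᵀ * V = 1) (X : Matrix (Fin m) (Fin n) ℝ) :
    fro (mask O (tproj (U * Uᵀ) (V * Vᵀ) X)) ≤ 2 * √κ * fro X := by
  have hP := isProj_mul_transpose hU
  have hR := isProj_mul_transpose hV
  have e : tproj (U * Uᵀ) (V * Vᵀ) X =
      U * (Uᵀ * X) + ((1 - U * Uᵀ) * X * V) * Vᵀ := by
    simp only [tproj, Matrix.sub_mul, Matrix.one_mul, Matrix.mul_assoc]
    abel
  have hk : ∀ A : Matrix (Fin m) (Fin n) ℝ, ip A A ≤ κ * ip X X → fro A ≤ √κ * fro X := by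
    intro A hA
    rw [fro, fro, ← Real.sqrt_mul hκ]
    exact Real.sqrt_le_sqrt hA
  have h1 : fro (mask O (U * (Uᵀ * X))) ≤ √κ * fro X := by
    refine hk _ ((h.fro_mask_mul_le _).trans (mul_le_mul_of_nonneg_left ?_ hκ))
    rw [ip_mul_left, transpose_transpose, ← Matrix.mul_assoc]
    exact hP.fro_mul_le X
  have h2 : fro (mask O (((1 - U * Uᵀ) * X * V) * Vᵀ)) ≤ √κ * fro X := by
    refine hk _ ((h.fro_mask_mul_transpose_le _).trans (mul_le_mul_of_nonneg_left ?_ hκ))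
    rw [ip_mul_right, Matrix.mul_assoc _ V]
    refine (hR.fro_mul_right_le _).trans ?_
    rw [ip_mul_left, hP.one_sub.symm, ← Matrix.mul_assoc, hP.one_sub.idem]
    exact hP.one_sub.fro_mul_le X
  rw [e, mask_add]
  linarith [fro_add_le (mask O (U * (Uᵀ * X))) (mask O (((1 - U * Uᵀ) * X * V) * Vᵀ))]

/-- Sparse random sets are spread. -/
lemma Pr_not_spread (hU : Uᵀ * U = 1) (hV : Vᵀ * V = 1) {a p : ℝ} (ha : 0 < a)
    (hUa : ∀ i, ∑ k, U i k ^ 2 ≤ a) (hVa : ∀ j, ∑ k, V j k ^ 2 ≤ a)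
    (hp : 0 < p) (hp2 : p ≤ 1 / 2) {K : ℕ} (hK : 2 * K * a ≤ 24 * p) :
    Pr (piW fun _ : Fin m × Fin n => bern p) (fun O => ¬ Spread U V (72 * p) O) ≤
      (m + n) * r * Real.exp (-K) := by
  have hpi := isProb_piW fun _ : Fin m × Fin n => isProb_bern hp.le (by linarith : p ≤ 1)
  have hc : ∀ j : Fin n, Pr (piW fun _ : Fin m × Fin n => bern p) (fun O => ¬ ∀ x,
      x ⬝ᵥ (gram (colVec U j) O *ᵥ x) ≤ 72 * p * (x ⬝ᵥ x)) ≤ r * Real.exp (-K) := by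
    intro j
    refine Pr_gram_le ?_ ha (fun x => ?_) hp hp2 hK
    · rw [sum_colVec j (fun _ w => vecMulVec w w) (by simp), sum_vecMulVec_row hU]
    · simp only [colVec]
      split_ifs
      · simpa [dotProduct, sq] using hUa x.1
      · simpa using ha.le
  have hr : ∀ i : Fin m, Pr (piW fun _ : Fin m × Fin n => bern p) (fun O => ¬ ∀ x,
      x ⬝ᵥ (gram (rowVec V i) O *ᵥ x) ≤ 72 * p * (x ⬝ᵥ x)) ≤ r * Real.exp (-K) := by
    intro i
    refine Pr_gram_le ?_ ha (fun x => ?_) hp hp2 hK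
    · rw [sum_rowVec i (fun _ w => vecMulVec w w) (by simp), sum_vecMulVec_row hV]
    · simp only [rowVec]
      split_ifs
      · simpa [dotProduct, sq] using hVa x.2
      · simpa using ha.le
  calc _ ≤ Pr (piW fun _ : Fin m × Fin n => bern p) (fun O =>
        (∃ j ∈ (Finset.univ : Finset (Fin n)), ¬ ∀ x,
          x ⬝ᵥ (gram (colVec U j) O *ᵥ x) ≤ 72 * p * (x ⬝ᵥ x)) ∨
        ∃ i ∈ (Finset.univ : Finset (Fin m)), ¬ ∀ x,
          x ⬝ᵥ (gram (rowVec V i) O *ᵥ x) ≤ 72 * p * (x ⬝ᵥ x)) := by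
        refine Pr_mono hpi.nonneg fun O h => ?_
        by_contra! hcon
        exact h ⟨fun j x => hcon.1 j (Finset.mem_univ j) x, fun i x => hcon.2 i (Finset.mem_univ i) x⟩
    _ ≤ _ := Pr_or_le hpi.nonneg _ _
    _ ≤ ∑ _j : Fin n, r * Real.exp (-K) + ∑ _i : Fin m, r * Real.exp (-K) :=
        add_le_add ((Pr_exists_le _ hpi.nonneg _).trans (Finset.sum_le_sum fun j _ => hc j))
          ((Pr_exists_le _ hpi.nonneg _).trans (Finset.sum_le_sum fun i _ => hr i))
    _ = _ := by simp; ring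

/-- As P_T is an orthogonal projection, the squared length is the (i, j) entry of P_T applied to
that unit matrix, namely α + β - αβ with α, β the squared row lengths of U and V. -/
lemma ip_tproj_single_le (hU : Uᵀ * U = 1) (hV : Vᵀ * V = 1) {ν : ℝ}
    (hUν : ∀ i, ∑ k, U i k ^ 2 ≤ ν) (hVν : ∀ j, ∑ k, V j k ^ 2 ≤ ν) (i : Fin m) (j : Fin n) :
    ip (tproj (U * Uᵀ) (V * Vᵀ) (Matrix.single i j 1))
      (tproj (U * Uᵀ) (V * Vᵀ) (Matrix.single i j 1)) ≤ 2 * ν := by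
  have hP := isProj_mul_transpose hU
  have hR := isProj_mul_transpose hV
  have hUi : (U * Uᵀ) i i = ∑ k, U i k ^ 2 := by simp [mul_apply, sq]
  have hVj : (V * Vᵀ) j j = ∑ k, V j k ^ 2 := by simp [mul_apply, sq]
  rw [ip_tproj_left _ _ hP hR, tproj_tproj _ hP hR, ip_single]
  have e : tproj (U * Uᵀ) (V * Vᵀ) (Matrix.single i j 1) i j =
      (U * Uᵀ) i i + (V * Vᵀ) j j - (U * Uᵀ) i i * (V * Vᵀ) j j := by
    simp only [tproj, Matrix.sub_apply, Matrix.add_apply]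
    have h3 : (U * Uᵀ * Matrix.single i j (1 : ℝ) * (V * Vᵀ)) i j = (U * Uᵀ) i i * (V * Vᵀ) j j := by
      rw [mul_apply, Finset.sum_eq_single j]
      · simp
      · intro b _ hb; simp [Matrix.mul_single_apply_of_ne, hb]
      · simp
    rw [h3]; simp
  rw [e, hUi, hVj]
  have h1 := hUν i
  have h2 := hVν j
  have h3 : 0 ≤ ∑ k, U i k ^ 2 := Finset.sum_nonneg fun _ _ => sq_nonneg _
  have h4 : 0 ≤ ∑ k, V j k ^ 2 := Finset.sum_nonneg fun _ _ => sq_nonneg _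
  nlinarith [mul_nonneg h3 h4]

end Sparse

/-! ### Random signs -/

section Signs

variable {m n : ℕ}

/-- The sign matrix of a family of bits. -/
def signM (ε : Fin m × Fin n → Bool) : Matrix (Fin m) (Fin n) ℝ := of fun i j => sgn (ε (i, j))

lemma Pr_abs_le_of_mgf {α : Type*} [Fintype α] {w : α → ℝ} (hw : ∀ a, 0 ≤ w a) (X : α → ℝ)
    {t u B : ℝ} (ht : 0 ≤ t) (h1 : Ex w (fun a => Real.exp (t * X a)) ≤ Real.exp B)
    (h2 : Ex w (fun a => Real.exp (-t * X a)) ≤ Real.exp B) :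
    Pr w (fun a => u ≤ |X a|) ≤ 2 * Real.exp (B - t * u) := by
  have h3 := Pr_le_of_mgf hw X (u := u) ht h1
  have h4 := Pr_le_of_mgf hw (fun a => -X a) (u := u) (B := B) ht (by simpa using h2)
  refine (Pr_mono hw (F := fun a => u ≤ X a ∨ u ≤ -X a) fun a h => le_abs.1 h).trans ?_
  linarith [Pr_or_le hw (fun a => u ≤ X a) (fun a => u ≤ -X a)]

lemma Ex_exp_ip_signM_le (C : Matrix (Fin m) (Fin n) ℝ) (t : ℝ) :
    Ex (piW fun _ : Fin m × Fin n => bern (1 / 2)) (fun ε => Real.exp (t * ip C (signM ε))) ≤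
      Real.exp (t ^ 2 * ip C C / 2) := by
  have e : ∀ ε : Fin m × Fin n → Bool, t * ip C (signM ε) =
      ∑ x : Fin m × Fin n, (t * C x.1 x.2) * sgn (ε x) := by
    intro ε
    rw [ip_eq_sum_prod, Finset.mul_sum]
    exact Finset.sum_congr rfl fun x _ => by simp [signM]; ring
  simp only [e]
  rw [Ex_piW_exp_sum (fun _ : Fin m × Fin n => bern (1 / 2))
    (fun x b => (t * C x.1 x.2) * sgn b)]
  calc _ ≤ ∏ x : Fin m × Fin n, Real.exp ((t * C x.1 x.2) ^ 2 / 2) :=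
        Finset.prod_le_prod (fun x _ => Ex_nonneg (isProb_bern (by norm_num) (by norm_num)).nonneg
          fun _ => (Real.exp_pos _).le) fun x _ => Ex_exp_sgn_le _
    _ = _ := by
        rw [← Real.exp_sum, ip_eq_sum_prod, Finset.mul_sum, Finset.sum_div]
        congr 1
        exact Finset.sum_congr rfl fun x _ => by ring

lemma isProb_signs : IsProb (piW fun _ : Fin m × Fin n => bern (1 / 2)) :=
  isProb_piW fun _ => isProb_bern (by norm_num) (by norm_num)

lemma Pr_abs_ip_signM_le (C : Matrix (Fin m) (Fin n) ℝ) {f u : ℝ} (hf : 0 < f) (hC : ip C C ≤ f)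
    (hu : 0 ≤ u) : Pr (piW fun _ : Fin m × Fin n => bern (1 / 2))
      (fun ε => u ≤ |ip C (signM ε)|) ≤ 2 * Real.exp (-(u ^ 2 / (2 * f))) := by
  have hB : ∀ t : ℝ, Real.exp (t ^ 2 * ip C C / 2) ≤ Real.exp (t ^ 2 * f / 2) := by
    intro t; gcongr
  refine (Pr_abs_le_of_mgf isProb_signs.nonneg _ (t := u / f) (u := u)
    (B := (u / f) ^ 2 * f / 2) (by positivity) ((Ex_exp_ip_signM_le C _).trans (hB _)) ?_).trans ?_
  · refine ((Ex_exp_ip_signM_le C _).trans (hB _)).trans_eq ?_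
    rw [neg_sq]
  · refine le_of_eq ?_
    congr 2
    field_simp
    ring

/-- The operator norm of a sparse random sign matrix. -/
lemma Pr_not_opLe_mask_signM {p s : ℝ} (hp0 : 0 ≤ p) (hp1 : p ≤ 1) (hs : 0 < s)
    (hp : ∀ t : ℝ, 1 - p + p * Real.cosh t ≤ Real.exp (s ^ 2 * t ^ 2 / 2)) {N : ℕ}
    (hm : m ≤ N) (hn : n ≤ N) :
    Pr (prodW (piW fun _ : Fin m × Fin n => bern p) (piW fun _ : Fin m × Fin n => bern (1 / 2)))
      (fun x => ¬ OpLe (mask x.1 (signM x.2)) (18 * s * √N)) ≤ Real.exp (-N) := by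
  have hP := isProb_piW fun _ : Fin m × Fin n => isProb_bern hp0 hp1
  refine Pr_not_opLe (isProb_prodW hP isProb_signs).nonneg hm hn _ hs fun x y hx hy t _ => ?_
  set C := vecMulVec y x with hC
  have hCC : ip C C ≤ 1 := by
    rw [← fro_sq]
    exact pow_le_one₀ (fro_nonneg C) (fro_vecMulVec_le hx hy)
  have e : ∀ O ε : Fin m × Fin n → Bool, t * (y ⬝ᵥ (mask O (signM ε) *ᵥ x)) =
      ∑ z : Fin m × Fin n, (if O z then t * C z.1 z.2 else 0) * sgn (ε z) := by
    intro O ε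
    rw [dot_mulVec_eq_ip, ip_eq_sum_prod, Finset.mul_sum]
    refine Finset.sum_congr rfl fun z _ => ?_
    simp only [mask, signM, of_apply, Prod.mk.eta]
    split_ifs
    · ring
    · simp
  rw [Ex_prodW]
  simp only [e]
  have e2 : ∀ O : Fin m × Fin n → Bool,
      Ex (piW fun _ : Fin m × Fin n => bern (1 / 2)) (fun ε => Real.exp
        (∑ z : Fin m × Fin n, (if O z then t * C z.1 z.2 else 0) * sgn (ε z))) =
      ∏ z : Fin m × Fin n, Real.cosh (if O z then t * C z.1 z.2 else 0) := by
    intro O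
    rw [Ex_piW_exp_sum (fun _ : Fin m × Fin n => bern (1 / 2))
      (fun z b => (if O z then t * C z.1 z.2 else 0) * sgn b)]
    simp only [Ex_exp_sgn]
  simp only [e2]
  rw [Ex_piW_prod (fun _ : Fin m × Fin n => bern p)
    (fun z b => Real.cosh (if b then t * C z.1 z.2 else 0))]
  calc _ ≤ ∏ z : Fin m × Fin n, Real.exp (s ^ 2 * (t * C z.1 z.2) ^ 2 / 2) := by
        refine Finset.prod_le_prod (fun z _ => Ex_nonneg (isProb_bern hp0 hp1).nonneg
          fun _ => (Real.cosh_pos _).le) fun z _ => ?_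
        rw [Ex_bern]
        simp only [if_true, Bool.false_eq_true, if_false, Real.cosh_zero]
        linarith [hp (t * C z.1 z.2)]
    _ = Real.exp (s ^ 2 * t ^ 2 / 2 * ip C C) := by
        rw [← Real.exp_sum, ip_eq_sum_prod, Finset.mul_sum]
        congr 1
        exact Finset.sum_congr rfl fun x _ => by ring
    _ ≤ _ := by
        refine Real.exp_le_exp.2 ?_
        have : 0 ≤ s ^ 2 * t ^ 2 / 2 := by positivity
        nlinarith

variable {P : Matrix (Fin m) (Fin m) ℝ} {R : Matrix (Fin n) (Fin n) ℝ}

/-- The inverse of `X ↦ X - P_O P_T P_O X` when `P_O P_T` is a contraction. -/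
lemma exists_inverse (hP : IsProj P) (hR : IsProj R) {O : Fin m × Fin n → Bool} {σ : ℝ}
    (hσ : 0 ≤ σ) (hσ2 : σ ^ 2 ≤ 1 / 2) (hO : ∀ X, fro (mask O (tproj P R X)) ≤ σ * fro X) :
    ∃ B : Matrix (Fin m) (Fin n) ℝ → Matrix (Fin m) (Fin n) ℝ,
      (∀ X, B X - mask O (tproj P R (mask O (B X))) = X) ∧
      (∀ X Y, ip (B X) Y = ip X (B Y)) ∧ (∀ X, fro (B X) ≤ 2 * fro X) ∧
      ∀ X, fro (B X - X) ≤ 2 * σ ^ 2 * fro X := by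
  -- The adjoint P_T P_O inherits the bound on P_O P_T, so their product P_O P_T P_O has norm at
  -- most σ².
  have h1 : ∀ Z, fro (tproj P R (mask O Z)) ≤ σ * fro Z := by
    intro Z
    set Y := tproj P R (mask O Z) with hY
    have h2 : fro Y ^ 2 ≤ σ * fro Z * fro Y := by
      rw [fro_sq]
      conv_lhs => rw [hY, ip_tproj_left _ _ hP hR, ip_mask_left, ← hY]
      refine (ip_le_fro_mul_fro _ _).trans ?_
      nlinarith [hO Y, fro_nonneg Z]
    rcases (fro_nonneg Y).eq_or_lt with h | h
    · rw [← h]; exact mul_nonneg hσ (fro_nonneg Z)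
    · nlinarith
  have h2 : ∀ Z, fro (mask O (tproj P R (mask O Z))) ≤ σ ^ 2 * fro Z := by
    intro Z
    have := hO (tproj P R (mask O Z))
    rw [tproj_tproj _ hP hR] at this
    nlinarith [h1 Z]
  let A : Matrix (Fin m) (Fin n) ℝ →ₗ[ℝ] Matrix (Fin m) (Fin n) ℝ :=
    { toFun := fun X => X - mask O (tproj P R (mask O X))
      map_add' := fun X Y => by rw [mask_add, tproj_add, mask_add]; abel
      map_smul' := fun a X => by
        rw [mask_smul, tproj_smul, mask_smul, RingHom.id_apply, smul_sub] }
  have hA : ∀ X, A X = X - mask O (tproj P R (mask O X)) := fun _ => rfl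
  -- A perturbation of the identity by norm at most 1/2 has no kernel; finite dimension then gives
  -- surjectivity, with no need for a Neumann series.
  have hinj : Function.Injective A := by
    rw [← LinearMap.ker_eq_bot, LinearMap.ker_eq_bot']
    intro X hX
    rw [hA, sub_eq_zero] at hX
    have h3 := h2 X
    rw [← hX] at h3
    refine eq_zero_of_fro_eq_zero (le_antisymm ?_ (fro_nonneg X))
    nlinarith [fro_nonneg X]
  choose B hB using LinearMap.injective_iff_surjective.1 hinj
  have hAs : ∀ X Y, ip (A X) Y = ip X (A Y) := by
    intro X Y
    rw [hA, hA, ip_sub_left, ip_sub_right, ip_mask_left, ip_tproj_left _ _ hP hR, ip_mask_left]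
  have hd : ∀ X, fro (B X - X) ≤ σ ^ 2 * fro (B X) := by
    intro X
    have : B X - X = mask O (tproj P R (mask O (B X))) := by
      have := hB X
      rw [hA, sub_eq_iff_eq_add] at this
      exact sub_eq_iff_eq_add'.2 this
    rw [this]
    exact h2 (B X)
  have hb : ∀ X, fro (B X) ≤ 2 * fro X := by
    intro X
    have h3 := fro_add_le X (B X - X)
    rw [add_sub_cancel] at h3
    nlinarith [hd X, fro_nonneg (B X)]
  refine ⟨B, hB, fun X Y => ?_, hb, fun X => ?_⟩
  · conv_lhs => rw [← hB Y]
    rw [← hAs, hB]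
  · nlinarith [hd X, hb X, sq_nonneg σ]

/-- The part of the certificate that matches the signs `ε` on `O`. -/
structure SignCert (P : Matrix (Fin m) (Fin m) ℝ) (R : Matrix (Fin n) (Fin n) ℝ)
    (O ε : Fin m × Fin n → Bool) (c : ℝ) (G : Matrix (Fin m) (Fin n) ℝ) : Prop where
  supp : mask O G = G
  sign : mask O (G - tproj P R G) = mask O (signM ε)
  small : ∀ i j, |tproj P R G i j| ≤ 1 / 4
  op : OpLe (G - mask O (signM ε)) c

/-- For fixed O take G = B(P_O ε) with B the inverse of 1 - P_O P_T P_O. Every quantity to be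
controlled is a linear form in the independent signs, hence subgaussian with variance proxy the
squared norm of its coefficient matrix. -/
lemma Pr_not_signCert (hP : IsProj P) (hR : IsProj R) {O : Fin m × Fin n → Bool} {σ : ℝ}
    (hσ : 0 < σ) (hσ2 : σ ^ 2 ≤ 1 / 2) (hO : ∀ X, fro (mask O (tproj P R X)) ≤ σ * fro X)
    {ν : ℝ} (hν : 0 < ν)
    (hT : ∀ i j, ip (tproj P R (Matrix.single i j 1)) (tproj P R (Matrix.single i j 1)) ≤ 2 * ν)
    {N : ℕ} (hm : m ≤ N) (hn : n ≤ N) :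
    Pr (piW fun _ : Fin m × Fin n => bern (1 / 2))
      (fun ε => ¬ ∃ G, SignCert P R O ε (36 * σ ^ 2 * √N) G) ≤
      2 * N ^ 2 * Real.exp (-(1 / (256 * ν))) + Real.exp (-N) := by
  obtain ⟨B, hB1, hB2, hB3, hB4⟩ := exists_inverse hP hR hσ.le hσ2 hO
  have hnn := (isProb_signs (m := m) (n := n)).nonneg
  set w : (Fin m × Fin n → Bool) → ℝ := piW fun _ : Fin m × Fin n => bern (1 / 2)
  -- Moving all operators to the unit matrix by self-adjointness gives the coefficients of one entry
  -- of P_T G. Their squared norm is at most 4 · 2ν, and the tail at 1/4 has exponent (1/4)²/(2 ·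
  -- 8ν) = 1/(256ν).
  set C : Fin m × Fin n → Matrix (Fin m) (Fin n) ℝ :=
    fun x => mask O (B (tproj P R (Matrix.single x.1 x.2 1))) with hC
  have hCe : ∀ ε i j, tproj P R (B (mask O (signM ε))) i j = ip (C (i, j)) (signM ε) := by
    intro ε i j
    rw [← ip_single (tproj P R (B (mask O (signM ε)))) i j, ← ip_tproj_left _ _ hP hR, ← hB2, ← ip_mask_left]
  have hCf : ∀ x, ip (C x) (C x) ≤ 8 * ν := by
    intro x
    have h1 := (fro_mask_le (B (tproj P R (Matrix.single x.1 x.2 1))) O).trans (hB3 _)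
    have h2 := hT x.1 x.2
    rw [← fro_sq] at h2 ⊢
    calc fro (C x) ^ 2 ≤ (2 * fro (tproj P R (Matrix.single x.1 x.2 1))) ^ 2 :=
          pow_le_pow_left₀ (fro_nonneg _) h1 2
      _ ≤ _ := by rw [mul_pow]; linarith
  have hE1 : Pr w (fun ε => ∃ x ∈ (Finset.univ : Finset (Fin m × Fin n)),
      1 / 4 ≤ |ip (C x) (signM ε)|) ≤ 2 * N ^ 2 * Real.exp (-(1 / (256 * ν))) := by
    refine (Pr_exists_le _ hnn _).trans ?_
    calc _ ≤ ∑ _x : Fin m × Fin n, 2 * Real.exp (-(1 / (256 * ν))) := by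
          refine Finset.sum_le_sum fun x _ => ?_
          refine (Pr_abs_ip_signM_le (C x) (f := 8 * ν) (by positivity) (hCf x)
            (by norm_num)).trans_eq ?_
          congr 3
          field_simp
          norm_num
      _ = m * n * (2 * Real.exp (-(1 / (256 * ν)))) := by simp
      _ ≤ N * N * (2 * Real.exp (-(1 / (256 * ν)))) := by gcongr
      _ = _ := by ring
  have hE2 : Pr w (fun ε => ¬ OpLe (B (mask O (signM ε)) - mask O (signM ε))
      (18 * (2 * σ ^ 2) * √N)) ≤ Real.exp (-N) := by
    refine Pr_not_opLe hnn hm hn _ (by positivity) fun x y hx hy t _ => ?_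
    -- The identity is subtracted from B because B - 1 has norm at most 2σ², which is small; the
    -- remaining P_O ε is bounded separately, using the randomness of O too.
    set D := mask O (B (vecMulVec y x) - vecMulVec y x) with hD
    have e : ∀ ε, y ⬝ᵥ ((B (mask O (signM ε)) - mask O (signM ε)) *ᵥ x) = ip D (signM ε) := by
      intro ε
      rw [dot_mulVec_eq_ip, ip_sub_right, ← hB2, ← ip_mask_left, ← ip_mask_left, ← ip_sub_left,
        ← mask_sub]
    simp only [e]
    refine (Ex_exp_ip_signM_le D t).trans (Real.exp_le_exp.2 ?_)
    have h1 : fro D ≤ 2 * σ ^ 2 := by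
      refine (fro_mask_le _ O).trans ((hB4 _).trans ?_)
      have := fro_vecMulVec_le hx hy
      nlinarith [sq_nonneg σ]
    rw [← fro_sq]
    have : fro D ^ 2 ≤ (2 * σ ^ 2) ^ 2 := pow_le_pow_left₀ (fro_nonneg D) h1 2
    gcongr
  refine (Pr_mono hnn (F := fun ε => (∃ x ∈ (Finset.univ : Finset (Fin m × Fin n)),
      1 / 4 ≤ |ip (C x) (signM ε)|) ∨ ¬ OpLe (B (mask O (signM ε)) - mask O (signM ε))
      (18 * (2 * σ ^ 2) * √N)) fun ε h => ?_).trans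
    ((Pr_or_le hnn _ _).trans (add_le_add hE1 hE2))
  by_contra! hcon
  refine h ⟨B (mask O (signM ε)), ?_⟩
  have hG := hB1 (mask O (signM ε))
  set G := B (mask O (signM ε)) with hGdef
  have hsupp : mask O G = G := by
    have e : G = mask O (signM ε) + mask O (tproj P R (mask O G)) := sub_eq_iff_eq_add.1 hG
    rw [e, mask_add, mask_mask, mask_mask]
  refine ⟨hsupp, ?_, fun i j => ?_, ?_⟩
  · rw [mask_sub, hsupp]
    rw [hsupp] at hG
    exact hG
  · rw [hCe]
    exact (hcon.1 (i, j) (Finset.mem_univ _)).le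
  · refine hcon.2.mono (le_of_eq (by ring))

end Signs

/-! ### The golfing scheme -/

section Golfing

variable {m n : ℕ} {P : Matrix (Fin m) (Fin m) ℝ} {R : Matrix (Fin n) (Fin n) ℝ}

lemma sub_smul_mask_apply {q : ℝ} (γ : Fin m × Fin n → Bool) (Z : Matrix (Fin m) (Fin n) ℝ)
    (i : Fin m) (j : Fin n) : (Z - q⁻¹ • mask γ Z) i j = cen q (γ (i, j)) * Z i j := by
  simp only [mask, cen, Matrix.sub_apply, Matrix.smul_apply, of_apply, smul_eq_mul]
  split_ifs
  · ring
  · ring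

lemma Ex_exp_ip_sub_smul_mask (q : ℝ) (C Z : Matrix (Fin m) (Fin n) ℝ) (t : ℝ) :
    Ex (piW fun _ : Fin m × Fin n => bern q)
      (fun γ => Real.exp (t * ip C (Z - q⁻¹ • mask γ Z))) =
    ∏ x : Fin m × Fin n,
      Ex (bern q) (fun b => Real.exp ((t * (C x.1 x.2 * Z x.1 x.2)) * cen q b)) := by
  rw [← Ex_piW_exp_sum (fun _ : Fin m × Fin n => bern q)
    (fun x b => (t * (C x.1 x.2 * Z x.1 x.2)) * cen q b)]
  congr 1
  ext γ
  rw [ip_eq_sum_prod, Finset.mul_sum]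
  congr 1
  refine Finset.sum_congr rfl fun x _ => ?_
  rw [sub_smul_mask_apply]
  ring

/-- The operator norm of a centered random sample. -/
lemma Pr_not_opLe_sub_smul_mask {q : ℝ} (hq0 : 0 < q) (hq1 : q ≤ 1)
    {Z : Matrix (Fin m) (Fin n) ℝ} {z : ℝ} (hz : 0 < z) (hZ : ∀ i j, |Z i j| ≤ z) {N : ℕ}
    (hm : m ≤ N) (hn : n ≤ N) :
    Pr (piW fun _ : Fin m × Fin n => bern q)
      (fun γ => ¬ OpLe (Z - q⁻¹ • mask γ Z) (36 * z / q * √N)) ≤ Real.exp (-N) := by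
  have hP := isProb_bern hq0.le hq1
  have h := Pr_not_opLe (isProb_piW fun _ : Fin m × Fin n => hP).nonneg hm hn
    (fun γ => Z - q⁻¹ • mask γ Z) (s := 2 * z / q) (by positivity) ?_
  · convert h using 5
    ring
  intro x y hx hy t _
  set C := vecMulVec y x
  have hCC : ip C C ≤ 1 := by
    rw [← fro_sq]
    exact pow_le_one₀ (fro_nonneg C) (fro_vecMulVec_le hx hy)
  simp only [dot_mulVec_eq_ip]
  rw [Ex_exp_ip_sub_smul_mask]
  calc _ ≤ ∏ x : Fin m × Fin n, Real.exp ((t * (C x.1 x.2 * Z x.1 x.2)) ^ 2 / q ^ 2) :=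
        Finset.prod_le_prod (fun x _ => Ex_nonneg hP.nonneg fun _ => (Real.exp_pos _).le)
          fun x _ => Ex_exp_cen_le hq0 hq1 _
    _ ≤ ∏ x : Fin m × Fin n, Real.exp (t ^ 2 * z ^ 2 / q ^ 2 * (C x.1 x.2 * C x.1 x.2)) := by
        refine Finset.prod_le_prod (fun x _ => (Real.exp_pos _).le) fun x _ =>
          Real.exp_le_exp.2 ?_
        have h1 : Z x.1 x.2 ^ 2 ≤ z ^ 2 := by
          rw [← sq_abs]; exact pow_le_pow_left₀ (abs_nonneg _) (hZ x.1 x.2) 2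
        calc (t * (C x.1 x.2 * Z x.1 x.2)) ^ 2 / q ^ 2 =
            t ^ 2 * Z x.1 x.2 ^ 2 / q ^ 2 * (C x.1 x.2 * C x.1 x.2) := by ring
          _ ≤ _ := by
            have := mul_self_nonneg (C x.1 x.2)
            gcongr
    _ = Real.exp (t ^ 2 * z ^ 2 / q ^ 2 * ip C C) := by
        rw [← Real.exp_sum, ip_eq_sum_prod, Finset.mul_sum]
    _ ≤ _ := by
        refine Real.exp_le_exp.2 ?_
        have h0 : 0 ≤ t ^ 2 * z ^ 2 / q ^ 2 := by positivity
        calc t ^ 2 * z ^ 2 / q ^ 2 * ip C C ≤ t ^ 2 * z ^ 2 / q ^ 2 * 2 := by gcongr; linarith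
          _ = _ := by ring

/-- A sampled step halves the largest entry. -/
lemma Pr_entry_tproj_sub_smul_mask (hP : IsProj P) (hR : IsProj R) {ν : ℝ} (hν : 0 < ν)
    (hT : ∀ i j, ip (tproj P R (Matrix.single i j 1)) (tproj P R (Matrix.single i j 1)) ≤ 2 * ν)
    {q : ℝ} (hq0 : 0 < q) (hq1 : q ≤ 1) {Z : Matrix (Fin m) (Fin n) ℝ} {z : ℝ} (hz : 0 < z)
    (hZ : ∀ i j, |Z i j| ≤ z) (i : Fin m) (j : Fin n) :
    Pr (piW fun _ : Fin m × Fin n => bern q)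
      (fun γ => z / 2 ≤ |tproj P R (Z - q⁻¹ • mask γ Z) i j|) ≤
      2 * Real.exp (-(q / (32 * ν))) := by
  have hpr := isProb_bern hq0.le hq1
  set D := tproj P R (Matrix.single i j 1) with hD
  have hDD : ip D D ≤ 2 * ν := hT i j
  have hDx : ∀ a b, |D a b| ≤ 2 * ν := by
    intro a b
    rw [← ip_single D a b, hD, ← tproj_tproj _ hP hR, ← ip_tproj_left _ _ hP hR]
    have h1 : ∀ a b, fro (tproj P R (Matrix.single a b 1)) ≤ √(2 * ν) := fun a b =>
      Real.sqrt_le_sqrt (hT a b)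
    calc _ ≤ _ := abs_ip_le _ _
      _ ≤ √(2 * ν) * √(2 * ν) := mul_le_mul (h1 _ _) (h1 _ _) (fro_nonneg _) (Real.sqrt_nonneg _)
      _ = 2 * ν := Real.mul_self_sqrt (by positivity)
  have e : ∀ γ : Fin m × Fin n → Bool, tproj P R (Z - q⁻¹ • mask γ Z) i j =
      ip D (Z - q⁻¹ • mask γ Z) := by
    intro γ
    rw [← ip_single (tproj P R (Z - q⁻¹ • mask γ Z)) i j, ← ip_tproj_left _ _ hP hR]
  simp only [e]
  -- Entries of D are at most 2ν, which keeps each exponent within q/4, in the Bernstein range.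
  -- Since ‖D‖² ≤ 2ν, the log-moment is at most q/(32ν), against t · z/2 = q/(16ν).
  have hmgf : ∀ t : ℝ, |t| = q / (8 * ν * z) → Ex (piW fun _ : Fin m × Fin n => bern q)
      (fun γ => Real.exp (t * ip D (Z - q⁻¹ • mask γ Z))) ≤ Real.exp (q / (32 * ν)) := by
    intro t ht
    rw [Ex_exp_ip_sub_smul_mask]
    calc _ ≤ ∏ x : Fin m × Fin n, Real.exp ((t * (D x.1 x.2 * Z x.1 x.2)) ^ 2 / q) := by
          refine Finset.prod_le_prod (fun x _ => Ex_nonneg hpr.nonneg fun _ => (Real.exp_pos _).le)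
            fun x _ => Ex_exp_cen_le_of_abs_le hq0 hq1 ?_
          rw [abs_mul, abs_mul, ht]
          calc q / (8 * ν * z) * (|D x.1 x.2| * |Z x.1 x.2|) ≤
              q / (8 * ν * z) * (2 * ν * z) := by
                gcongr
                · exact hDx _ _
                · exact hZ _ _
            _ = q / 4 := by field_simp; norm_num
            _ ≤ q := by linarith
      _ ≤ ∏ x : Fin m × Fin n, Real.exp (q / (64 * ν ^ 2) * (D x.1 x.2 * D x.1 x.2)) := by
          refine Finset.prod_le_prod (fun x _ => (Real.exp_pos _).le) fun x _ =>
            Real.exp_le_exp.2 ?_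
          have h1 : Z x.1 x.2 ^ 2 ≤ z ^ 2 := by
            rw [← sq_abs]; exact pow_le_pow_left₀ (abs_nonneg _) (hZ x.1 x.2) 2
          have h2 : t ^ 2 = (q / (8 * ν * z)) ^ 2 := by rw [← sq_abs, ht]
          calc (t * (D x.1 x.2 * Z x.1 x.2)) ^ 2 / q =
              t ^ 2 / q * (D x.1 x.2 * D x.1 x.2) * Z x.1 x.2 ^ 2 := by ring
            _ ≤ t ^ 2 / q * (D x.1 x.2 * D x.1 x.2) * z ^ 2 := by
              have := mul_self_nonneg (D x.1 x.2)
              gcongr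
            _ = _ := by
              rw [h2]
              field_simp
              ring
      _ = Real.exp (q / (64 * ν ^ 2) * ip D D) := by
          rw [← Real.exp_sum, ip_eq_sum_prod, Finset.mul_sum]
      _ ≤ _ := by
          refine Real.exp_le_exp.2 ?_
          calc q / (64 * ν ^ 2) * ip D D ≤ q / (64 * ν ^ 2) * (2 * ν) := by gcongr
            _ = _ := by field_simp; norm_num
  have ht0 : 0 ≤ q / (8 * ν * z) := by positivity
  refine (Pr_abs_le_of_mgf (isProb_piW fun _ : Fin m × Fin n => hpr).nonneg _ ht0
    (hmgf _ (abs_of_nonneg ht0)) (hmgf _ (by rw [abs_neg, abs_of_nonneg ht0]))).trans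
    (le_of_eq ?_)
  congr 2
  field_simp
  norm_num

/-- The residuals of the golfing scheme. -/
def golf (P : Matrix (Fin m) (Fin m) ℝ) (R : Matrix (Fin n) (Fin n) ℝ) (q : ℝ)
    (Z₀ : Matrix (Fin m) (Fin n) ℝ) {k : ℕ} (Γ : Fin k → Fin m × Fin n → Bool) :
    ℕ → Matrix (Fin m) (Fin n) ℝ
  | 0 => Z₀
  | j + 1 => if h : j < k then
      golf P R q Z₀ Γ j - q⁻¹ • tproj P R (mask (Γ ⟨j, h⟩) (golf P R q Z₀ Γ j))
    else golf P R q Z₀ Γ j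

variable {q : ℝ} {Z₀ : Matrix (Fin m) (Fin n) ℝ} {k : ℕ}

lemma golf_succ (Γ : Fin k → Fin m × Fin n → Bool) (j : Fin k) :
    golf P R q Z₀ Γ (j + 1) = golf P R q Z₀ Γ j -
      q⁻¹ • tproj P R (mask (Γ j) (golf P R q Z₀ Γ j)) := by
  rw [golf, dif_pos j.2]

lemma tproj_golf (hP : IsProj P) (hR : IsProj R) (hZ₀ : tproj P R Z₀ = Z₀)
    (Γ : Fin k → Fin m × Fin n → Bool) (j : ℕ) :
    tproj P R (golf P R q Z₀ Γ j) = golf P R q Z₀ Γ j := by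
  induction j with
  | zero => exact hZ₀
  | succ j ih =>
    rw [golf]
    split_ifs
    · rw [tproj_sub, tproj_smul, tproj_tproj _ hP hR, ih]
    · exact ih

/-- The residual entering step j is determined by the earlier batches, hence independent of batch j.
-/
lemma golf_congr {Γ Γ' : Fin k → Fin m × Fin n → Bool} {j : ℕ}
    (h : ∀ i : Fin k, (i : ℕ) < j → Γ i = Γ' i) : golf P R q Z₀ Γ j = golf P R q Z₀ Γ' j := by
  induction j with
  | zero => rfl
  | succ j ih =>
    have ih := ih fun i hi => h i (by omega)
    rw [golf, golf, ih]
    split_ifs with hj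
    · rw [h ⟨j, hj⟩ (by simp)]
    · rfl

/-- The set of positions that are in none of the batches. -/
def unsampled (Γ : Fin k → Fin m × Fin n → Bool) (x : Fin m × Fin n) : Bool :=
  decide (∀ j, Γ j x = false)

/-- The outcome of a successful golfing scheme: `Y` is supported off `O` and `P_T Y` is close
to `Z₀`. -/
structure GolfCert (P : Matrix (Fin m) (Fin m) ℝ) (R : Matrix (Fin n) (Fin n) ℝ)
    (Z₀ : Matrix (Fin m) (Fin n) ℝ) (O : Fin m × Fin n → Bool) (z q : ℝ) (k N : ℕ)
    (Y Z : Matrix (Fin m) (Fin n) ℝ) : Prop where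
  eq : tproj P R Y + Z = Z₀
  supp : ∀ i j, O (i, j) → Y i j = 0
  bound : ∀ i j, |Y i j| ≤ 2 * z / q
  rest : ∀ i j, |Z i j| ≤ z * (1 / 2) ^ k
  op : OpLe (Y - tproj P R Y) (72 * z / q * √N)

/-- Y is the sum of the rescaled samples of the residuals. Applying P_T telescopes to Z₀ minus the
last residual, and geometric decay sums every bound to at most twice its first term. -/
lemma exists_golfCert (hP : IsProj P) (hR : IsProj R) (hZ₀ : tproj P R Z₀ = Z₀) (hq0 : 0 < q)
    {z : ℝ} (hz : 0 < z) {N : ℕ} {Γ : Fin k → Fin m × Fin n → Bool}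
    (hsmall : ∀ j ≤ k, ∀ a b, |golf P R q Z₀ Γ j a b| ≤ z * (1 / 2) ^ j)
    (hop : ∀ j : Fin k, OpLe (golf P R q Z₀ Γ j - q⁻¹ • mask (Γ j) (golf P R q Z₀ Γ j))
      (36 * (z * (1 / 2) ^ (j : ℕ)) / q * √N)) :
    ∃ Y Z, GolfCert P R Z₀ (unsampled Γ) z q k N Y Z := by
  set Zs := golf P R q Z₀ Γ with hZs
  set Y : ℕ → Matrix (Fin m) (Fin n) ℝ := fun j =>
    if h : j < k then q⁻¹ • mask (Γ ⟨j, h⟩) (Zs j) else 0 with hY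
  have hYj : ∀ j : Fin k, Y j = q⁻¹ • mask (Γ j) (Zs j) := fun j => by simp [hY]
  have hgeo : ∑ j ∈ Finset.range k, (1 / 2 : ℝ) ^ j ≤ 2 := sum_geometric_two_le k
  have htel : ∀ l ≤ k, tproj P R (∑ j ∈ Finset.range l, Y j) + Zs l = Z₀ := by
    intro l
    induction l with
    | zero => intro _; simp [hZs, golf]
    | succ l ih =>
      intro hl
      have e := golf_succ (P := P) (R := R) (q := q) (Z₀ := Z₀) Γ ⟨l, hl⟩
      simp only [← hZs] at e
      rw [Finset.sum_range_succ, tproj_add, hYj ⟨l, hl⟩, e, tproj_smul, ← ih (by omega)]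
      simp only
      abel
  refine ⟨∑ j ∈ Finset.range k, Y j, Zs k, htel k le_rfl, fun a b hab => ?_, fun a b => ?_,
    hsmall k le_rfl, ?_⟩
  · rw [Matrix.sum_apply]
    refine Finset.sum_eq_zero fun j hj => ?_
    have hj := Finset.mem_range.1 hj
    rw [hYj ⟨j, hj⟩]
    simp only [unsampled, decide_eq_true_eq] at hab
    simp [mask, hab]
  · rw [Matrix.sum_apply]
    calc |∑ j ∈ Finset.range k, Y j a b| ≤ ∑ j ∈ Finset.range k, |Y j a b| :=
          Finset.abs_sum_le_sum_abs _ _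
      _ ≤ ∑ j ∈ Finset.range k, z / q * (1 / 2) ^ j := by
          refine Finset.sum_le_sum fun j hj => ?_
          have hj := Finset.mem_range.1 hj
          rw [hYj ⟨j, hj⟩]
          have h1 := hsmall j hj.le a b
          simp only [mask, Matrix.smul_apply, of_apply, smul_eq_mul]
          split_ifs
          · rw [abs_mul, abs_of_pos (inv_pos.2 hq0)]
            calc q⁻¹ * |Zs j a b| ≤ q⁻¹ * (z * (1 / 2) ^ j) := by gcongr
              _ = _ := by ring
          · simp; positivity
      _ = z / q * ∑ j ∈ Finset.range k, (1 / 2) ^ j := by rw [Finset.mul_sum]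
      _ ≤ z / q * 2 := by gcongr
      _ = _ := by ring
  · have e : (∑ j ∈ Finset.range k, Y j) - tproj P R (∑ j ∈ Finset.range k, Y j) =
        ∑ j ∈ Finset.range k, (Y j - tproj P R (Y j)) := by
      rw [tproj_sum, Finset.sum_sub_distrib]
    rw [e]
    have hj : ∀ j ∈ Finset.range k, OpLe (Y j - tproj P R (Y j))
        (36 * (z * (1 / 2) ^ j) / q * √N) := by
      intro j hj
      have hj := Finset.mem_range.1 hj
      -- The residual lies in T, so subtracting it from the sample leaves the component orthogonal
      -- to T unchanged and replaces the sample by a centered matrix.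
      have h1 := (opLe_sub_tproj hP hR (hop ⟨j, hj⟩)).neg
      have hT := tproj_golf (q := q) hP hR hZ₀ Γ j
      simp only [← hZs] at h1 hT
      rw [hYj ⟨j, hj⟩]
      convert h1 using 1
      rw [tproj_sub, hT]
      simp only
      abel
    refine (OpLe.sum _ hj).mono ?_
    calc ∑ j ∈ Finset.range k, 36 * (z * (1 / 2) ^ j) / q * √N =
        36 * z / q * √N * ∑ j ∈ Finset.range k, (1 / 2 : ℝ) ^ j := by
          rw [Finset.mul_sum]
          exact Finset.sum_congr rfl fun j _ => by ring
      _ ≤ 36 * z / q * √N * 2 := by gcongr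
      _ = _ := by ring

/-- The golfing scheme succeeds with high probability. -/
lemma Pr_not_golfCert (hP : IsProj P) (hR : IsProj R) {ν : ℝ} (hν : 0 < ν)
    (hT : ∀ i j, ip (tproj P R (Matrix.single i j 1)) (tproj P R (Matrix.single i j 1)) ≤ 2 * ν)
    (hZ₀ : tproj P R Z₀ = Z₀) (hq0 : 0 < q) (hq1 : q ≤ 1) {z : ℝ} (hz : 0 < z)
    (hZz : ∀ i j, |Z₀ i j| ≤ z) {N : ℕ} (hm : m ≤ N) (hn : n ≤ N) (k : ℕ) :
    Pr (piW fun _ : Fin k => piW fun _ : Fin m × Fin n => bern q)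
      (fun Γ => ¬ ∃ Y Z, GolfCert P R Z₀ (unsampled Γ) z q k N Y Z) ≤
      k * (2 * N ^ 2 * Real.exp (-(q / (32 * ν))) + Real.exp (-N)) := by
  have hb := isProb_piW fun _ : Fin m × Fin n => isProb_bern hq0.le hq1
  have hpi := isProb_piW fun _ : Fin k => hb
  set δ := 2 * N ^ 2 * Real.exp (-(q / (32 * ν))) + Real.exp (-N) with hδ
  have hδ0 : 0 ≤ δ := by positivity
  let fails : Matrix (Fin m) (Fin n) ℝ → ℝ → (Fin m × Fin n → Bool) → Prop := fun Z y γ =>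
    (∃ x ∈ (Finset.univ : Finset (Fin m × Fin n)),
      y / 2 ≤ |tproj P R (Z - q⁻¹ • mask γ Z) x.1 x.2|) ∨
    ¬ OpLe (Z - q⁻¹ • mask γ Z) (36 * y / q * √N)
  have hfix : ∀ Z y, 0 < y → (∀ i j, |Z i j| ≤ y) →
      Pr (piW fun _ : Fin m × Fin n => bern q) (fails Z y) ≤ δ := by
    intro Z y hy hZ
    refine (Pr_or_le hb.nonneg _ _).trans (add_le_add ?_
      (Pr_not_opLe_sub_smul_mask hq0 hq1 hy hZ hm hn))
    refine (Pr_exists_le _ hb.nonneg _).trans ?_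
    calc _ ≤ ∑ _x : Fin m × Fin n, 2 * Real.exp (-(q / (32 * ν))) :=
          Finset.sum_le_sum fun x _ =>
            Pr_entry_tproj_sub_smul_mask hP hR hν hT hq0 hq1 hy hZ x.1 x.2
      _ = m * n * (2 * Real.exp (-(q / (32 * ν)))) := by simp
      _ ≤ N * N * (2 * Real.exp (-(q / (32 * ν)))) := by gcongr
      _ = _ := by ring
  -- Failure at step j is counted only if the residual is still small. Resampling batch j alone then
  -- bounds its probability, and if no step is bad, induction keeps all residuals small.
  let bad : Fin k → (Fin k → Fin m × Fin n → Bool) → Prop := fun j Γ =>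
    (∀ a b, |golf P R q Z₀ Γ j a b| ≤ z * (1 / 2) ^ (j : ℕ)) ∧
      fails (golf P R q Z₀ Γ j) (z * (1 / 2) ^ (j : ℕ)) (Γ j)
  have hbad : ∀ j, Pr (piW fun _ : Fin k => piW fun _ : Fin m × Fin n => bern q) (bad j) ≤ δ := by
    intro j
    rw [Pr, Ex_piW_update (fun _ => hb) j]
    refine hpi.Ex_le_of_le fun Γ => ?_
    have hc : ∀ γ, golf P R q Z₀ (Function.update Γ j γ) j = golf P R q Z₀ Γ j := fun γ =>
      golf_congr fun i hi => Function.update_of_ne (by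
        rintro rfl
        exact lt_irrefl _ hi) _ _
    by_cases hs : ∀ a b, |golf P R q Z₀ Γ j a b| ≤ z * (1 / 2) ^ (j : ℕ)
    · refine le_trans (Ex_mono hb.nonneg fun γ => ?_) (hfix (golf P R q Z₀ Γ j)
        (z * (1 / 2) ^ (j : ℕ)) (by positivity) hs)
      by_cases h : bad j (Function.update Γ j γ)
      · have h2 := h.2
        rw [hc, Function.update_self] at h2
        rw [ind_of h, ind_of h2]
      · rw [ind_of_not h]; exact ind_nonneg _ _
    · refine le_trans (hb.Ex_le_of_le (c := 0) fun γ => ?_) hδ0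
      rw [ind_of_not]
      intro h
      have h1 := h.1
      rw [hc] at h1
      exact hs h1
  calc _ ≤ Pr (piW fun _ : Fin k => piW fun _ : Fin m × Fin n => bern q)
        (fun Γ => ∃ j ∈ (Finset.univ : Finset (Fin k)), bad j Γ) := by
        refine Pr_mono hpi.nonneg fun Γ h => ?_
        by_contra hcon
        have hgood : ∀ j, ¬ bad j Γ := fun j hj => hcon ⟨j, Finset.mem_univ j, hj⟩
        have hsmall : ∀ j ≤ k, ∀ a b, |golf P R q Z₀ Γ j a b| ≤ z * (1 / 2) ^ j := by
          intro j
          induction j with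
          | zero => intro _ a b; simpa [golf] using hZz a b
          | succ j ih =>
            intro hj a b
            have ih := ih (by omega)
            have hg := hgood ⟨j, hj⟩
            have hf : ¬ fails (golf P R q Z₀ Γ j) (z * (1 / 2) ^ j) (Γ ⟨j, hj⟩) :=
              fun h => hg ⟨ih, h⟩
            have h1 : |tproj P R (golf P R q Z₀ Γ j -
                q⁻¹ • mask (Γ ⟨j, hj⟩) (golf P R q Z₀ Γ j)) a b| < z * (1 / 2) ^ j / 2 := by
              by_contra hlt
              exact hf (Or.inl ⟨(a, b), Finset.mem_univ _, not_lt.1 hlt⟩)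
            have e := golf_succ (P := P) (R := R) (q := q) (Z₀ := Z₀) Γ ⟨j, hj⟩
            simp only at e
            rw [tproj_sub, tproj_golf hP hR hZ₀, tproj_smul, ← e] at h1
            refine h1.le.trans (le_of_eq ?_)
            rw [pow_succ]; ring
        refine h (exists_golfCert hP hR hZ₀ hq0 hz hsmall fun j => ?_)
        by_contra hop
        exact hgood j ⟨hsmall j j.2.le, Or.inr hop⟩
    _ ≤ ∑ j : Fin k, Pr (piW fun _ : Fin k => piW fun _ : Fin m × Fin n => bern q) (bad j) :=
        Pr_exists_le _ hpi.nonneg _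
    _ ≤ ∑ _j : Fin k, δ := Finset.sum_le_sum fun j _ => hbad j
    _ = _ := by simp

end Golfing

/-! ### Recovery with random signs -/

section Recovery

variable {m n r k : ℕ} {U : Matrix (Fin m) (Fin r) ℝ} {V : Matrix (Fin n) (Fin r) ℝ}

/-- Sign and golfing certificates together yield exact recovery. -/
lemma isExact_of_certs {N : ℕ} (hm : m ≤ N) (hn : n ≤ N) (hN : 2 ≤ N)
    {L : Matrix (Fin m) (Fin n) ℝ} {τ : Fin r → ℝ} (hU : Uᵀ * U = 1) (hV : Vᵀ * V = 1)
    (hτ : ∀ i, 0 < τ i) (hL : L = U * diagonal τ * Vᵀ) {O ε : Fin m × Fin n → Bool}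
    {κ z q c c' : ℝ} {G Y Z : Matrix (Fin m) (Fin n) ℝ} (hκ0 : 0 ≤ κ) (hκ : κ ≤ 1 / 16)
    (hz0 : 0 ≤ z) (hspread : Spread U V κ O)
    (hG : SignCert (U * Uᵀ) (V * Vᵀ) O ε (c * √N) G)
    (hE : OpLe (mask O (signM ε)) (c' * √N)) (hcc : c + c' ≤ 1 / 4)
    (hY : GolfCert (U * Uᵀ) (V * Vᵀ) (U * Vᵀ) O z q k N Y Z)
    (h1 : 72 * z / q * √N ≤ 1 / 4) (h2 : 2 * z / q ≤ 1 / √N / 8)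
    (h3 : z ≤ 1 / √N / 8) (h4 : N * (1 / 2 : ℝ) ^ k ≤ 1)
    {S : Matrix (Fin m) (Fin n) ℝ}
    (hS : ∀ i j, S i j ≠ 0 → O (i, j) ∧ S i j * signM ε i j = |S i j|) :
    IsExact (1 / √N) L S := by
  have hP := isProj_mul_transpose hU
  have hR := isProj_mul_transpose hV
  have hN' : (1 : ℝ) < √N := by
    rw [Real.lt_sqrt zero_le_one]
    have : (2 : ℝ) ≤ N := by exact_mod_cast hN
    linarith
  have hN0 : 0 < √(N : ℝ) := by linarith
  set lam : ℝ := 1 / √N with hlam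
  have hlam0 : 0 < lam := by positivity
  have hlam1 : lam < 1 := by rw [hlam, div_lt_one hN0]; exact hN'
  set P := U * Uᵀ with hPdef
  set R := V * Vᵀ with hRdef
  set W := (Y - tproj P R Y) + lam • (G - tproj P R G) with hW
  -- On O the matrix Y vanishes and the G part is exactly λε, leaving the error Z. Off O the matrix
  -- G vanishes, and λ/8 + λ/8 + λ/4 = λ/2.
  have hQ : U * Vᵀ + W = Y + Z + lam • (G - tproj P R G) := by
    rw [hW, ← hY.eq]; abel
  have hpow : (1 / 2 : ℝ) ^ k ≤ 1 := pow_le_one₀ (by norm_num) (by norm_num)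
  have hZ : ∀ i j, |Z i j| ≤ lam / 8 := fun i j =>
    (hY.rest i j).trans ((mul_le_of_le_one_right hz0 hpow).trans h3)
  have hopG : OpLe G (1 / 4 * √N) := by
    have := (hG.op).add hE
    rw [sub_add_cancel] at this
    refine this.mono ?_
    rw [← add_mul]
    gcongr
  refine isExact_of_certificate hlam0 hlam1 hU hV hτ hL O (ε := signM ε) (W := W)
    (fun i j => (abs_sgn _).le) ?_ ?_ ?_ ?_ ?_ hS
  · rw [hW, tproj_add, tproj_smul, tproj_sub, tproj_sub, tproj_tproj _ hP hR, tproj_tproj _ hP hR,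
      sub_self, sub_self, smul_zero, add_zero]
  · refine (hY.op.add ((opLe_sub_tproj hP hR hopG).smul hlam0.le)).mono ?_
    have : lam * (1 / 4 * √N) = 1 / 4 := by rw [hlam]; field_simp
    linarith
  · have e : mask O (U * Vᵀ + W - lam • signM ε) = mask O Z := by
      have hY0 : mask O Y = 0 := by
        ext i j
        simp only [mask, of_apply, Matrix.zero_apply]
        split_ifs with h
        · exact hY.supp i j h
        · rfl
      rw [hQ, mask_sub, mask_add, mask_add, mask_smul, mask_smul, hG.sign, hY0]
      abel
    rw [e]
    refine (fro_mask_le _ _).trans ((fro_le_of_abs_le Z (by positivity) hm hn hY.rest).trans ?_)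
    calc (N : ℝ) * (z * (1 / 2) ^ k) = z * (N * (1 / 2) ^ k) := by ring
      _ ≤ z * 1 := by gcongr
      _ ≤ lam / 4 := by linarith
  · intro i j hO
    have hG0 : G i j = 0 := by
      rw [← hG.supp]; simp [mask, hO]
    rw [hQ]
    simp only [Matrix.add_apply, Matrix.smul_apply, Matrix.sub_apply, smul_eq_mul, hG0, zero_sub]
    have a1 := (hY.bound i j).trans h2
    have a2 := hZ i j
    have a3 : |lam * -(tproj P R G i j)| ≤ lam * (1 / 4) := by
      rw [abs_mul, abs_neg, abs_of_pos hlam0]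
      exact mul_le_mul_of_nonneg_left (hG.small i j) hlam0.le
    calc _ ≤ |Y i j| + |Z i j| + |lam * -(tproj P R G i j)| := abs_add_three _ _ _
      _ ≤ _ := by linarith
  · intro X
    refine (hspread.fro_mask_tproj_le hκ0 hU hV X).trans ?_
    have : √κ ≤ 1 / 4 := by
      rw [Real.sqrt_le_left (by norm_num)]; linarith
    have h0 := fro_nonneg X
    nlinarith

/-- The law of the set of positions that are in none of the batches. -/
lemma Ex_unsampled {q : ℝ} (hq0 : 0 ≤ q) (hq1 : q ≤ 1) (F : (Fin m × Fin n → Bool) → ℝ) :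
    Ex (piW fun _ : Fin k => piW fun _ : Fin m × Fin n => bern q) (fun Γ => F (unsampled Γ)) =
      Ex (piW fun _ : Fin m × Fin n => bern ((1 - q) ^ k)) F := by
  -- Transposing the array of bits groups the k bits of one position together, so that the unsampled
  -- set becomes a coordinatewise function.
  have e1 : Ex (piW fun _ : Fin k => piW fun _ : Fin m × Fin n => bern q)
      (fun Γ => F (unsampled Γ)) =
      Ex (piW fun _ : Fin m × Fin n => piW fun _ : Fin k => bern q)
        (fun ω => F (fun x => decide (∀ j, ω x j = false))) := by
    refine Fintype.sum_equiv (Equiv.piComm _) _ _ fun Γ => ?_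
    congr 1
    simp only [piW, Equiv.piComm_apply, Function.swap]
    exact Finset.prod_comm
  rw [e1, Ex_piW_comp (fun _ (a : Fin k → Bool) => decide (∀ j, a j = false))]
  congr 2
  ext x b
  have hb := isProb_bern hq0 hq1
  have ht : Ex (piW fun _ : Fin k => bern q)
      (fun a => if decide (∀ j, a j = false) = true then (1 : ℝ) else 0) = (1 - q) ^ k := by
    have := Ex_piW_prod (fun _ : Fin k => bern q) (fun _ c => if c = false then (1 : ℝ) else 0)
    simp only [Ex_bern] at this
    simp only [Bool.true_eq_false, if_false, mul_zero, if_true, mul_one, zero_add,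
      Finset.prod_const, Finset.card_univ, Fintype.card_fin] at this
    rw [← this]
    congr 1
    ext a
    rw [Finset.prod_ite_zero]
    simp
  cases b
  · have hs : Ex (piW fun _ : Fin k => bern q) (fun a =>
        (if decide (∀ j, a j = false) = true then (1 : ℝ) else 0) +
        (if decide (∀ j, a j = false) = false then (1 : ℝ) else 0)) = 1 := by
      refine Eq.trans ?_ ((isProb_piW fun _ : Fin k => hb).Ex_const 1)
      congr 1
      ext a
      by_cases h : ∀ j, a j = false <;> simp [h]
    rw [Ex_add, ht] at hs
    simp only [mapW, bern, Bool.false_eq_true, if_false]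
    linarith
  · simpa [mapW, bern] using ht

/-- The positions of `O` at which the random sign agrees with the prescribed one. -/
def agree (σ O ε : Fin m × Fin n → Bool) (x : Fin m × Fin n) : Bool := O x && (ε x == σ x)

/-- The law of the positions with the prescribed sign. -/
lemma Ex_agree (p : ℝ) (σ : Fin m × Fin n → Bool) (F : (Fin m × Fin n → Bool) → ℝ) :
    Ex (prodW (piW fun _ : Fin m × Fin n => bern p) (piW fun _ : Fin m × Fin n => bern (1 / 2)))
      (fun x => F (agree σ x.1 x.2)) = Ex (piW fun _ : Fin m × Fin n => bern (p / 2)) F := by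
  have e1 : Ex (prodW (piW fun _ : Fin m × Fin n => bern p)
      (piW fun _ : Fin m × Fin n => bern (1 / 2))) (fun x => F (agree σ x.1 x.2)) =
      Ex (piW fun _ : Fin m × Fin n => prodW (bern p) (bern (1 / 2)))
        (fun ω => F (fun x => (ω x).1 && ((ω x).2 == σ x))) := by
    refine (Fintype.sum_equiv (Equiv.arrowProdEquivProdArrow _ _ _) _ _ fun ω => ?_).symm
    congr 1
    simp only [piW, prodW, Equiv.arrowProdEquivProdArrow]
    exact Finset.prod_mul_distrib
  rw [e1, Ex_piW_comp (fun x (a : Bool × Bool) => a.1 && (a.2 == σ x))]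
  congr 2
  ext x b
  rw [mapW, Ex_prodW]
  simp only [Ex_bern]
  cases b <;> cases σ x <;> simp [bern] <;> ring

/-- The random-sign experiment: with high probability PCP recovers `L` for every matrix supported
on the agreeing positions. -/
lemma Pr_exact_agree {N : ℕ} (hm : m ≤ N) (hn : n ≤ N) (hN : 2 ≤ N)
    {L : Matrix (Fin m) (Fin n) ℝ} {τ : Fin r → ℝ} (hU : Uᵀ * U = 1) (hV : Vᵀ * V = 1)
    (hτ : ∀ i, 0 < τ i) (hL : L = U * diagonal τ * Vᵀ) {ν p q s z : ℝ} {K k : ℕ}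
    (hν : 0 < ν) (hUν : ∀ i, ∑ k, U i k ^ 2 ≤ ν) (hVν : ∀ j, ∑ k, V j k ^ 2 ≤ ν)
    (hp : 0 < p) (hpsmall : p ≤ 1 / 82944) (hs : 0 < s) (hs2 : 18 * s ≤ 1 / 8)
    (hps : ∀ t : ℝ, 1 - p + p * Real.cosh t ≤ Real.exp (s ^ 2 * t ^ 2 / 2))
    (hK : 2 * K * ν ≤ 24 * p) (hq0 : 0 < q) (hq1 : q ≤ 1) (hqp : (1 - q) ^ k = p)
    (hz : 0 < z) (hUVz : ∀ i j, |(U * Vᵀ) i j| ≤ z)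
    (h1 : 72 * z / q * √N ≤ 1 / 4) (h2 : 2 * z / q ≤ 1 / √N / 8)
    (h3 : z ≤ 1 / √N / 8) (h4 : N * (1 / 2 : ℝ) ^ k ≤ 1) (S : Matrix (Fin m) (Fin n) ℝ) :
    Pr (piW fun _ : Fin m × Fin n => bern (p / 2)) (fun Ω => ¬ ∀ S' : Matrix (Fin m) (Fin n) ℝ,
        (∀ i j, S' i j ≠ 0 → Ω (i, j) ∧ S' i j = S i j) → IsExact (1 / √N) L S') ≤
      k * (2 * N ^ 2 * Real.exp (-(q / (32 * ν))) + Real.exp (-N)) +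
      (m + n) * r * Real.exp (-K) + Real.exp (-N) +
      (2 * N ^ 2 * Real.exp (-(1 / (256 * ν))) + Real.exp (-N)) := by
  have hP := isProj_mul_transpose hU
  have hR := isProj_mul_transpose hV
  have hT := ip_tproj_single_le hU hV hUν hVν
  have hUV := tproj_mul_transpose hU hV
  have hΓ := isProb_piW fun _ : Fin k =>
    isProb_piW fun _ : Fin m × Fin n => isProb_bern hq0.le hq1
  have hε := isProb_signs (m := m) (n := n)
  have hO := isProb_piW fun _ : Fin m × Fin n => isProb_bern hp.le (by linarith : p ≤ 1)
  set wΓ : (Fin k → Fin m × Fin n → Bool) → ℝ :=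
    piW fun _ : Fin k => piW fun _ : Fin m × Fin n => bern q with hwΓ
  set wε : (Fin m × Fin n → Bool) → ℝ := piW fun _ : Fin m × Fin n => bern (1 / 2) with hwε
  set wO : (Fin m × Fin n → Bool) → ℝ := piW fun _ : Fin m × Fin n => bern p with hwO
  have law : ∀ F, Ex wΓ (fun Γ => F (unsampled Γ)) = Ex wO F := by
    intro F
    rw [hwΓ, Ex_unsampled hq0.le hq1, hqp]
  have hprod := isProb_prodW hΓ hε
  set σ : ℝ := 2 * √(72 * p) with hσ
  have hσ2 : σ ^ 2 = 288 * p := by rw [hσ, mul_pow, Real.sq_sqrt (by positivity)]; ring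
  have hσ0 : 0 < σ := by positivity
  let sg : Fin m × Fin n → Bool := fun x => decide (0 ≤ S x.1 x.2)
  let A : (Fin k → Fin m × Fin n → Bool) × (Fin m × Fin n → Bool) → Prop := fun x =>
    ¬ ∃ Y Z, GolfCert (U * Uᵀ) (V * Vᵀ) (U * Vᵀ) (unsampled x.1) z q k N Y Z
  let B : (Fin k → Fin m × Fin n → Bool) × (Fin m × Fin n → Bool) → Prop := fun x =>
    ¬ Spread U V (72 * p) (unsampled x.1)
  let C : (Fin k → Fin m × Fin n → Bool) × (Fin m × Fin n → Bool) → Prop := fun x =>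
    ¬ OpLe (mask (unsampled x.1) (signM x.2)) (18 * s * √N)
  -- Spread is part of the event, so that for each fixed family of batches either `Pr_not_signCert`
  -- applies or the event is empty.
  let D : (Fin k → Fin m × Fin n → Bool) × (Fin m × Fin n → Bool) → Prop := fun x =>
    Spread U V (72 * p) (unsampled x.1) ∧
      ¬ ∃ G, SignCert (U * Uᵀ) (V * Vᵀ) (unsampled x.1) x.2 (36 * σ ^ 2 * √N) G
  have hA : Pr (prodW wΓ wε) A ≤
      k * (2 * N ^ 2 * Real.exp (-(q / (32 * ν))) + Real.exp (-N)) := by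
    rw [Pr, Ex_prodW_swap]
    refine hε.Ex_le_of_le fun ε => ?_
    exact Pr_not_golfCert hP hR hν hT hUV hq0 hq1 hz hUVz hm hn k
  have hB : Pr (prodW wΓ wε) B ≤ (m + n) * r * Real.exp (-K) := by
    rw [Pr, Ex_prodW_swap]
    refine hε.Ex_le_of_le fun ε => ?_
    have := law (ind fun O => ¬ Spread U V (72 * p) O)
    exact this.le.trans (Pr_not_spread hU hV hν hUν hVν hp (by linarith) hK)
  have hC : Pr (prodW wΓ wε) C ≤ Real.exp (-N) := by
    rw [Pr, Ex_prodW]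
    have := law (fun O => Ex wε (fun ε => ind (fun x : (Fin m × Fin n → Bool) ×
      (Fin m × Fin n → Bool) => ¬ OpLe (mask x.1 (signM x.2)) (18 * s * √N)) (O, ε)))
    refine this.le.trans ?_
    rw [← Ex_prodW]
    exact Pr_not_opLe_mask_signM hp.le (by linarith) hs hps hm hn
  have hD : Pr (prodW wΓ wε) D ≤
      2 * N ^ 2 * Real.exp (-(1 / (256 * ν))) + Real.exp (-N) := by
    rw [Pr, Ex_prodW]
    refine hΓ.Ex_le_of_le fun Γ => ?_
    by_cases h : Spread U V (72 * p) (unsampled Γ)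
    · refine le_trans (Ex_mono hε.nonneg fun ε => ?_) (Pr_not_signCert hP hR hσ0 (by rw [hσ2]; linarith)
        (fun X => h.fro_mask_tproj_le (by positivity) hU hV X) hν hT hm hn)
      by_cases hd : D (Γ, ε)
      · rw [ind_of hd, ind_of (E := fun ε => ¬ ∃ G, SignCert (U * Uᵀ) (V * Vᵀ) (unsampled Γ) ε
          (36 * σ ^ 2 * √N) G) hd.2]
      · rw [ind_of_not hd]; exact ind_nonneg _ _
    · refine le_trans (hε.Ex_le_of_le (c := 0) fun ε => ?_) (by positivity)
      rw [ind_of_not (E := D)]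
      exact fun hd => h hd.1
  have hlaw2 := fun F => Ex_agree p sg F
  rw [Pr, ← hlaw2, Ex_prodW, ← hwε, ← hwO]
  -- O is realized as the complement of the batches, so that all four events live on one space, that
  -- of batches and signs.
  rw [← law (fun O => Ex wε (fun ε => ind (fun Ω : Fin m × Fin n → Bool =>
    ¬ ∀ S' : Matrix (Fin m) (Fin n) ℝ, (∀ i j, S' i j ≠ 0 → Ω (i, j) ∧ S' i j = S i j) →
      IsExact (1 / √N) L S') (agree sg O ε))), ← Ex_prodW wΓ wε (fun x => ind (fun Ω :
    Fin m × Fin n → Bool => ¬ ∀ S' : Matrix (Fin m) (Fin n) ℝ,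
      (∀ i j, S' i j ≠ 0 → Ω (i, j) ∧ S' i j = S i j) →
      IsExact (1 / √N) L S') (agree sg (unsampled x.1) x.2))]
  have hfin : Pr (prodW wΓ wε) (fun x => ¬ ∀ S' : Matrix (Fin m) (Fin n) ℝ,
      (∀ i j, S' i j ≠ 0 → agree sg (unsampled x.1) x.2 (i, j) ∧ S' i j = S i j) →
      IsExact (1 / √N) L S') ≤ Pr (prodW wΓ wε) (fun x => ((A x ∨ B x) ∨ C x) ∨ D x) := by
    refine Pr_mono hprod.nonneg fun x hx => ?_
    by_contra hcon
    simp only [not_or] at hcon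
    obtain ⟨⟨⟨hAx, hBx⟩, hCx⟩, hDx⟩ := hcon
    have hBx' := not_not.1 hBx
    obtain ⟨Y, Z, hYZ⟩ := not_not.1 hAx
    obtain ⟨G, hG⟩ : ∃ G, SignCert (U * Uᵀ) (V * Vᵀ) (unsampled x.1) x.2 (36 * σ ^ 2 * √N) G := by
      by_contra hno
      exact hDx ⟨hBx', hno⟩
    refine hx fun S' hS' => ?_
    -- With σ² = 288p the sign certificate costs 36 · 288p = 10368p ≤ 1/8, whence 82944 = 8 · 10368;
    -- the sign matrix on O costs 18s ≤ 1/8.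
    refine isExact_of_certs hm hn hN hU hV hτ hL (by positivity) (by linarith) hz.le hBx' hG
      (not_not.1 hCx) (by rw [hσ2]; linarith) hYZ h1 h2 h3 h4 fun i j hij => ?_
    obtain ⟨ha, hb⟩ := hS' i j hij
    simp only [agree, Bool.and_eq_true, beq_iff_eq] at ha
    refine ⟨ha.1, ?_⟩
    simp only [signM, of_apply, ha.2, sg, hb, sgn]
    by_cases h0 : 0 ≤ S i j
    · simp [h0, abs_of_nonneg h0]
    · simp [h0, abs_of_neg (not_le.1 h0)]
  refine hfin.trans ((Pr_or_le hprod.nonneg _ _).trans (add_le_add ?_ hD))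
  refine (Pr_or_le hprod.nonneg _ _).trans (add_le_add ?_ hC)
  exact (Pr_or_le hprod.nonneg _ _).trans (add_le_add hA hB)

end Recovery

/-! ### From Bernoulli sets to uniformly random sets -/

section Transfer

variable {ι : Type*} [Fintype ι] [DecidableEq ι]

/-- The set of indices with value `true`. -/
def trueSet (ω : ι → Bool) : Finset ι := Finset.univ.filter fun i => ω i = true

/-- Families of bits correspond to finite sets. -/
def trueSetEquiv : (ι → Bool) ≃ Finset ι where
  toFun := trueSet
  invFun s i := decide (i ∈ s)
  left_inv ω := by ext i; simp [trueSet]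
  right_inv s := by ext i; simp [trueSet]

open Classical in
/-- The proportion of the sets of size `k` that satisfy `E`. -/
def proportion (E : Finset ι → Prop) (k : ℕ) : ℝ :=
  (((Finset.univ.powersetCard k).filter E).card : ℝ) /
    ((Finset.univ : Finset ι).powersetCard k).card

/-- The shadow of the (k + 1)-sets with a decreasing property consists of k-sets with that property;
the local LYM inequality says that passing to the shadow does not lower the density. -/
lemma proportion_succ_le {E : Finset ι → Prop} (hE : ∀ s t, s ⊆ t → E t → E s) (k : ℕ) :
    proportion E (k + 1) ≤ proportion E k := by
  classical
  simp only [proportion, Finset.card_powersetCard, Finset.card_univ]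
  have h𝒜 : (((Finset.univ.powersetCard (k + 1)).filter E : Finset (Finset ι)) :
      Set (Finset ι)).Sized (k + 1) := by
    intro s hs
    simp only [Finset.coe_filter, Finset.mem_powersetCard_univ] at hs
    exact hs.1
  refine (Finset.local_lubell_yamamoto_meshalkin_inequality_div (𝕜 := ℝ) (Nat.succ_ne_zero k)
    h𝒜).trans ?_
  rw [Nat.succ_sub_one]
  gcongr
  intro s hs
  obtain ⟨t, ht, a, ha, rfl⟩ := Finset.mem_shadow_iff.1 hs
  rw [Finset.mem_filter, Finset.mem_powersetCard_univ] at ht ⊢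
  refine ⟨?_, hE _ t (Finset.erase_subset a t) ht.2⟩
  rw [Finset.card_erase_of_mem ha, ht.1]; rfl

lemma proportion_antitone {E : Finset ι → Prop} (hE : ∀ s t, s ⊆ t → E t → E s) :
    Antitone (proportion E) := antitone_nat_of_succ_le (proportion_succ_le hE)

lemma proportion_nonneg {ι : Type*} [Fintype ι] (E : Finset ι → Prop) (k : ℕ) : 0 ≤ proportion E k := by
  unfold proportion; positivity

lemma piW_bern_eq {ι : Type*} [Fintype ι] (π : ℝ) (ω : ι → Bool) : piW (fun _ : ι => bern π) ω =
    π ^ (trueSet ω).card * (1 - π) ^ (Fintype.card ι - (trueSet ω).card) := by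
  simp only [piW, bern]
  rw [Finset.prod_ite, Finset.prod_const, Finset.prod_const, ← Finset.card_univ]
  congr 2
  have := Finset.card_filter_add_card_filter_not (s := (Finset.univ : Finset ι))
    (fun i => ω i = true)
  rw [trueSet]
  omega

open Classical in
lemma Pr_bern_card_eq (π : ℝ) (E : Finset ι → Prop) (k : ℕ) :
    Pr (piW fun _ : ι => bern π) (fun ω => E (trueSet ω) ∧ (trueSet ω).card = k) =
      π ^ k * (1 - π) ^ (Fintype.card ι - k) *
        ((Finset.univ.powersetCard k).filter E).card := by
  rw [Pr, Ex, Finset.card_filter]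
  push_cast
  rw [Finset.mul_sum, ← Finset.sum_subset (Finset.subset_univ
    ((Finset.univ : Finset (ι → Bool)).filter fun ω => (trueSet ω).card = k))]
  · refine Finset.sum_bij (fun ω _ => trueSet ω) ?_ ?_ ?_ ?_
    · intro ω hω
      simpa using hω
    · intro a _ b _ h
      exact trueSetEquiv.injective h
    · intro s hs
      refine ⟨trueSetEquiv.symm s, ?_, trueSetEquiv.apply_symm_apply s⟩
      have : trueSet (trueSetEquiv.symm s) = s := trueSetEquiv.apply_symm_apply s
      simpa [this] using hs
    · intro ω hω
      have hk : (trueSet ω).card = k := by simpa using hω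
      rw [piW_bern_eq, hk]
      simp [ind, hk]
  · intro ω _ hω
    have hk : (trueSet ω).card ≠ k := by simpa using hω
    simp [ind, hk]

/-- Decreasing properties are at least as likely for uniform sets of size `m` as for Bernoulli
sets, up to the probability that the Bernoulli set has fewer than `m` elements. -/
lemma Pr_bern_le_proportion {π : ℝ} (h0 : 0 ≤ π) (h1 : π ≤ 1) {E : Finset ι → Prop}
    (hE : ∀ s t, s ⊆ t → E t → E s) (m : ℕ) :
    Pr (piW fun _ : ι => bern π) (fun ω => E (trueSet ω)) ≤
      proportion E m + Pr (piW fun _ : ι => bern π) (fun ω => (trueSet ω).card < m) := by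
  classical
  have hpi := isProb_piW fun _ : ι => isProb_bern h0 h1
  set w : (ι → Bool) → ℝ := piW fun _ : ι => bern π
  -- Conditioned on its size, a Bernoulli set is uniform. Sizes k ≥ m are then compared with m by
  -- monotonicity.
  have hk : ∀ k, Pr w (fun ω => E (trueSet ω) ∧ (trueSet ω).card = k) =
      proportion E k * Pr w (fun ω => True ∧ (trueSet ω).card = k) := by
    intro k
    rw [Pr_bern_card_eq π E k, Pr_bern_card_eq π (fun _ => True) k, proportion]
    simp only [Finset.filter_true]
    rcases eq_or_ne ((Finset.powersetCard k (Finset.univ : Finset ι)).card) 0 with h | h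
    · have : (Finset.filter E (Finset.powersetCard k (Finset.univ : Finset ι))).card = 0 :=
        Nat.le_zero.1 (h ▸ Finset.card_filter_le _ _)
      simp [h, this]
    · have : ((Finset.powersetCard k (Finset.univ : Finset ι)).card : ℝ) ≠ 0 := by exact_mod_cast h
      field_simp
  set I := Finset.Ico m (Fintype.card ι + 1)
  have hle : Pr w (fun ω => E (trueSet ω)) ≤ Pr w (fun ω =>
      (∃ k ∈ I, E (trueSet ω) ∧ (trueSet ω).card = k) ∨ (trueSet ω).card < m) := by
    refine Pr_mono hpi.nonneg fun ω h => ?_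
    rcases lt_or_ge (trueSet ω).card m with h' | h'
    · exact Or.inr h'
    · refine Or.inl ⟨_, Finset.mem_Ico.2 ⟨h', ?_⟩, h, rfl⟩
      exact Nat.lt_succ_of_le (Finset.card_le_univ _)
  refine hle.trans ((Pr_or_le hpi.nonneg _ _).trans (add_le_add ?_ le_rfl))
  refine (Pr_exists_le I hpi.nonneg _).trans ?_
  calc ∑ k ∈ I, Pr w (fun ω => E (trueSet ω) ∧ (trueSet ω).card = k)
      ≤ ∑ k ∈ I, proportion E m * Pr w (fun ω => True ∧ (trueSet ω).card = k) := by
        refine Finset.sum_le_sum fun k hkI => ?_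
        rw [hk]
        exact mul_le_mul_of_nonneg_right (proportion_antitone hE (Finset.mem_Ico.1 hkI).1)
          (Pr_nonneg hpi.nonneg _)
    _ = proportion E m * ∑ k ∈ I, Pr w (fun ω => True ∧ (trueSet ω).card = k) := by
        rw [Finset.mul_sum]
    _ ≤ proportion E m * 1 := by
        refine mul_le_mul_of_nonneg_left ?_ (proportion_nonneg E m)
        simp only [Pr]
        rw [← Ex_sum]
        refine hpi.Ex_le_of_le fun ω => ?_
        simp only [ind, true_and]
        rw [Finset.sum_ite_eq]
        split_ifs <;> norm_num
    _ = _ := mul_one _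

/-- A Bernoulli set is unlikely to have far fewer elements than expected. -/
lemma Pr_card_lt_le {π : ℝ} (h0 : 0 ≤ π) (h1 : π ≤ 1) {m : ℕ}
    (hm : (m : ℝ) ≤ π / 4 * Fintype.card ι) :
    Pr (piW fun _ : ι => bern π) (fun ω => (trueSet ω).card < m) ≤
      Real.exp (-(π / 4 * Fintype.card ι)) := by
  have hb := isProb_bern h0 h1
  have hpi := isProb_piW fun _ : ι => hb
  have hmgf : Ex (piW fun _ : ι => bern π)
      (fun ω => Real.exp (1 * (-((trueSet ω).card : ℝ)))) ≤
      Real.exp (-(π / 2 * Fintype.card ι)) := by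
    have e : ∀ ω : ι → Bool, 1 * (-((trueSet ω).card : ℝ)) = ∑ i, if ω i then (-1 : ℝ) else 0 := by
      intro ω
      rw [← Finset.sum_filter, Finset.sum_const]
      simp [trueSet]
    simp only [e]
    rw [Ex_piW_exp_sum (fun _ : ι => bern π) (fun _ b => if b then (-1 : ℝ) else 0)]
    calc _ ≤ ∏ _i : ι, Real.exp (-(π / 2)) := by
          refine Finset.prod_le_prod (fun i _ => Ex_nonneg hb.nonneg fun _ => (Real.exp_pos _).le)
            fun i _ => ?_
          rw [Ex_bern]
          simp only [if_true, Bool.false_eq_true, if_false, Real.exp_zero, mul_one]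
          have he : Real.exp (-1) ≤ 1 / 2 := by
            rw [Real.exp_neg, one_div]
            exact inv_anti₀ (by norm_num) (by linarith [Real.add_one_le_exp 1])
          have := Real.add_one_le_exp (-(π / 2))
          nlinarith
      _ = _ := by
          rw [Finset.prod_const, Finset.card_univ, ← Real.exp_nat_mul]
          congr 1; ring
  refine (Pr_mono hpi.nonneg (F := fun ω => -(m : ℝ) ≤ -((trueSet ω).card : ℝ))
    fun ω h => ?_).trans ((Pr_le_of_mgf hpi.nonneg _ zero_le_one hmgf).trans ?_)
  · have : ((trueSet ω).card : ℝ) ≤ m := by exact_mod_cast h.le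
    linarith
  · refine Real.exp_le_exp.2 ?_
    linarith

end Transfer

/-! ### Choice of parameters -/

lemma proportion_mono {ι : Type*} [Fintype ι] {E F : Finset ι → Prop} (h : ∀ s, E s → F s)
    (k : ℕ) : proportion E k ≤ proportion F k := by
  classical
  unfold proportion
  gcongr
  exact h _

lemma exp_neg_mul_log {N : ℕ} (hN : 0 < N) (a : ℕ) :
    Real.exp (-(a * Real.log N)) = ((N : ℝ) ^ a)⁻¹ := by
  have : (0 : ℝ) < N := by exact_mod_cast hN
  rw [Real.exp_neg, Real.exp_nat_mul, Real.exp_log this]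

lemma exp_neg_le_factorial_mul {x : ℝ} (hx : 0 < x) (a : ℕ) :
    Real.exp (-x) ≤ a.factorial * (x ^ a)⁻¹ := by
  have h := Real.pow_div_factorial_le_exp x hx.le a
  rw [Real.exp_neg]
  have hf : (0 : ℝ) < a.factorial := by exact_mod_cast a.factorial_pos
  calc (Real.exp x)⁻¹ ≤ (x ^ a / a.factorial)⁻¹ := inv_anti₀ (by positivity) h
    _ = _ := by rw [inv_div, div_eq_mul_inv]

/-- The density of the batches for which a fraction `p` of the positions remains unsampled. -/
lemma exists_batch_density {p : ℝ} (hp0 : 0 < p) (hp : p ≤ 1 / 2) {k : ℕ} (hk : 0 < k) :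
    ∃ q : ℝ, 0 < q ∧ q ≤ 1 ∧ (1 - q) ^ k = p ∧ 1 / q ≤ 2 * k := by
  have hk' : (0 : ℝ) < k := by exact_mod_cast hk
  set q : ℝ := 1 - p ^ ((k : ℝ)⁻¹) with hq
  have hpow : (1 - q) ^ k = p := by
    rw [hq, sub_sub_cancel]; exact Real.rpow_inv_natCast_pow hp0.le hk.ne'
  have hq1 : q ≤ 1 := by
    have := Real.rpow_nonneg hp0.le ((k : ℝ)⁻¹)
    linarith
  -- Bernoulli's inequality gives p = (1 - q)^k ≥ 1 - kq, hence kq ≥ 1 - p ≥ 1/2.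
  have hlow : 1 / (2 * k) ≤ q := by
    by_contra hlt
    have hqk : q * (2 * k) < 1 := by
      rwa [not_le, lt_div_iff₀ (by positivity)] at hlt
    have := one_add_mul_le_pow (a := -q) (by linarith) k
    rw [← sub_eq_add_neg, hpow] at this
    linarith
  have hq0 : 0 < q := lt_of_lt_of_le (by positivity) hlow
  refine ⟨q, hq0, hq1, hpow, ?_⟩
  rw [div_le_iff₀ hq0]
  rw [div_le_iff₀ (by positivity)] at hlow
  linarith

lemma natCast_mul_half_pow_le {N k : ℕ} (hN : (0 : ℝ) < N) (hk : Real.log N ≤ k * (1 / 2)) :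
    N * (1 / 2 : ℝ) ^ k ≤ 1 := by
  have he : Real.exp (1 / 2) ≤ 2 := by
    have : Real.exp (1 / 2) ^ 2 = Real.exp 1 := by rw [← Real.exp_nat_mul]; norm_num
    nlinarith [Real.exp_one_lt_d9, Real.exp_pos (1 / 2)]
  have h1 : (N : ℝ) ≤ 2 ^ k := by
    calc (N : ℝ) = Real.exp (Real.log N) := (Real.exp_log hN).symm
      _ ≤ Real.exp (k * (1 / 2)) := Real.exp_le_exp.2 hk
      _ = Real.exp (1 / 2) ^ k := Real.exp_nat_mul _ _
      _ ≤ _ := by gcongr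
  rw [one_div, inv_pow, ← div_eq_mul_inv]
  exact div_le_one_of_le₀ h1 (by positivity)

lemma one_lt_of_one_le_log {N : ℕ} (h : 1 ≤ Real.log N) : 1 < N := by
  by_contra hN
  have : N = 0 ∨ N = 1 := by omega
  rcases this with rfl | rfl <;> simp at h <;> linarith

/-- The failure probability, evaluated for the chosen parameters. -/
lemma failure_bound {n₁ n₂ N r k K : ℕ} {ρ x q f : ℝ} (hx : x = Real.log N) (hlog : 1 ≤ x)
    (h1N : n₁ ≤ N) (h2N : n₂ ≤ N) (hrN : r ≤ N) (hρ0 : 0 < ρ) (hρ : ρ ≤ 1 / 4160)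
    (hk5 : (k : ℝ) ≤ 5 * x) (hq0 : 0 < q) (hqx : 1 / q ≤ 10 * x) (hK12 : 12 * x ≤ K)
    (hf : f = Nat.factorial 11) :
    k * (2 * N ^ 2 * Real.exp (-(q / (32 * (ρ / x ^ 2)))) + Real.exp (-N)) +
      (n₁ + n₂) * r * Real.exp (-K) + Real.exp (-N) +
      (2 * N ^ 2 * Real.exp (-(1 / (256 * (ρ / x ^ 2)))) + Real.exp (-N)) ≤
      (14 + 7 * f) * ((N : ℝ) ^ 10)⁻¹ := by
  have hx0 : 0 < x := by linarith
  have hN1 : 1 < N := one_lt_of_one_le_log (hx ▸ hlog)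
  have hN0' : 0 < N := by omega
  have hN0 : (0 : ℝ) < N := by exact_mod_cast hN0'
  have hxN : x ≤ N := hx ▸ Real.log_le_self hN0.le
  set ν := ρ / x ^ 2 with hν
  have hν0 : 0 < ν := by positivity
  set y := ((N : ℝ) ^ 10)⁻¹ with hy
  have hy0 : 0 < y := by positivity
  have hexpN : N * Real.exp (-N) ≤ f * y := by
    calc N * Real.exp (-N) ≤ N * (f * ((N : ℝ) ^ 11)⁻¹) := by
          gcongr; rw [hf]; exact exp_neg_le_factorial_mul hN0 11
      _ = _ := by rw [hy]; field_simp
  have hexpN' : Real.exp (-N) ≤ f * y := by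
    have : (1 : ℝ) ≤ N := by exact_mod_cast hN1.le
    have := Real.exp_pos (-(N : ℝ))
    nlinarith
  have b1 : 2 * N ^ 2 * Real.exp (-(q / (32 * ν))) ≤ 2 * y * (N : ℝ)⁻¹ := by
    -- Thirteen logarithms: two pay for the N² entries, one for the number of batches, ten remain.
    -- Since q ≥ 1/(10x), this needs ρ ≤ 1/(13 · 320) = 1/4160.
    have h1 : 13 * x ≤ q / (32 * ν) := by
      rw [le_div_iff₀ (by positivity)]
      have h2 : 1 ≤ 10 * x * q := by rwa [div_le_iff₀ hq0] at hqx
      have h3 : 13 * x * (32 * ν) = 416 * ρ / x := by rw [hν]; field_simp; norm_num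
      rw [h3, div_le_iff₀ hx0]
      nlinarith
    calc 2 * N ^ 2 * Real.exp (-(q / (32 * ν))) ≤ 2 * N ^ 2 * Real.exp (-((13 : ℕ) * x)) := by
          gcongr; push_cast; exact h1
      _ = _ := by rw [hx, exp_neg_mul_log hN0', hy]; field_simp
  have b2 : (n₁ + n₂) * r * Real.exp (-K) ≤ 2 * y := by
    have hrN' : (r : ℝ) ≤ N := by exact_mod_cast hrN
    have h1N' : (n₁ : ℝ) ≤ N := by exact_mod_cast h1N
    have h2N' : (n₂ : ℝ) ≤ N := by exact_mod_cast h2N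
    calc (n₁ + n₂) * r * Real.exp (-K) ≤ (N + N) * N * Real.exp (-((12 : ℕ) * x)) := by
          gcongr; push_cast; exact hK12
      _ = _ := by rw [hx, exp_neg_mul_log hN0', hy]; field_simp; norm_num
  have b3 : 2 * N ^ 2 * Real.exp (-(1 / (256 * ν))) ≤ 2 * y := by
    have h1 : 12 * x ≤ 1 / (256 * ν) := by
      rw [le_div_iff₀ (by positivity)]
      have h3 : 12 * x * (256 * ν) = 3072 * ρ / x := by rw [hν]; field_simp; norm_num
      rw [h3, div_le_iff₀ hx0]
      linarith
    calc 2 * N ^ 2 * Real.exp (-(1 / (256 * ν))) ≤ 2 * N ^ 2 * Real.exp (-((12 : ℕ) * x)) := by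
          gcongr; push_cast; exact h1
      _ = _ := by rw [hx, exp_neg_mul_log hN0', hy]; field_simp
  have b4 : k * (2 * N ^ 2 * Real.exp (-(q / (32 * ν))) + Real.exp (-N)) ≤ 10 * y + 5 * (f * y) := by
    have hkN : (k : ℝ) ≤ 5 * N := by linarith
    have h1 : 0 ≤ 2 * N ^ 2 * Real.exp (-(q / (32 * ν))) + Real.exp (-N) := by positivity
    calc _ ≤ 5 * N * (2 * N ^ 2 * Real.exp (-(q / (32 * ν))) + Real.exp (-N)) := by gcongr
      _ = 5 * N * (2 * N ^ 2 * Real.exp (-(q / (32 * ν)))) + 5 * (N * Real.exp (-N)) := by ring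
      _ ≤ 5 * N * (2 * y * (N : ℝ)⁻¹) + 5 * (f * y) := by gcongr
      _ = _ := by field_simp; ring
  linarith

lemma exp_neg_mul_le_pow_inv {p M N : ℝ} (hp : 0 < p) (hN : 0 < N) (hNM : N ≤ M) :
    Real.exp (-(p / 2 / 4 * M)) ≤ Nat.factorial 10 * (8 / p) ^ 10 * (N ^ 10)⁻¹ := by
  calc Real.exp (-(p / 2 / 4 * M)) ≤ Real.exp (-(p / 2 / 4 * N)) := by gcongr
    _ = Real.exp (-(p / 8 * N)) := by ring_nf
    _ ≤ Nat.factorial 10 * ((p / 8 * N) ^ 10)⁻¹ := exp_neg_le_factorial_mul (by positivity) 10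
    _ = _ := by rw [mul_pow, mul_inv, ← inv_pow (p / 8), inv_div]; ring

set_option maxHeartbeats 1000000 in
/-- The quantitative form of the theorem for dimensions with `log N ≥ 1`. -/
lemma uniformProb_ge {p : ℝ} (hp : 0 < p) (hpsmall : p ≤ 1 / 82944)
    (hps : ∀ t : ℝ, 1 - p + p * Real.cosh t ≤ Real.exp ((1 / 144 : ℝ) ^ 2 * t ^ 2 / 2))
    {ρ : ℝ} (hρ0 : 0 < ρ) (hρ : ρ ≤ (1 / 2880) ^ 2) (hρp : ρ ≤ p / 2) {n₁ n₂ N : ℕ}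
    (h1N : n₁ ≤ N) (h2N : n₂ ≤ N) (hNle : N ≤ n₁ * n₂) (hlog : 1 ≤ Real.log N) (hn₁ : 0 < n₁)
    (hn₂ : 0 < n₂)
    (L S : Matrix (Fin n₁) (Fin n₂) ℝ) {μ : ℝ} (hL : Incoherent L μ)
    (hr₁ : L.rank * μ * Real.log N ^ 2 ≤ ρ * n₁) (hr₂ : L.rank * μ * Real.log N ^ 2 ≤ ρ * n₂)
    (hr : L.rank * μ * Real.log N ^ 2 * N ≤ ρ * (n₁ * n₂)) {m : ℕ}
    (hm : (m : ℝ) ≤ p / 8 * (n₁ * n₂)) :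
    1 - (14 + 7 * Nat.factorial 11 + Nat.factorial 10 * (8 / p) ^ 10) * ((N : ℝ) ^ 10)⁻¹ ≤
      uniformProb m fun Ω => IsExact (1 / √(N : ℝ)) L (restrict Ω S) := by
  obtain ⟨U, τ, V, hsvd, hUμ, hVμ, hUVμ⟩ := hL
  set x := Real.log N with hx
  have hx0 : 0 < x := by linarith
  have hN1 : 1 < N := one_lt_of_one_le_log hlog
  have hN0 : (0 : ℝ) < N := by exact_mod_cast (by omega : 0 < N)
  have hxN : x ≤ N := Real.log_le_self hN0.le
  have hs0 : 0 < √(N : ℝ) := Real.sqrt_pos.2 hN0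
  have hn₁' : (0 : ℝ) < n₁ := by exact_mod_cast hn₁
  have hn₂' : (0 : ℝ) < n₂ := by exact_mod_cast hn₂
  -- The leverage bound from the rank condition. One logarithm offsets 1/q ≤ 10 log N, and the other
  -- makes the failure exponents multiples of log N.
  set ν := ρ / x ^ 2 with hν
  have hν0 : 0 < ν := by positivity
  have hUν : ∀ i, ∑ k, U i k ^ 2 ≤ ν := fun i => (hUμ i).trans (by
    rw [hν, div_le_div_iff₀ hn₁' (by positivity)]; linarith)
  have hVν : ∀ j, ∑ k, V j k ^ 2 ≤ ν := fun j => (hVμ j).trans (by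
    rw [hν, div_le_div_iff₀ hn₂' (by positivity)]; linarith)
  set t := √ρ with ht
  have ht0 : 0 < t := Real.sqrt_pos.2 hρ0
  have ht1 : t ≤ 1 / 2880 := by
    rw [ht, Real.sqrt_le_left (by norm_num)]; exact hρ
  -- Bounds the entries of UVᵀ by the third incoherence condition; the factor 1/log N pays for
  -- dividing by q. The condition √ρ ≤ 1/2880 is 720√ρ ≤ 1/4, as used in `c1`.
  set z := t / x / √N with hz
  have hz0 : 0 < z := by positivity
  have hUVz : ∀ i j, |(U * Vᵀ) i j| ≤ z := by
    intro i j
    refine (hUVμ i j).trans (Real.sqrt_le_iff.2 ⟨hz0.le, ?_⟩)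
    have : z ^ 2 = ρ / (x ^ 2 * N) := by
      rw [hz, div_pow, div_pow, ht, Real.sq_sqrt hρ0.le, Real.sq_sqrt hN0.le, div_div]
    rw [this, div_le_div_iff₀ (by positivity) (by positivity)]
    linarith
  -- Large enough for N · 2^(-k) ≤ 1, small enough for 1/q ≤ 2k ≤ 10 log N.
  set k := ⌈4 * x⌉₊ with hk
  have hk4 : 4 * x ≤ k := Nat.le_ceil _
  have hk5 : (k : ℝ) ≤ 5 * x := by
    have := Nat.ceil_lt_add_one (by positivity : 0 ≤ 4 * x)
    linarith
  have hk0 : 0 < k := by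
    have : (0 : ℝ) < k := by linarith
    exact_mod_cast this
  obtain ⟨q, hq0, hq1, hqp, hqk⟩ := exists_batch_density hp (by linarith) hk0
  have hqx : 1 / q ≤ 10 * x := by linarith
  set K := ⌈12 * x⌉₊ with hK
  have hK12 : 12 * x ≤ K := Nat.le_ceil _
  have hK13 : (K : ℝ) ≤ 13 * x := by
    have := Nat.ceil_lt_add_one (by positivity : 0 ≤ 12 * x)
    linarith
  have hKν : 2 * K * ν ≤ 24 * p := by
    have h1 : x * ν ≤ ρ := by
      rw [hν, mul_div_assoc', div_le_iff₀ (by positivity)]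
      linarith [mul_nonneg (mul_pos hρ0 hx0).le (sub_nonneg.2 hlog)]
    linarith [mul_le_mul_of_nonneg_right hK13 hν0.le]
  have hzq : z / q ≤ 10 * t / √N := by
    calc z / q = z * (1 / q) := by ring
      _ ≤ z * (10 * x) := by gcongr
      _ = _ := by rw [hz]; field_simp
  have c1 : 72 * z / q * √N ≤ 1 / 4 := by
    calc 72 * z / q * √N = 72 * (z / q) * √N := by ring
      _ ≤ 72 * (10 * t / √N) * √N := by gcongr
      _ = 720 * t := by field_simp; norm_num
      _ ≤ _ := by linarith
  have c2 : 2 * z / q ≤ 1 / √N / 8 := by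
    calc 2 * z / q = 2 * (z / q) := by ring
      _ ≤ 2 * (10 * t / √N) := by gcongr
      _ = 20 * t / √N := by ring
      _ ≤ 1 / 8 / √N := by gcongr; linarith
      _ = _ := by ring
  have c3 : z ≤ 1 / √N / 8 := by
    calc z ≤ t / 1 / √N := by rw [hz]; gcongr
      _ ≤ 1 / 8 / 1 / √N := by gcongr; linarith
      _ = _ := by ring
  have c4 : N * (1 / 2 : ℝ) ^ k ≤ 1 := natCast_mul_half_pow_le hN0 (by linarith)
  have hmain := Pr_exact_agree h1N h2N hN1 hsvd.orthU hsvd.orthV hsvd.pos hsvd.eq hν0 hUν hVν hp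
    hpsmall (s := 1 / 144) (by norm_num) (by norm_num) hps hKν hq0 hq1 hqp hz0 hUVz c1 c2 c3 c4 S
  -- Quantifying over all matrices made of entries of S inside Ω, instead of the restriction of S
  -- alone, makes the property decreasing in Ω by definition.
  let E : Finset (Fin n₁ × Fin n₂) → Prop := fun Ω => ∀ S' : Matrix (Fin n₁) (Fin n₂) ℝ,
    (∀ i j, S' i j ≠ 0 → (i, j) ∈ Ω ∧ S' i j = S i j) → IsExact (1 / √(N : ℝ)) L S'
  have hE : ∀ s u, s ⊆ u → E u → E s := fun s u hsu h S' hS' =>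
    h S' fun i j hij => ⟨hsu (hS' i j hij).1, (hS' i j hij).2⟩
  have hπ0 : 0 ≤ p / 2 := by positivity
  have hπ1 : p / 2 ≤ 1 := by linarith
  have hev : Pr (piW fun _ : Fin n₁ × Fin n₂ => bern (p / 2)) (fun ω => ¬ E (trueSet ω)) =
      Pr (piW fun _ : Fin n₁ × Fin n₂ => bern (p / 2)) (fun Ω =>
        ¬ ∀ S' : Matrix (Fin n₁) (Fin n₂) ℝ, (∀ i j, S' i j ≠ 0 → Ω (i, j) ∧ S' i j = S i j) →
          IsExact (1 / √(N : ℝ)) L S') := by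
    congr 1
    ext ω
    simp [E, trueSet]
  rw [← hev] at hmain
  have htrans := Pr_bern_le_proportion hπ0 hπ1 hE m
  rw [(isProb_piW fun _ : Fin n₁ × Fin n₂ => isProb_bern hπ0 hπ1).Pr_eq_one_sub] at htrans
  have hcard : (Fintype.card (Fin n₁ × Fin n₂) : ℝ) = n₁ * n₂ := by simp
  have htail := Pr_card_lt_le (ι := Fin n₁ × Fin n₂) hπ0 hπ1 (m := m) (by rw [hcard]; linarith)
  have hprop : proportion E m ≤
      uniformProb m fun Ω => IsExact (1 / √(N : ℝ)) L (restrict Ω S) := by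
    refine proportion_mono (F := fun Ω => IsExact (1 / √(N : ℝ)) L (restrict Ω S)) (fun Ω h => ?_) m
    refine h _ fun i j hij => ?_
    by_cases hΩ : (i, j) ∈ Ω
    · exact ⟨hΩ, by simp [restrict, hΩ]⟩
    · simp [restrict, hΩ] at hij
  have hfail := failure_bound (r := L.rank) hx hlog h1N h2N (L.rank_le_width.trans h2N) hρ0
    (hρ.trans (by norm_num)) hk5 hq0 hqx hK12 rfl
  have hNle' : (N : ℝ) ≤ Fintype.card (Fin n₁ × Fin n₂) := by
    rw [hcard]; exact_mod_cast hNle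
  have b5 := exp_neg_mul_le_pow_inv hp hN0 hNle'
  refine le_trans ?_ hprop
  rw [add_mul]
  have hmain' := hmain.trans hfail
  have htail' := htail.trans b5
  linarith only [hmain', htail', htrans]

theorem exact_recovery_rectangular : ∃ c ρr ρs : ℝ, 0 < c ∧ 0 < ρr ∧ 0 < ρs ∧
    ∀ (n₁ n₂ : ℕ) (L₀ S : Matrix (Fin n₁) (Fin n₂) ℝ) (μ : ℝ) (m : ℕ),
      0 < n₁ → 0 < n₂ → 0 < μ → Incoherent L₀ μ →
      (L₀.rank : ℝ) * μ * Real.log (max n₁ n₂ : ℕ) ^ 2 ≤ ρr * (min n₁ n₂ : ℕ) →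
      (m : ℝ) ≤ ρs * (n₁ * n₂ : ℝ) →
      1 - c * ((max n₁ n₂ : ℕ) : ℝ) ^ (-10 : ℤ) ≤
        uniformProb m fun Ω =>
          IsExact (1 / √((max n₁ n₂ : ℕ) : ℝ)) L₀ (restrict Ω S) := by
  obtain ⟨p₀, hp₀, hps⟩ := exists_sparse_sign_mgf (s := 1 / 144) (by norm_num)
  set p := min p₀ (1 / 82944) with hp
  have hp0 : 0 < p := lt_min hp₀ (by norm_num)
  have hpsmall : p ≤ 1 / 82944 := min_le_right _ _
  set ρ := min ((1 / 2880) ^ 2) (p / 2) with hρ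
  have hρ0 : 0 < ρ := lt_min (by norm_num) (by positivity)
  set c₀ : ℝ := 14 + 7 * Nat.factorial 11 + Nat.factorial 10 * (8 / p) ^ 10 with hc₀
  have hc₀0 : 0 < c₀ := by positivity
  -- The summand 3¹⁰ makes the claim trivial for N ≤ 2, where log N < 1. The density p/8 is a
  -- quarter of the Bernoulli density p/2, as the lower tail bound on the cardinality requires.
  refine ⟨c₀ + 3 ^ 10, ρ, p / 8, by positivity, hρ0, by positivity, ?_⟩
  intro n₁ n₂ L S μ m hn₁ hn₂ hμ hL hr hm
  set N := max n₁ n₂ with hN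
  have hN0 : 0 < N := lt_of_lt_of_le hn₁ (le_max_left _ _)
  have hN0' : (0 : ℝ) < N := by exact_mod_cast hN0
  have hzpow : (N : ℝ) ^ (-10 : ℤ) = ((N : ℝ) ^ 10)⁻¹ := by
    rw [_root_.zpow_neg]; norm_cast
  rw [hzpow]
  rcases le_or_gt N 2 with hsmall | hlarge
  · have h1 : (N : ℝ) ^ 10 ≤ 3 ^ 10 := by
      gcongr
      exact_mod_cast (by omega : N ≤ 3)
    have h2 : 1 ≤ (c₀ + 3 ^ 10) * ((N : ℝ) ^ 10)⁻¹ := by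
      rw [← div_eq_mul_inv, one_le_div (by positivity)]
      linarith
    have h3 : 0 ≤ uniformProb m fun Ω => IsExact (1 / √(N : ℝ)) L (restrict Ω S) :=
      proportion_nonneg (fun Ω => IsExact (1 / √(N : ℝ)) L (restrict Ω S)) m
    linarith
  · have hlog : 1 ≤ Real.log N := by
      rw [Real.le_log_iff_exp_le hN0']
      have : (3 : ℝ) ≤ N := by exact_mod_cast hlarge
      linarith [Real.exp_one_lt_d9]
    have hmin₁ : ((min n₁ n₂ : ℕ) : ℝ) ≤ n₁ := by exact_mod_cast min_le_left _ _
    have hmin₂ : ((min n₁ n₂ : ℕ) : ℝ) ≤ n₂ := by exact_mod_cast min_le_right _ _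
    have hmul : (min n₁ n₂ : ℕ) * N = n₁ * n₂ := by
      rw [hN]; exact min_mul_max n₁ n₂
    have hmul' : ((min n₁ n₂ : ℕ) : ℝ) * N = n₁ * n₂ := by exact_mod_cast hmul
    have hNle : N ≤ n₁ * n₂ := by
      rw [← hmul]
      exact Nat.le_mul_of_pos_left _ (lt_min hn₁ hn₂)
    have h := uniformProb_ge hp0 hpsmall
      (fun t => hps p hp0.le (min_le_left _ _) (by linarith) t) hρ0 (min_le_left _ _)
      (min_le_right _ _) (le_max_left n₁ n₂) (le_max_right n₁ n₂) hNle hlog hn₁ hn₂ L S hL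
      (hr.trans (by gcongr)) (hr.trans (by gcongr))
      ((mul_le_mul_of_nonneg_right hr hN0'.le).trans_eq (by rw [mul_assoc, hmul'])) hm
    refine le_trans ?_ h
    have : 0 < ((N : ℝ) ^ 10)⁻¹ := by positivity
    nlinarith

end
end PCP


theorem theorem1p1 :
    ∃ c ρr ρs : ℝ, 0 < c ∧ 0 < ρr ∧ 0 < ρs ∧
      -- square matrices
      (∀ (n : ℕ) (L₀ S : Matrix (Fin n) (Fin n) ℝ) (μ : ℝ) (m : ℕ),
        0 < n → 0 < μ → PCP.Incoherent L₀ μ →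
        (L₀.rank : ℝ) * μ * Real.log n ^ 2 ≤ ρr * n →
        (m : ℝ) ≤ ρs * (n : ℝ) ^ 2 →
        1 - c * (n : ℝ) ^ (-10 : ℤ) ≤
          PCP.uniformProb m fun Ω => PCP.IsExact (1 / √(n : ℝ)) L₀ (PCP.restrict Ω S)) ∧
      -- rectangular matrices
      (∀ (n₁ n₂ : ℕ) (L₀ S : Matrix (Fin n₁) (Fin n₂) ℝ) (μ : ℝ) (m : ℕ),
        0 < n₁ → 0 < n₂ → 0 < μ → PCP.Incoherent L₀ μ →
        (L₀.rank : ℝ) * μ * Real.log (max n₁ n₂ : ℕ) ^ 2 ≤ ρr * (min n₁ n₂ : ℕ) →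
        (m : ℝ) ≤ ρs * (n₁ * n₂ : ℝ) →
        1 - c * ((max n₁ n₂ : ℕ) : ℝ) ^ (-10 : ℤ) ≤
          PCP.uniformProb m fun Ω =>
            PCP.IsExact (1 / √((max n₁ n₂ : ℕ) : ℝ)) L₀ (PCP.restrict Ω S)) := by
  obtain ⟨c, ρr, ρs, hc, hr, hs, h⟩ := PCP.exact_recovery_rectangular
  refine ⟨c, ρr, ρs, hc, hr, hs, fun n L₀ S μ m hn hμ hL hrank hm => ?_, h⟩
  have := h n n L₀ S μ m hn hn hμ hL (by simpa using hrank) (by rw [← sq]; exact hm)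
  simpa only [max_self] using this
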